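/- Let $1\le k\le n$ be integers, $\alpha\in\mathbb R$, and let $\Omega\subset\mathbb R^n$ be a bounded open set. For a positive $C^2$ function $w$ put $A_{ij}(w)=w\,w_{ij}-\tfrac12|\nabla w|^2\delta_{ij}$ and $S_m(w)=\sigma_m(\lambda\{A_{ij}(w)\})$, where $\lambda\{\cdot\}$ denotes the vector of eigenvalues and $\sigma_m$ the $m$-th elementary symmetric function ($\sigma_0=1$). Let $\Gamma_k=\{\lambda\in\mathbb R^n:\sigma_i(\lambda)\ge 0,\ 1\le i\le k\}$, let $\tilde\Phi^k(\Omega)$ be the set of $w\in C^2(\Omega)$ with $w>0$ and $\lambda\{A_{ij}(w)\}\in\Gamma_k$ in $\Omega$, and let $\Phi^k(\Omega)$ be the set of $w\in L^1_{loc}(\Omega)$, $w>0$ in $\Omega$, that are limits in $L^1_{loc}(\Omega)$ of sequences in $\tilde\Phi^k(\Omega)$. Here $C^2(\bar\Omega)$ is the set of functions that are $C^2$ in $\Omega$ and that, together with their first and second derivatives, extend continuously to $\bar\Omega$. Let $b_0=k$ and let $b_1,\dots,b_k\ge 0$ be real numbers such that $$b_0\big[\alpha+k+(\alpha+n+1)k\big]-2k\,b_1<0,$$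 $$b_k\big[\alpha+kn+2k(\alpha+n+k+1)\big]-\tfrac12(\alpha+n+k-1)\,n\,b_{k-1}-4k(\alpha+n+k)b_k+b_{k-1}(\alpha+n+k)(\alpha+n+k-1)\le 0,$$ $$b_l\big[\alpha+k-l+l(n+l-k)+(\alpha+n+l+1)(k+l)\big]-2(l+1)(k+l)b_{l+1}-\tfrac12(\alpha+n+l-1)(n+l-k)b_{l-1}\le 0\quad\text{for }1\le l\le k-1,$$ $$b_l(\alpha+n+l+1)(\alpha+n+l)-4(l+1)(\alpha+n+l+1)b_{l+1}+4(l+2)(l+1)b_{l+2}\le 0\quad\text{for }0\le l\le k-2.$$ Let $u,v\in C^2(\bar\Omega)\cap\Phi^k(\Omega)$, with $v>0$ on $\partial\Omega$, satisfy $$\sum_{l=0}^k b_l v^\alpha|\nabla v|^{2l}S_{k-l}(v)\le\sum_{l=0}^k b_l u^\alpha|\nabla u|^{2l}S_{k-l}(u)\ \text{ in }\Omega,\qquad v\ge u\ \text{ on }\partial\Omega.$$ Then $u\le v$ in $\Omega$. -/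

import Mathlib

open Filter Topology MeasureTheory

noncomputable section

namespace SigmaYamabe

variable {n : ℕ}

/-- The elementary symmetric function `σ_k` of a vector of `ℝⁿ`. -/
def sigma (k : ℕ) (lam : Fin n → ℝ) : ℝ :=
  ∑ s ∈ Finset.powersetCard k (Finset.univ : Finset (Fin n)), ∏ i ∈ s, lam i

/-- The (closed) Garding cone `Γ_k`. -/
def gardingCone (n k : ℕ) : Set (Fin n → ℝ) :=
  {lam | ∀ i : ℕ, 1 ≤ i → i ≤ k → 0 ≤ sigma i lam}

open Classical in
/-- The vector of eigenvalues, with multiplicity, of a real symmetric matrix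
(and `0` for a matrix that is not symmetric, which plays no role below). -/
def eigenvec (A : Matrix (Fin n) (Fin n) ℝ) : Fin n → ℝ :=
  if h : A.IsHermitian then h.eigenvalues else 0

/-- The Hessian matrix `(v_{ij})`. -/
def hessian (v : EuclideanSpace ℝ (Fin n) → ℝ) (x : EuclideanSpace ℝ (Fin n)) :
    Matrix (Fin n) (Fin n) ℝ :=
  Matrix.of fun i j =>
    fderiv ℝ (fderiv ℝ v) x (EuclideanSpace.single i 1) (EuclideanSpace.single j 1)

/-- The matrix `A_{ij}(v) = v v_{ij} - (1/2) |∇v|² δ_{ij}`. -/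
def schouten (v : EuclideanSpace ℝ (Fin n) → ℝ) (x : EuclideanSpace ℝ (Fin n)) :
    Matrix (Fin n) (Fin n) ℝ :=
  v x • hessian v x - ((1 / 2 : ℝ) * ‖gradient v x‖ ^ 2) • (1 : Matrix (Fin n) (Fin n) ℝ)

/-- The `σ_k`-Yamabe operator `S_k(v) = σ_k(λ{A_{ij}(v)})`. -/
def yamabeOp (k : ℕ) (v : EuclideanSpace ℝ (Fin n) → ℝ) (x : EuclideanSpace ℝ (Fin n)) : ℝ :=
  sigma k (eigenvec (schouten v x))

/-- `ψ(w) = ∑_{l=0}^k b_l w^α |∇w|^{2l} S_{k-l}(w)`. -/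
def psi (k : ℕ) (α : ℝ) (b : ℕ → ℝ) (w : EuclideanSpace ℝ (Fin n) → ℝ)
    (x : EuclideanSpace ℝ (Fin n)) : ℝ :=
  ∑ l ∈ Finset.range (k + 1),
    b l * (w x) ^ α * ‖gradient w x‖ ^ (2 * l) * yamabeOp (k - l) w x

/-- The class of positive `C²` functions on `Ω` with `λ{A_{ij}(u)} ∈ Γ_k` at each point. -/
def PhiTilde (k : ℕ) (Ω : Set (EuclideanSpace ℝ (Fin n))) :
    Set (EuclideanSpace ℝ (Fin n) → ℝ) :=
  {u | ContDiffOn ℝ 2 u Ω ∧ ∀ x ∈ Ω, 0 < u x ∧ eigenvec (schouten u x) ∈ gardingCone n k}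

/-- The class of positive `L¹_loc(Ω)` functions that are limits in `L¹_loc(Ω)` of sequences
in `PhiTilde k Ω`. -/
def Phi (k : ℕ) (Ω : Set (EuclideanSpace ℝ (Fin n))) :
    Set (EuclideanSpace ℝ (Fin n) → ℝ) :=
  {u | LocallyIntegrableOn u Ω ∧ (∀ x ∈ Ω, 0 < u x) ∧
    ∃ U : ℕ → EuclideanSpace ℝ (Fin n) → ℝ, (∀ m, U m ∈ PhiTilde k Ω) ∧
      ∀ K ⊆ Ω, IsCompact K →
        Tendsto (fun m => eLpNorm (U m - u) 1 (volume.restrict K)) atTop (𝓝 0)}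

/-- `u ∈ C²(closure Ω)`: `u` is `C²` in the open set `Ω`, continuous on its closure, and its
first and second derivatives extend continuously from `Ω` to its closure. -/
def IsC2OnClosure (Ω : Set (EuclideanSpace ℝ (Fin n)))
    (u : EuclideanSpace ℝ (Fin n) → ℝ) : Prop :=
  ContDiffOn ℝ 2 u Ω ∧ ContinuousOn u (closure Ω) ∧
  (∃ G, ContinuousOn G (closure Ω) ∧ Set.EqOn G (fderiv ℝ u) Ω) ∧
  (∃ H, ContinuousOn H (closure Ω) ∧ Set.EqOn H (fderiv ℝ (fderiv ℝ u)) Ω)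

end SigmaYamabe

end

/-!
The comparison principle holds because, for jets whose matrix lies in the Gårding cone, the formal
adjoint of the linearization of `ψ(w) = ∑ b_l w^α |∇w|^(2l) S_(k-l)(w)` is nonpositive when applied
to the constant `1`.

The Newton tensors `T_m(A)` of `A(w) = w D²w - (1/2) |∇w|² I` satisfy
`w div T_m = n T_m ∇w - (n - m) σ_m ∇w` (`sum_dnewtonT`): third derivatives of `w` do not enter.
Therefore the divergence of the tensor `X = w^(α+1) |∇w|^(2l) T_m(A)` depends only on the 2-jet
of `w` (`sum_dtensorX`), and by mollification the weak form of that identity holds for `w` of class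
`C²` (`integral_tensorX`). Hence the linearization of `ψ` at `w` is a second order operator in
divergence form, plus first and zeroth order terms, and its adjoint applied to `1` is an explicit
function `adjointOne` of the 2-jet. The inequalities for `α` and the `b_l` ensure that, on the
Gårding cone, `adjointOne ≤ κ w^(α-1) S_k(w)` with `κ < 0` (`adjointOne_le`).

Suppose now that `v < u` somewhere and put `w_t = v + t (u - v)`. Functions of class `C²` that are
`L¹_loc` limits of admissible functions are admissible (`jetA_mem_matCone_of_mem_Phi`). Since
`A(w) / w` is superadditive (`jetA_combination`), all `w_t` are admissible, so that the Newton
tensors of `A(w_t)` are positive semidefinite and the second order part is degenerate elliptic.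
Let `G` be a smooth nondecreasing cutoff of the Heaviside function at level `δ`, with primitive `Γ`.
By the first variation formula (`hasDerivAt_integral_psiJet`) the derivative of
`I(t) = ∫ G(u - v) ψ(w_t)` is the sum of a nonpositive gradient term, of an error that is
`O(δ)` because `G(s) s - Γ(s) = O(δ)`, and of `∫ Γ(u - v) adjointOne(w_t) ≤ 0`. By a maximum
principle (`exists_sig_pos`) there is a point with `v < u` at which `S_k(v) > 0`; near that point and
for small `t` the last term is bounded away from `0`, uniformly in `δ`. So `I(1) < I(0)` for small
`δ`, whereas `ψ(v) ≤ ψ(u)` gives `I(0) ≤ I(1)`.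

The Gårding cone of matrices is described by the polynomials `sig A m` in the entries of `A`, and its
convexity is derived from the Marcus–Lopes inequality for elementary symmetric functions.
-/

open Filter Topology MeasureTheory

namespace SigmaYamabe

noncomputable section

/-! ### Elementary symmetric functions and the Gårding cone -/

section GardingCone

variable {ι : Type*}

/-- The elementary symmetric function `e_m` of the entries `x i`, `i ∈ s`. -/
def esym (s : Finset ι) (m : ℕ) (x : ι → ℝ) : ℝ :=
  ∑ t ∈ Finset.powersetCard m s, ∏ i ∈ t, x i

lemma esym_zero (s : Finset ι) (x : ι → ℝ) : esym s 0 x = 1 := by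
  simp [esym]

lemma esym_eq_zero {s : Finset ι} {m : ℕ} (h : s.card < m) (x : ι → ℝ) : esym s m x = 0 := by
  simp [esym, Finset.powersetCard_eq_empty.2 h]

lemma esym_insert [DecidableEq ι] {s : Finset ι} {a : ι} (ha : a ∉ s) (m : ℕ) (x : ι → ℝ) :
    esym (insert a s) (m + 1) x = esym s (m + 1) x + x a * esym s m x := by
  unfold esym
  rw [Finset.powersetCard_succ_insert ha, Finset.sum_union, Finset.sum_image, Finset.mul_sum]
  · congr 1
    refine Finset.sum_congr rfl fun t ht => ?_
    rw [Finset.prod_insert]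
    exact fun h => ha ((Finset.mem_powersetCard.1 ht).1 h)
  · intro t ht t' ht' h
    have h1 : a ∉ t := fun h => ha ((Finset.mem_powersetCard.1 ht).1 h)
    have h2 : a ∉ t' := fun h => ha ((Finset.mem_powersetCard.1 ht').1 h)
    rw [← Finset.erase_insert h1, ← Finset.erase_insert h2, h]
  · rw [Finset.disjoint_left]
    intro t ht ht'
    obtain ⟨t', _, rfl⟩ := Finset.mem_image.1 ht'
    exact ha ((Finset.mem_powersetCard.1 ht).1 (Finset.mem_insert_self _ _))

lemma esym_erase [DecidableEq ι] {s : Finset ι} {a : ι} (ha : a ∈ s) (m : ℕ) (x : ι → ℝ) :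
    esym s (m + 1) x = esym (s.erase a) (m + 1) x + x a * esym (s.erase a) m x := by
  conv_lhs => rw [← Finset.insert_erase ha]
  exact esym_insert (Finset.notMem_erase a s) m x

lemma sum_mul_esym_erase [DecidableEq ι] (s : Finset ι) (m : ℕ) (x : ι → ℝ) :
    ∑ i ∈ s, x i * esym (s.erase i) m x = (m + 1) * esym s (m + 1) x := by
  induction s using Finset.induction_on generalizing m with
  | empty => rw [esym_eq_zero (by simp)]; simp
  | insert a s ha ih =>
    rw [Finset.sum_insert ha, Finset.erase_insert ha, esym_insert ha]
    have h1 : ∀ i ∈ s, (insert a s).erase i = insert a (s.erase i) := fun i hi =>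
      Finset.erase_insert_of_ne (fun h => ha (h ▸ hi))
    have h2 : ∀ i ∈ s, a ∉ s.erase i := fun i _ h => ha (Finset.mem_of_mem_erase h)
    cases m with
    | zero =>
      have := ih 0
      simp only [esym_zero, mul_one] at this ⊢
      rw [this]; push_cast; ring
    | succ m =>
      have h3 : ∀ i ∈ s, x i * esym ((insert a s).erase i) (m + 1) x
          = x i * esym (s.erase i) (m + 1) x + x a * (x i * esym (s.erase i) m x) := by
        intro i hi
        rw [h1 i hi, esym_insert (h2 i hi)]; ring
      rw [Finset.sum_congr rfl h3, Finset.sum_add_distrib, ← Finset.mul_sum, ih, ih]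
      push_cast; ring

open Polynomial in
lemma splits_derivative {p : ℝ[X]} (hp : p.Splits) : (derivative p).Splits := by
  rw [splits_iff_card_roots] at hp ⊢
  have h1 := p.card_roots_le_derivative
  have h2 := natDegree_derivative_le p
  have h3 := (derivative p).card_roots'
  omega

open Polynomial in
/-- Laguerre's inequality for real-rooted polynomials. -/
lemma eval_mul_eval_derivative_two_le {p : ℝ[X]} (hp : p.Splits) (x : ℝ) :
    p.eval x * (derivative (derivative p)).eval x ≤ ((derivative p).eval x) ^ 2 := by
  have key : ∀ m : Multiset ℝ, ∀ x : ℝ,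
      ((m.map fun a => X - C a).prod).eval x *
        (derivative (derivative (m.map fun a => X - C a).prod)).eval x ≤
        ((derivative (m.map fun a => X - C a).prod).eval x) ^ 2 := by
    intro m x
    induction m using Multiset.induction_on with
    | empty => simp
    | cons a m ih =>
      set g := (m.map fun a => X - C a).prod
      simp only [Multiset.map_cons, Multiset.prod_cons, derivative_mul, derivative_sub,
        derivative_X, derivative_C, eval_add, eval_mul, eval_sub, eval_X, eval_C, sub_zero,
        one_mul, derivative_add]
      nlinarith [mul_nonneg (sq_nonneg (x - a)) (sub_nonneg.2 ih), sq_nonneg (eval x g)]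
  rw [hp.eq_prod_roots]
  simp only [derivative_C_mul, eval_mul, eval_C]
  nlinarith [mul_nonneg (sq_nonneg p.leadingCoeff) (sub_nonneg.2 (key p.roots x))]

open Polynomial in
lemma esym_eq_coeff {s : Finset ι} {m : ℕ} (h : m ≤ s.card) (x : ι → ℝ) :
    esym s m x = (∏ i ∈ s, (X + C (x i))).coeff (s.card - m) := by
  rw [Finset.prod_X_add_C_coeff s x (Nat.sub_le _ _), Nat.sub_sub_self h]; rfl

open Polynomial in
/-- Newton's inequality, without its binomial factors; the entries of `x` may have any sign. -/
lemma esym_newton [DecidableEq ι] (s : Finset ι) (m : ℕ) (x : ι → ℝ) :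
    esym s m x * esym s (m + 2) x ≤ esym s (m + 1) x ^ 2 := by
  rcases Nat.lt_or_ge s.card (m + 2) with h | h
  · rw [esym_eq_zero h, mul_zero]; positivity
  set p : ℝ[X] := ∏ i ∈ s, (X + C (x i)) with hp
  have hs : p.Splits := by
    rw [hp]
    exact Splits.prod fun i _ => Splits.X_add_C _
  have hd : ∀ j, (derivative^[j] p).Splits := by
    intro j
    induction j with
    | zero => exact hs
    | succ j ih => rw [Function.iterate_succ_apply']; exact splits_derivative ih
  obtain ⟨j, hj⟩ : ∃ j, s.card = m + 2 + j := ⟨s.card - (m + 2), by omega⟩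
  have e0 := esym_eq_coeff (s := s) (m := m) (by omega) x
  have e1 := esym_eq_coeff (s := s) (m := m + 1) (by omega) x
  have e2 := esym_eq_coeff (s := s) (m := m + 2) (by omega) x
  rw [show s.card - m = j + 2 by omega] at e0
  rw [show s.card - (m + 1) = j + 1 by omega] at e1
  rw [show s.card - (m + 2) = j by omega] at e2
  have L := eval_mul_eval_derivative_two_le (hd j) 0
  rw [← Function.iterate_succ_apply' derivative, ← Function.iterate_succ_apply' derivative] at L
  simp only [← coeff_zero_eq_eval_zero, coeff_iterate_derivative, zero_add] at L
  rw [← hp] at e0 e1 e2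
  rw [← e0, ← e1, ← e2] at L
  simp only [Nat.descFactorial_self, nsmul_eq_mul, Nat.factorial_succ] at L
  push_cast at L
  set f : ℝ := (j.factorial : ℝ)
  have hf : 0 < f := by positivity
  have hj1 : (0 : ℝ) < (j : ℝ) + 1 := by positivity
  have L2 : ((j : ℝ) + 1 + 1) * (esym s m x * esym s (m + 2) x)
      ≤ ((j : ℝ) + 1) * esym s (m + 1) x ^ 2 := by
    have hpos : 0 < f ^ 2 * ((j : ℝ) + 1) := by positivity
    refine le_of_mul_le_mul_left ?_ hpos
    nlinarith [L]
  rcases le_or_gt (esym s m x * esym s (m + 2) x) 0 with h0 | h0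
  · exact h0.trans (sq_nonneg _)
  · refine le_of_mul_le_mul_left ?_ hj1
    nlinarith

/-- The open Gårding cone of the entries indexed by `s`. -/
def posCone (s : Finset ι) (k : ℕ) : Set (ι → ℝ) := {x | ∀ j ≤ k, 0 < esym s j x}

/-- The closed Gårding cone of the entries indexed by `s`. -/
def nonnegCone (s : Finset ι) (k : ℕ) : Set (ι → ℝ) := {x | ∀ j ≤ k, 0 ≤ esym s j x}

/-- Dropping one entry lowers the order of the cone by one; the induction on the order rests on
Newton's inequality for the remaining entries. -/
lemma posCone_erase [DecidableEq ι] {s : Finset ι} {k : ℕ} {x : ι → ℝ}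
    (hx : x ∈ posCone s (k + 1)) {i : ι} (hi : i ∈ s) : x ∈ posCone (s.erase i) k := by
  intro j hj
  induction j with
  | zero => rw [esym_zero]; exact one_pos
  | succ j ih =>
    have ih := ih (by omega)
    by_contra! hneg
    have h1 := hx (j + 1) (by omega)
    have h2 := hx (j + 2) (by omega)
    rw [esym_erase hi] at h1 h2
    have hN := esym_newton (s.erase i) j x
    set a := esym (s.erase i) j x
    set b := esym (s.erase i) (j + 1) x
    set c := esym (s.erase i) (j + 2) x
    nlinarith [mul_pos ih h2, mul_nonneg (neg_nonneg.2 hneg) h1.le]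

open Polynomial in
/-- Adding a positive constant to every entry moves the closed cone into the open one: expanded in
`ε`, `e_m(x + ε)` has nonnegative coefficients and a positive coefficient at `ε ^ m`. -/
lemma esym_add_const_pos {s : Finset ι} {m : ℕ} (hm : m ≤ s.card) {x : ι → ℝ}
    (hx : x ∈ nonnegCone s m) {ε : ℝ} (hε : 0 < ε) : 0 < esym s m (fun i => x i + ε) := by
  set p : ℝ[X] := ∏ i ∈ s, (X + C (x i)) with hp
  have h1 : ∏ i ∈ s, (X + C (x i + ε)) = taylor ε p := by
    rw [hp, ← taylorAlgHom_apply, map_prod]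
    refine Finset.prod_congr rfl fun i _ => ?_
    simp [taylor_X]; ring
  rw [esym_eq_coeff hm, h1, taylor_coeff, hasseDeriv_apply]
  have hdeg : p.natDegree = s.card := by
    rw [hp, natDegree_prod_of_monic _ _ fun i _ => monic_X_add_C _]; simp
  have hmon : p.Monic := monic_prod_of_monic _ _ fun i _ => monic_X_add_C _
  have hcoef : ∀ i ≤ s.card, p.coeff i = esym s (s.card - i) x := by
    intro i hi
    rw [esym_eq_coeff (Nat.sub_le _ _), Nat.sub_sub_self hi]
  rw [sum_over_range' _ (by simp) (s.card + 1) (by omega), eval_finsetSum]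
  simp only [eval_monomial]
  refine Finset.sum_pos' ?_ ⟨s.card, by simp, ?_⟩
  · intro i hi
    rw [Finset.mem_range] at hi
    rcases Nat.lt_or_ge i (s.card - m) with h | h
    · simp [Nat.choose_eq_zero_of_lt h]
    · have : 0 ≤ p.coeff i := by
        rw [hcoef i (by omega)]; exact hx _ (by omega)
      positivity
  · have h2 : p.coeff s.card = 1 := by rw [← hdeg]; exact hmon
    rw [h2]
    have : 0 < s.card.choose (s.card - m) := Nat.choose_pos (Nat.sub_le _ _)
    positivity

lemma add_const_mem_posCone {s : Finset ι} {k : ℕ} (hk : k ≤ s.card) {x : ι → ℝ}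
    (hx : x ∈ nonnegCone s k) {ε : ℝ} (hε : 0 < ε) : (fun i => x i + ε) ∈ posCone s k :=
  fun _ hj => esym_add_const_pos (hj.trans hk) (fun i hi => hx i (hi.trans hj)) hε

lemma continuous_esym (s : Finset ι) (m : ℕ) : Continuous (esym s m : (ι → ℝ) → ℝ) := by
  unfold esym; fun_prop

lemma mem_nonnegCone_of_forall_add {s : Finset ι} {k : ℕ} {x : ι → ℝ}
    (h : ∀ ε > 0, (fun i => x i + ε) ∈ nonnegCone s k) : x ∈ nonnegCone s k := by
  intro j hj
  have hc : Continuous fun ε : ℝ => esym s j (fun i => x i + ε) :=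
    (continuous_esym s j).comp (by fun_prop)
  have h1 : Tendsto (fun ε : ℝ => esym s j (fun i => x i + ε)) (𝓝[>] 0) (𝓝 (esym s j x)) := by
    have := (hc.tendsto 0).mono_left (nhdsWithin_le_nhds (s := Set.Ioi 0))
    simpa using this
  refine ge_of_tendsto h1 ?_
  filter_upwards [self_mem_nhdsWithin] with ε hε using h ε hε j hj

lemma posCone_subset (s : Finset ι) (k : ℕ) : (posCone s k : Set (ι → ℝ)) ⊆ nonnegCone s k :=
  fun _ hx j hj => (hx j hj).le

lemma nonnegCone_erase [DecidableEq ι] {s : Finset ι} {k : ℕ} (hk : k + 1 ≤ s.card) {x : ι → ℝ}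
    (hx : x ∈ nonnegCone s (k + 1)) {i : ι} (hi : i ∈ s) : x ∈ nonnegCone (s.erase i) k :=
  mem_nonnegCone_of_forall_add fun _ hε =>
    posCone_subset _ _ (posCone_erase (add_const_mem_posCone hk hx hε) hi)

lemma add_sq_div_add_le {a b c d e : ℝ} (hc : 0 < c) (hd : 0 < d) (he : c + d ≤ e) :
    (a + b) ^ 2 / e ≤ a ^ 2 / c + b ^ 2 / d := by
  have h1 : (a + b) ^ 2 / e ≤ (a + b) ^ 2 / (c + d) := by gcongr
  refine h1.trans ?_
  rw [div_add_div _ _ hc.ne' hd.ne', div_le_div_iff₀ (by positivity) (by positivity)]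
  have : (a ^ 2 * d + c * b ^ 2) * (c + d) - (a + b) ^ 2 * (c * d) = (a * d - b * c) ^ 2 := by ring
  nlinarith [sq_nonneg (a * d - b * c)]

/-- The recursion for the quotients `e_{k+1} / e_k` used in the Marcus–Lopes inequality. -/
lemma esym_quotient_identity [DecidableEq ι] {s : Finset ι} {k : ℕ} {x : ι → ℝ}
    (hx : x ∈ posCone s (k + 1)) :
    (k + 2) * (esym s (k + 2) x / esym s (k + 1) x) = ∑ i ∈ s, x i -
      ∑ i ∈ s, x i ^ 2 / (x i + esym (s.erase i) (k + 1) x / esym (s.erase i) k x) := by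
  have h0 := hx (k + 1) le_rfl
  have h1 := sum_mul_esym_erase s (k + 1) x
  rw [mul_div_assoc', div_eq_iff h0.ne', sub_mul, Finset.sum_mul, Finset.sum_mul,
    ← Finset.sum_sub_distrib]
  rw [show ((k : ℝ) + 2) = ((k + 1 : ℕ) : ℝ) + 1 by push_cast; ring, ← h1]
  refine Finset.sum_congr rfl fun i hi => ?_
  have h2 := posCone_erase hx hi k le_rfl
  have h3 := esym_erase hi k x
  have h4 : x i + esym (s.erase i) (k + 1) x / esym (s.erase i) k x
      = esym s (k + 1) x / esym (s.erase i) k x := by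
    rw [h3]; field_simp; ring
  rw [h4]
  field_simp
  rw [h3]; ring

/-- The Marcus–Lopes inequality: the Gårding cone is closed under addition and the quotient
`e_{k+1} / e_k` is superadditive on it. The quotient with index `k + 1` is expressed through those
with index `k` on one entry less, and `(a, c) ↦ a ^ 2 / c` is subadditive for `c > 0`. -/
lemma marcus_lopes [DecidableEq ι] (k : ℕ) : ∀ (s : Finset ι) (x y : ι → ℝ),
    x ∈ posCone s k → y ∈ posCone s k →
    x + y ∈ posCone s k ∧ esym s (k + 1) x / esym s k x + esym s (k + 1) y / esym s k y ≤
      esym s (k + 1) (x + y) / esym s k (x + y) := by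
  induction k with
  | zero =>
    intro s x y _ _
    refine ⟨fun j hj => ?_, ?_⟩
    · rw [Nat.le_zero.1 hj, esym_zero]; exact one_pos
    · simp only [esym_zero, div_one]
      have : ∀ z : ι → ℝ, esym s (0 + 1) z = ∑ i ∈ s, z i := by
        intro z; simp [esym, Finset.powersetCard_one]
      simp only [this, Pi.add_apply, Finset.sum_add_distrib, le_refl]
  | succ k ih =>
    intro s x y hx hy
    have hx' : x ∈ posCone s k := fun j hj => hx j (by omega)
    have hy' : y ∈ posCone s k := fun j hj => hy j (by omega)
    obtain ⟨h1, h2⟩ := ih s x y hx' hy'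
    have hxy : x + y ∈ posCone s (k + 1) := by
      intro j hj
      rcases Nat.lt_or_ge j (k + 1) with h | h
      · exact h1 j (by omega)
      · obtain rfl : j = k + 1 := by omega
        have h3 : 0 < esym s (k + 1) x / esym s k x := div_pos (hx _ le_rfl) (hx' _ le_rfl)
        have h4 : 0 < esym s (k + 1) y / esym s k y := div_pos (hy _ le_rfl) (hy' _ le_rfl)
        have h5 := h1 k le_rfl
        have h6 : 0 < esym s (k + 1) (x + y) / esym s k (x + y) := by linarith
        exact (div_pos_iff_of_pos_right h5).1 h6
    refine ⟨hxy, ?_⟩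
    have hk : (0 : ℝ) < k + 2 := by positivity
    refine le_of_mul_le_mul_left ?_ hk
    rw [mul_add, esym_quotient_identity hx, esym_quotient_identity hy, esym_quotient_identity hxy]
    have h3 : ∑ i ∈ s, (x + y) i ^ 2 / ((x + y) i +
          esym (s.erase i) (k + 1) (x + y) / esym (s.erase i) k (x + y)) ≤
        ∑ i ∈ s, x i ^ 2 / (x i + esym (s.erase i) (k + 1) x / esym (s.erase i) k x) +
        ∑ i ∈ s, y i ^ 2 / (y i + esym (s.erase i) (k + 1) y / esym (s.erase i) k y) := by
      rw [← Finset.sum_add_distrib]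
      refine Finset.sum_le_sum fun i hi => ?_
      have hpos : ∀ z : ι → ℝ, z ∈ posCone s (k + 1) →
          0 < z i + esym (s.erase i) (k + 1) z / esym (s.erase i) k z := by
        intro z hz
        have a1 := hz (k + 1) le_rfl
        have a2 := posCone_erase hz hi k le_rfl
        rw [esym_erase hi] at a1
        have : z i + esym (s.erase i) (k + 1) z / esym (s.erase i) k z =
            (esym (s.erase i) (k + 1) z + z i * esym (s.erase i) k z) / esym (s.erase i) k z := by
          field_simp; ring
        rw [this]; exact div_pos a1 a2
      refine add_sq_div_add_le (hpos x hx) (hpos y hy) ?_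
      have := (ih (s.erase i) x y (posCone_erase hx hi) (posCone_erase hy hi)).2
      simp only [Pi.add_apply] at this ⊢
      linarith
    have h4 : ∑ i ∈ s, (x + y) i = ∑ i ∈ s, x i + ∑ i ∈ s, y i := by
      simp [Finset.sum_add_distrib]
    linarith

lemma add_mem_nonnegCone [DecidableEq ι] {s : Finset ι} {k : ℕ} (hk : k ≤ s.card) {x y : ι → ℝ}
    (hx : x ∈ nonnegCone s k) (hy : y ∈ nonnegCone s k) : x + y ∈ nonnegCone s k := by
  refine mem_nonnegCone_of_forall_add fun ε hε => posCone_subset _ _ ?_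
  have h := (marcus_lopes k s _ _ (add_const_mem_posCone hk hx (half_pos hε))
    (add_const_mem_posCone hk hy (half_pos hε))).1
  convert h using 1
  ext i
  simp only [Pi.add_apply]; ring

lemma esym_smul (s : Finset ι) (m : ℕ) (c : ℝ) (x : ι → ℝ) :
    esym s m (c • x) = c ^ m * esym s m x := by
  unfold esym
  rw [Finset.mul_sum]
  refine Finset.sum_congr rfl fun t ht => ?_
  simp [Finset.prod_mul_distrib, (Finset.mem_powersetCard.1 ht).2]

lemma smul_mem_nonnegCone {s : Finset ι} {k : ℕ} {c : ℝ} (hc : 0 ≤ c) {x : ι → ℝ}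
    (hx : x ∈ nonnegCone s k) : c • x ∈ nonnegCone s k := fun j hj => by
  rw [esym_smul]; exact mul_nonneg (pow_nonneg hc _) (hx j hj)

lemma nonneg_mem_nonnegCone (s : Finset ι) (k : ℕ) {x : ι → ℝ} (hx : ∀ i, 0 ≤ x i) :
    x ∈ nonnegCone s k :=
  fun _ _ => Finset.sum_nonneg fun _ _ => Finset.prod_nonneg fun i _ => hx i

lemma esym_univ_perm [Fintype ι] (m : ℕ) (σ : Equiv.Perm ι) (x : ι → ℝ) :
    esym Finset.univ m (x ∘ σ) = esym Finset.univ m x := by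
  unfold esym
  refine Finset.sum_bij' (fun t _ => t.map σ.toEmbedding) (fun t _ => t.map σ.symm.toEmbedding)
    ?_ ?_ ?_ ?_ ?_
  · intro t ht; simpa [Finset.mem_powersetCard] using ht
  · intro t ht; simpa [Finset.mem_powersetCard] using ht
  · intro t _; ext; simp
  · intro t _; ext; simp
  · intro t _; simp

lemma convex_nonnegCone [DecidableEq ι] {s : Finset ι} {k : ℕ} (hk : k ≤ s.card) :
    Convex ℝ (nonnegCone s k : Set (ι → ℝ)) := fun _ hx _ hy _ _ ha hb _ =>
  add_mem_nonnegCone hk (smul_mem_nonnegCone ha hx) (smul_mem_nonnegCone hb hy)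

end GardingCone

/-! ### Newton tensors and the Gårding cone of symmetric matrices -/

section NewtonTensor

variable {ι : Type*} [Fintype ι] [DecidableEq ι]

/-- The Newton tensors `T_m(A)`, by the Faddeev–LeVerrier recursion. It makes sense for every
square matrix and is visibly polynomial in the entries. -/
def newtonT (A : Matrix ι ι ℝ) : ℕ → Matrix ι ι ℝ
  | 0 => 1
  | m + 1 => (((m : ℝ) + 1)⁻¹ * (A * newtonT A m).trace) • 1 - A * newtonT A m

/-- The elementary symmetric function `σ_m` of the eigenvalues of `A`, as a polynomial in the
entries of `A`. -/
def sig (A : Matrix ι ι ℝ) : ℕ → ℝ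
  | 0 => 1
  | m + 1 => ((m : ℝ) + 1)⁻¹ * (A * newtonT A m).trace

lemma sig_zero (A : Matrix ι ι ℝ) : sig A 0 = 1 := rfl

lemma newtonT_zero (A : Matrix ι ι ℝ) : newtonT A 0 = 1 := rfl

lemma newtonT_succ (A : Matrix ι ι ℝ) (m : ℕ) :
    newtonT A (m + 1) = sig A (m + 1) • 1 - A * newtonT A m := rfl

lemma mul_newtonT (A : Matrix ι ι ℝ) (m : ℕ) :
    A * newtonT A m = sig A (m + 1) • 1 - newtonT A (m + 1) := by
  rw [newtonT_succ]; abel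

lemma trace_mul_newtonT (A : Matrix ι ι ℝ) (m : ℕ) :
    (A * newtonT A m).trace = (m + 1) * sig A (m + 1) := by
  simp only [sig]
  have : (m : ℝ) + 1 ≠ 0 := by positivity
  field_simp

lemma trace_newtonT (A : Matrix ι ι ℝ) (m : ℕ) :
    (newtonT A m).trace = (Fintype.card ι - m) * sig A m := by
  cases m with
  | zero => simp [newtonT_zero, sig_zero]
  | succ m =>
    rw [newtonT_succ, Matrix.trace_sub, trace_mul_newtonT, Matrix.trace_smul, Matrix.trace_one]
    push_cast
    simp only [smul_eq_mul]; ring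

lemma newtonT_commute (A : Matrix ι ι ℝ) (m : ℕ) : Commute A (newtonT A m) := by
  induction m with
  | zero => exact Commute.one_right A
  | succ m ih =>
    rw [newtonT_succ]
    exact ((Commute.one_right A).smul_right _).sub_right ((Commute.refl A).mul_right ih)

lemma newtonT_isHermitian {A : Matrix ι ι ℝ} (hA : A.IsHermitian) (m : ℕ) :
    (newtonT A m).IsHermitian := by
  induction m with
  | zero => exact Matrix.isHermitian_one
  | succ m ih =>
    rw [newtonT_succ]
    refine Matrix.IsHermitian.sub ?_ ?_
    · simp [Matrix.IsHermitian]
    · rw [Matrix.IsHermitian, Matrix.conjTranspose_mul, hA.eq, ih.eq]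
      exact (newtonT_commute A m).eq.symm

lemma newtonT_sig_conj {U V : Matrix ι ι ℝ} (h : V * U = 1) (D : Matrix ι ι ℝ) (m : ℕ) :
    newtonT (U * D * V) m = U * newtonT D m * V ∧ sig (U * D * V) m = sig D m := by
  have h' : U * V = 1 := mul_eq_one_comm.1 h
  have hmul : ∀ X : Matrix ι ι ℝ, U * D * V * (U * X * V) = U * (D * X) * V := by
    intro X
    calc U * D * V * (U * X * V) = U * D * (V * U) * X * V := by simp only [mul_assoc]
      _ = _ := by rw [h]; simp only [mul_one, mul_assoc]
  have htr : ∀ X : Matrix ι ι ℝ, (U * X * V).trace = X.trace := by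
    intro X; rw [Matrix.trace_mul_comm, ← mul_assoc, h, one_mul]
  induction m with
  | zero => simp [newtonT_zero, sig_zero, h']
  | succ m ih =>
    have h2 : sig (U * D * V) (m + 1) = sig D (m + 1) := by
      simp only [sig]; rw [ih.1, hmul, htr]
    refine ⟨?_, h2⟩
    rw [newtonT_succ, newtonT_succ, h2, ih.1, hmul, mul_sub, sub_mul]
    congr 1
    simp [h']

lemma newtonT_sig_diagonal (x : ι → ℝ) (m : ℕ) :
    newtonT (Matrix.diagonal x) m = Matrix.diagonal (fun i => esym (Finset.univ.erase i) m x) ∧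
      sig (Matrix.diagonal x) m = esym Finset.univ m x := by
  induction m with
  | zero => simp [newtonT_zero, sig_zero, esym_zero]
  | succ m ih =>
    have h2 : sig (Matrix.diagonal x) (m + 1) = esym Finset.univ (m + 1) x := by
      simp only [sig]
      rw [ih.1, Matrix.diagonal_mul_diagonal, Matrix.trace_diagonal, sum_mul_esym_erase]
      have : (m : ℝ) + 1 ≠ 0 := by positivity
      field_simp
    refine ⟨?_, h2⟩
    rw [newtonT_succ, h2, ih.1, Matrix.diagonal_mul_diagonal, ← Matrix.diagonal_one,
      ← Matrix.diagonal_smul, Matrix.diagonal_sub]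
    congr 1
    ext i
    have := esym_erase (Finset.mem_univ i) m x
    simp only [Pi.smul_apply, smul_eq_mul, mul_one]
    linarith

/-- Spectral decomposition of a real symmetric matrix. -/
lemma exists_orthogonal_diagonalization {A : Matrix ι ι ℝ} (hA : A.IsHermitian) :
    ∃ U V : Matrix ι ι ℝ, V * U = 1 ∧ V = U.transpose ∧
      A = U * Matrix.diagonal hA.eigenvalues * V := by
  refine ⟨hA.eigenvectorUnitary, star (hA.eigenvectorUnitary : Matrix ι ι ℝ),
    Unitary.coe_star_mul_self _, ?_, ?_⟩
  · rw [Matrix.star_eq_conjTranspose, Matrix.conjTranspose_eq_transpose_of_trivial]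
  · have := hA.spectral_theorem
    rw [Unitary.conjStarAlgAut_apply] at this
    simpa using this

lemma sig_eq_esym_eigenvalues {A : Matrix ι ι ℝ} (hA : A.IsHermitian) (m : ℕ) :
    sig A m = esym Finset.univ m hA.eigenvalues := by
  obtain ⟨U, V, h, -, hUV⟩ := exists_orthogonal_diagonalization hA
  conv_lhs => rw [hUV]
  rw [(newtonT_sig_conj h _ m).2, (newtonT_sig_diagonal _ m).2]

/-- The closed Gårding cone of symmetric matrices. -/
def matCone (ι : Type*) [Fintype ι] [DecidableEq ι] (k : ℕ) : Set (Matrix ι ι ℝ) :=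
  {A | A.IsHermitian ∧ ∀ j ≤ k, 0 ≤ sig A j}

lemma matCone_eigenvalues {k : ℕ} {A : Matrix ι ι ℝ} (hA : A ∈ matCone ι k) :
    hA.1.eigenvalues ∈ nonnegCone Finset.univ k := fun j hj => by
  rw [← sig_eq_esym_eigenvalues]; exact hA.2 j hj

/-- The diagonal of a symmetric matrix is the image of its eigenvalues under a doubly stochastic
matrix, hence by Birkhoff's theorem a convex combination of their rearrangements. -/
lemma diag_mem_nonnegCone {k : ℕ} (hk : k ≤ Fintype.card ι) {A : Matrix ι ι ℝ}
    (hA : A ∈ matCone ι k) : A.diag ∈ nonnegCone Finset.univ k := by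
  obtain ⟨U, V, h, hV, hUV⟩ := exists_orthogonal_diagonalization hA.1
  have h' : U * V = 1 := mul_eq_one_comm.1 h
  set x := hA.1.eigenvalues with hx
  set M : Matrix ι ι ℝ := Matrix.of fun i j => U i j ^ 2 with hM
  have hds : M ∈ doublyStochastic ℝ ι := by
    rw [mem_doublyStochastic_iff_sum]
    refine ⟨fun i j => sq_nonneg _, fun i => ?_, fun j => ?_⟩
    · have := congrFun (congrFun h' i) i
      rw [hV, Matrix.mul_apply] at this
      simpa [hM, sq] using this
    · have := congrFun (congrFun h j) j
      rw [hV, Matrix.mul_apply] at this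
      simpa [hM, sq] using this
  have hdiag : A.diag = M.mulVec x := by
    ext i
    rw [Matrix.diag_apply, hUV, Matrix.mul_apply, Matrix.mulVec, dotProduct]
    refine Finset.sum_congr rfl fun j _ => ?_
    rw [Matrix.mul_diagonal, hV, Matrix.transpose_apply, hM, Matrix.of_apply]; ring
  rw [hdiag]
  have hconv : Convex ℝ {N : Matrix ι ι ℝ | N.mulVec x ∈ nonnegCone Finset.univ k} := by
    intro N hN N' hN' a b ha hb hab
    have := convex_nonnegCone (s := (Finset.univ : Finset ι)) (by simpa using hk) hN hN' ha hb hab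
    simpa [Matrix.add_mulVec, Matrix.smul_mulVec] using this
  have hsub : convexHull ℝ {σ.permMatrix ℝ | σ : Equiv.Perm ι} ⊆
      {N : Matrix ι ι ℝ | N.mulVec x ∈ nonnegCone Finset.univ k} := by
    refine convexHull_min ?_ hconv
    rintro _ ⟨σ, rfl⟩ j hj
    rw [Matrix.permMatrix_mulVec, esym_univ_perm]
    exact matCone_eigenvalues hA j hj
  refine hsub ?_
  rw [← doublyStochastic_eq_convexHull_permMatrix]
  exact hds

/-- The Gårding cone of symmetric matrices is closed under addition. In an orthonormal eigenbasis of
`A + B` the eigenvalues of the sum are the sums of the diagonal entries of `A` and of `B`, which lie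
in the cone of vectors. -/
lemma add_mem_matCone {k : ℕ} (hk : k ≤ Fintype.card ι) {A B : Matrix ι ι ℝ}
    (hA : A ∈ matCone ι k) (hB : B ∈ matCone ι k) : A + B ∈ matCone ι k := by
  have hC := hA.1.add hB.1
  refine ⟨hC, fun j hj => ?_⟩
  obtain ⟨U, V, h, hV, hUV⟩ := exists_orthogonal_diagonalization hC
  have h' : U * V = 1 := mul_eq_one_comm.1 h
  have hconj : ∀ X ∈ matCone ι k, V * X * U ∈ matCone ι k := by
    intro X hX
    refine ⟨?_, fun j hj => ?_⟩
    · have := Matrix.isHermitian_mul_mul_conjTranspose V hX.1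
      rwa [Matrix.conjTranspose_eq_transpose_of_trivial, hV, Matrix.transpose_transpose,
        ← hV] at this
    · rw [(newtonT_sig_conj h' X j).2]; exact hX.2 j hj
  have hsum : hC.eigenvalues = (V * A * U).diag + (V * B * U).diag := by
    rw [← Matrix.diag_add, ← add_mul, ← mul_add]
    conv_rhs => rw [hUV]
    have : V * (U * Matrix.diagonal hC.eigenvalues * V) * U
        = (V * U) * Matrix.diagonal hC.eigenvalues * (V * U) := by simp only [mul_assoc]
    rw [this, h, one_mul, mul_one, Matrix.diag_diagonal]
  rw [sig_eq_esym_eigenvalues hC, hsum]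
  exact add_mem_nonnegCone (by simpa using hk) (diag_mem_nonnegCone hk (hconj A hA))
    (diag_mem_nonnegCone hk (hconj B hB)) j hj

lemma sig_newtonT_smul (c : ℝ) (A : Matrix ι ι ℝ) (m : ℕ) :
    newtonT (c • A) m = c ^ m • newtonT A m ∧ sig (c • A) m = c ^ m * sig A m := by
  induction m with
  | zero => simp [newtonT_zero, sig_zero]
  | succ m ih =>
    have h1 : (c • A) * newtonT (c • A) m = c ^ (m + 1) • (A * newtonT A m) := by
      rw [ih.1, Matrix.smul_mul, Matrix.mul_smul, smul_smul]; congr 1; ring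
    have h2 : sig (c • A) (m + 1) = c ^ (m + 1) * sig A (m + 1) := by
      simp only [sig]; rw [h1, Matrix.trace_smul, smul_eq_mul]; ring
    refine ⟨?_, h2⟩
    rw [newtonT_succ, newtonT_succ, h1, h2, smul_sub, smul_smul]

lemma smul_mem_matCone {k : ℕ} {c : ℝ} (hc : 0 ≤ c) {A : Matrix ι ι ℝ}
    (hA : A ∈ matCone ι k) : c • A ∈ matCone ι k := by
  refine ⟨?_, fun j hj => ?_⟩
  · rw [Matrix.IsHermitian, Matrix.conjTranspose_smul, hA.1.eq]; simp
  · rw [(sig_newtonT_smul c A j).2]; exact mul_nonneg (pow_nonneg hc _) (hA.2 j hj)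

lemma posSemidef_mem_matCone {A : Matrix ι ι ℝ} (hA : A.PosSemidef) (k : ℕ) :
    A ∈ matCone ι k := by
  refine ⟨hA.1, fun j hj => ?_⟩
  rw [sig_eq_esym_eigenvalues hA.1]
  exact nonneg_mem_nonnegCone _ k (fun i => hA.eigenvalues_nonneg i) j hj

lemma smul_one_mem_matCone {c : ℝ} (hc : 0 ≤ c) (k : ℕ) :
    c • (1 : Matrix ι ι ℝ) ∈ matCone ι k :=
  smul_mem_matCone hc (posSemidef_mem_matCone Matrix.PosSemidef.one k)

lemma sig_add_smul_one_pos {k : ℕ} (hk : k ≤ Fintype.card ι) {A : Matrix ι ι ℝ}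
    (hA : A ∈ matCone ι k) {ε : ℝ} (hε : 0 < ε) : 0 < sig (A + ε • 1) k := by
  obtain ⟨U, V, h, -, hUV⟩ := exists_orthogonal_diagonalization hA.1
  have h' : U * V = 1 := mul_eq_one_comm.1 h
  have : A + ε • 1 = U * Matrix.diagonal (fun i => hA.1.eigenvalues i + ε) * V := by
    have h2 : Matrix.diagonal (fun i => hA.1.eigenvalues i + ε)
        = Matrix.diagonal hA.1.eigenvalues + ε • 1 := by
      rw [← Matrix.diagonal_one, ← Matrix.diagonal_smul, Matrix.diagonal_add]; simp
    rw [h2, mul_add, add_mul, ← hUV]; simp [h']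
  rw [this, (newtonT_sig_conj h _ k).2, (newtonT_sig_diagonal _ k).2]
  exact esym_add_const_pos (by simpa using hk) (matCone_eigenvalues hA) hε

/-- The linearization of `σ_{m+1}` is degenerate elliptic on the Gårding cone: in an eigenbasis the
Newton tensor is diagonal, with entries `e_m` of the eigenvalues other than the `i`-th. -/
lemma newtonT_posSemidef {k m : ℕ} (hk : k ≤ Fintype.card ι) (hm : m + 1 ≤ k)
    {A : Matrix ι ι ℝ} (hA : A ∈ matCone ι k) : (newtonT A m).PosSemidef := by
  obtain ⟨U, V, h, hV, hUV⟩ := exists_orthogonal_diagonalization hA.1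
  rw [hUV, (newtonT_sig_conj h _ m).1, (newtonT_sig_diagonal _ m).1, hV,
    ← Matrix.conjTranspose_eq_transpose_of_trivial]
  refine Matrix.PosSemidef.mul_mul_conjTranspose_same ?_ U
  refine Matrix.PosSemidef.diagonal fun i => ?_
  exact nonnegCone_erase (by simpa using hm.trans hk)
    (fun j hj => matCone_eigenvalues hA j (hj.trans hm)) (Finset.mem_univ i) m le_rfl

end NewtonTensor

lemma sig_eq_sigma_eigenvec {n : ℕ} {A : Matrix (Fin n) (Fin n) ℝ} (hA : A.IsHermitian) (m : ℕ) :
    sigma m (eigenvec A) = sig A m := by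
  rw [sig_eq_esym_eigenvalues hA, eigenvec, dif_pos hA]; rfl

/-- For symmetric matrices, membership in `matCone` is membership of the eigenvalue vector in
`gardingCone`. -/
lemma mem_matCone_iff {n k : ℕ} {A : Matrix (Fin n) (Fin n) ℝ} (hA : A.IsHermitian) :
    A ∈ matCone (Fin n) k ↔ eigenvec A ∈ gardingCone n k := by
  constructor
  · intro h i _ hi
    rw [sig_eq_sigma_eigenvec hA]; exact h.2 i hi
  · intro h
    refine ⟨hA, fun j hj => ?_⟩
    rcases Nat.eq_zero_or_pos j with rfl | h0
    · rw [sig_zero]; exact zero_le_one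
    · rw [← sig_eq_sigma_eigenvec hA]; exact h j h0 hj

/-! ### Derivatives of the elementary symmetric functions of a matrix -/

section MatrixDeriv

variable {ι : Type*}

/-- Entrywise derivative of a curve of matrices (no norm on matrices is singled out). -/
def HasEntryDerivAt (A : ℝ → Matrix ι ι ℝ) (B : Matrix ι ι ℝ) (t : ℝ) : Prop :=
  ∀ i j, HasDerivAt (fun s => A s i j) (B i j) t

lemma HasEntryDerivAt.mul [Fintype ι] {A A' : ℝ → Matrix ι ι ℝ} {B B' : Matrix ι ι ℝ} {t : ℝ}
    (h : HasEntryDerivAt A B t) (h' : HasEntryDerivAt A' B' t) :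
    HasEntryDerivAt (fun s => A s * A' s) (B * A' t + A t * B') t := by
  intro i j
  simp only [Matrix.mul_apply, Matrix.add_apply, ← Finset.sum_add_distrib]
  exact HasDerivAt.fun_sum fun l _ => (h i l).mul (h' l j)

lemma HasEntryDerivAt.trace [Fintype ι] {A : ℝ → Matrix ι ι ℝ} {B : Matrix ι ι ℝ} {t : ℝ}
    (h : HasEntryDerivAt A B t) : HasDerivAt (fun s => (A s).trace) B.trace t :=
  HasDerivAt.fun_sum fun i _ => h i i

/-- `d tr A^{m+1} = (m + 1) tr (A^m dA)`, although `A` and its derivative need not commute. -/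
lemma hasEntryDerivAt_trace_pow [Fintype ι] [DecidableEq ι] {A : ℝ → Matrix ι ι ℝ}
    {B : Matrix ι ι ℝ} {t : ℝ} (h : HasEntryDerivAt A B t) (m : ℕ) :
    HasDerivAt (fun s => (A s ^ (m + 1)).trace) ((m + 1) * (A t ^ m * B).trace) t := by
  have key : ∀ m : ℕ, ∃ P, HasEntryDerivAt (fun s => A s ^ m) P t ∧
      ∀ j, (P * A t ^ (j + 1)).trace = m * (A t ^ (m + j) * B).trace := by
    intro m
    induction m with
    | zero =>
      refine ⟨0, fun i j => ?_, fun j => by simp⟩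
      simpa using hasDerivAt_const t ((1 : Matrix ι ι ℝ) i j)
    | succ m ih =>
      obtain ⟨P, hP, hPt⟩ := ih
      refine ⟨P * A t + A t ^ m * B, ?_, fun j => ?_⟩
      · simpa only [pow_succ] using hP.mul h
      · have e : (A t ^ m * B * A t ^ (j + 1)).trace = (A t ^ (m + 1 + j) * B).trace := by
          rw [Matrix.trace_mul_comm, ← mul_assoc, ← pow_add,
            show j + 1 + m = m + 1 + j by ring]
        rw [add_mul, Matrix.trace_add, mul_assoc, ← pow_succ', hPt (j + 1), e,
          show m + (j + 1) = m + 1 + j by ring]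
        push_cast; ring
  obtain ⟨P, hP, hPt⟩ := key m
  have h1 : HasEntryDerivAt (fun s => A s ^ (m + 1)) (P * A t + A t ^ m * B) t := by
    simpa only [pow_succ] using hP.mul h
  convert h1.trace using 1
  have := hPt 0
  rw [zero_add, pow_one, add_zero] at this
  rw [Matrix.trace_add, this]; ring

variable [Fintype ι] [DecidableEq ι]

lemma newtonT_eq_sum (A : Matrix ι ι ℝ) (m : ℕ) :
    newtonT A m = ∑ i ∈ Finset.range (m + 1), ((-1) ^ i * sig A (m - i)) • A ^ i := by
  induction m with
  | zero => simp [newtonT_zero, sig_zero]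
  | succ m ih =>
    rw [newtonT_succ, ih, Finset.sum_range_succ' _ (m + 1), Finset.mul_sum, sub_eq_neg_add,
      ← Finset.sum_neg_distrib]
    congr 1
    · refine Finset.sum_congr rfl fun i _ => ?_
      rw [Matrix.mul_smul, ← pow_succ', ← neg_smul, Nat.add_sub_add_right]
      congr 1; ring
    · simp

lemma succ_mul_sig_eq_sum (A : Matrix ι ι ℝ) (m : ℕ) :
    (m + 1) * sig A (m + 1) =
      ∑ i ∈ Finset.range (m + 1), ((-1) ^ i * sig A (m - i)) * (A ^ (i + 1)).trace := by
  rw [← trace_mul_newtonT, newtonT_eq_sum, Finset.mul_sum, Matrix.trace_sum]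
  refine Finset.sum_congr rfl fun i _ => ?_
  rw [Matrix.mul_smul, Matrix.trace_smul, ← pow_succ', smul_eq_mul]

/-- The identity behind the derivative formula for `sig`: the coefficientwise form of
`d/ds (s T) = s p T + σ (1 + s A)⁻²` for `σ = det (1 + s A)`, `T = σ (1 + s A)⁻¹`. -/
lemma sum_trace_pow_smul_newtonT (A : Matrix ι ι ℝ) (m : ℕ) :
    ∑ i ∈ Finset.range m, ((-1) ^ i * (A ^ (i + 1)).trace) • newtonT A (m - 1 - i) +
      ∑ i ∈ Finset.range (m + 1), ((-1) ^ i * (i + 1) * sig A (m - i)) • A ^ i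
      = ((m : ℝ) + 1) • newtonT A m := by
  induction m with
  | zero => simp [newtonT_zero, sig_zero]
  | succ m ih =>
    have hF : ∑ i ∈ Finset.range (m + 1), ((-1) ^ i * (A ^ (i + 1)).trace) • newtonT A (m - i) +
        A * ∑ i ∈ Finset.range m, ((-1) ^ i * (A ^ (i + 1)).trace) • newtonT A (m - 1 - i)
        = ((m + 1) * sig A (m + 1)) • (1 : Matrix ι ι ℝ) := by
      rw [succ_mul_sig_eq_sum, Finset.sum_range_succ, Finset.sum_range_succ, add_smul,
        Finset.sum_smul, Finset.mul_sum, add_right_comm, ← Finset.sum_add_distrib]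
      congr 1
      · refine Finset.sum_congr rfl fun i hi => ?_
        rw [Finset.mem_range] at hi
        obtain ⟨d, rfl⟩ : ∃ d, m = i + 1 + d := ⟨m - (i + 1), by omega⟩
        rw [show i + 1 + d - i = d + 1 by omega, show i + 1 + d - 1 - i = d by omega,
          Matrix.mul_smul, mul_newtonT, ← smul_add, add_sub_cancel, smul_smul]
        congr 1; ring
      · simp [newtonT_zero, sig_zero]
    have hG : ∑ i ∈ Finset.range (m + 2), ((-1) ^ i * ((i : ℝ) + 1) * sig A (m + 1 - i)) • A ^ i +
        A * ∑ i ∈ Finset.range (m + 1), ((-1) ^ i * ((i : ℝ) + 1) * sig A (m - i)) • A ^ i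
        = newtonT A (m + 1) := by
      rw [newtonT_eq_sum A (m + 1), Finset.sum_range_succ' _ (m + 1), Finset.mul_sum,
        add_right_comm, ← Finset.sum_add_distrib, Finset.sum_range_succ' _ (m + 1)]
      congr 1
      · refine Finset.sum_congr rfl fun i _ => ?_
        rw [Matrix.mul_smul, ← pow_succ', ← add_smul, Nat.add_sub_add_right]
        congr 1; push_cast; ring
      · simp
    have ih' := congrArg (A * ·) ih
    beta_reduce at ih'
    rw [Matrix.mul_add, Matrix.mul_smul, mul_newtonT] at ih'
    simp only [Nat.add_sub_cancel]
    rw [eq_sub_of_add_eq hF, eq_sub_of_add_eq hG]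
    rw [sub_add_sub_comm, ih', mul_smul]
    push_cast
    module

/-- `dσ_{m+1}(A)[B] = tr (T_m(A) B)`. -/
lemma hasDerivAt_sig {A : ℝ → Matrix ι ι ℝ} {B : Matrix ι ι ℝ} {t : ℝ}
    (h : HasEntryDerivAt A B t) (m : ℕ) :
    HasDerivAt (fun s => sig (A s) (m + 1)) (newtonT (A t) m * B).trace t := by
  induction m using Nat.strong_induction_on with
  | _ m ih =>
    have hm : (m : ℝ) + 1 ≠ 0 := by positivity
    have h1 : (fun s => sig (A s) (m + 1)) = fun s => ((m : ℝ) + 1)⁻¹ *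
        ∑ i ∈ Finset.range (m + 1), ((-1) ^ i * sig (A s) (m - i)) * (A s ^ (i + 1)).trace := by
      funext s; rw [← succ_mul_sig_eq_sum]; field_simp
    have h2 : ∀ i ∈ Finset.range (m + 1), HasDerivAt (fun s => sig (A s) (m - i))
        (if i < m then (newtonT (A t) (m - 1 - i) * B).trace else 0) t := by
      intro i hi
      rw [Finset.mem_range] at hi
      split_ifs with hlt
      · have := ih (m - 1 - i) (by omega)
        rwa [show m - 1 - i + 1 = m - i by omega] at this
      · rw [show m - i = 0 by omega]
        exact hasDerivAt_const t 1
    rw [h1]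
    have h3 := HasDerivAt.const_mul ((m : ℝ) + 1)⁻¹ (HasDerivAt.fun_sum fun i hi =>
      (((h2 i hi).const_mul ((-1) ^ i)).mul (hasEntryDerivAt_trace_pow h i)))
    refine h3.congr_deriv ?_
    rw [inv_mul_eq_iff_eq_mul₀ hm]
    have h4 := congrArg (fun X => (X * B).trace) (sum_trace_pow_smul_newtonT (A t) m)
    simp only [Matrix.add_mul, Finset.sum_mul, Matrix.trace_add, Matrix.trace_sum, Matrix.smul_mul,
      Matrix.trace_smul, smul_eq_mul] at h4
    rw [Finset.sum_add_distrib, ← h4, Finset.sum_range_succ]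
    congr 1
    · simp only [lt_irrefl, if_false, mul_zero, zero_mul, add_zero]
      refine Finset.sum_congr rfl fun i hi => ?_
      rw [if_pos (Finset.mem_range.1 hi)]; ring
    · refine Finset.sum_congr rfl fun i _ => ?_
      ring

/-- The derivative of the Newton tensor `T_m` at `A` in the direction `B`. -/
def dnewtonT (A B : Matrix ι ι ℝ) : ℕ → Matrix ι ι ℝ
  | 0 => 0
  | m + 1 => (newtonT A m * B).trace • 1 - (B * newtonT A m + A * dnewtonT A B m)

lemma hasEntryDerivAt_newtonT {A : ℝ → Matrix ι ι ℝ} {B : Matrix ι ι ℝ} {t : ℝ}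
    (h : HasEntryDerivAt A B t) (m : ℕ) :
    HasEntryDerivAt (fun s => newtonT (A s) m) (dnewtonT (A t) B m) t := by
  induction m with
  | zero => intro i j; exact hasDerivAt_const t _
  | succ m ih =>
    intro i j
    have h1 := (hasDerivAt_sig h m).mul_const ((1 : Matrix ι ι ℝ) i j)
    exact h1.sub (h.mul ih i j)

lemma newtonT_sig_entries_contDiff {X : Type*} [NormedAddCommGroup X] [NormedSpace ℝ X]
    {d : WithTop ℕ∞} {A : X → Matrix ι ι ℝ} (hA : ∀ i j, ContDiff ℝ d fun x => A x i j) (m : ℕ) :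
    (∀ i j, ContDiff ℝ d fun x => newtonT (A x) m i j) ∧ ContDiff ℝ d fun x => sig (A x) m := by
  induction m with
  | zero => exact ⟨fun i j => contDiff_const, contDiff_const⟩
  | succ m ih =>
    have hmul : ∀ i j, ContDiff ℝ d fun x => (A x * newtonT (A x) m) i j := by
      intro i j
      simp only [Matrix.mul_apply]
      exact ContDiff.sum fun l _ => (hA i l).mul (ih.1 l j)
    have hs : ContDiff ℝ d fun x => sig (A x) (m + 1) := by
      refine contDiff_const.mul ?_
      exact ContDiff.sum fun l _ => hmul l l
    refine ⟨fun i j => ?_, hs⟩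
    exact (hs.mul contDiff_const).sub (hmul i j)

end MatrixDeriv

/-! ### The divergence of the Newton tensors -/

section Divergence

variable {ι : Type*} [Fintype ι]

lemma hasDerivAt_dotProduct {p q : ℝ → ι → ℝ} {p' q' : ι → ℝ} {t : ℝ}
    (hp : ∀ a, HasDerivAt (fun s => p s a) (p' a) t)
    (hq : ∀ a, HasDerivAt (fun s => q s a) (q' a) t) :
    HasDerivAt (fun s => p s ⬝ᵥ q s) (p' ⬝ᵥ q t + p t ⬝ᵥ q') t := by
  simp only [dotProduct, ← Finset.sum_add_distrib]
  exact HasDerivAt.fun_sum fun a _ => (hp a).mul (hq a)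

lemma hasDerivAt_dotProduct_self {p : ℝ → ι → ℝ} {p' : ι → ℝ} {t : ℝ}
    (hp : ∀ a, HasDerivAt (fun s => p s a) (p' a) t) :
    HasDerivAt (fun s => p s ⬝ᵥ p s) (2 * (p t ⬝ᵥ p')) t := by
  convert hasDerivAt_dotProduct hp hp using 1
  rw [dotProduct_comm p']; ring

variable [DecidableEq ι]

/-- The matrix `A = z H - (1/2) |p|² I` of a 2-jet `(z, p, H)`. -/
def jetA (z : ℝ) (p : ι → ℝ) (H : Matrix ι ι ℝ) : Matrix ι ι ℝ :=
  z • H - ((1 / 2 : ℝ) * (p ⬝ᵥ p)) • 1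

/-- The derivative of `jetA` in the direction `(z', p', H')`. -/
def djetA (z : ℝ) (p : ι → ℝ) (H : Matrix ι ι ℝ) (z' : ℝ) (p' : ι → ℝ) (H' : Matrix ι ι ℝ) :
    Matrix ι ι ℝ :=
  z' • H + z • H' - (p ⬝ᵥ p') • 1

lemma jetA_isHermitian {z : ℝ} {p : ι → ℝ} {H : Matrix ι ι ℝ} (hH : H.IsHermitian) :
    (jetA z p H).IsHermitian := by
  have h1 := hH.eq
  rw [Matrix.conjTranspose_eq_transpose_of_trivial] at h1
  rw [Matrix.IsHermitian, Matrix.conjTranspose_eq_transpose_of_trivial]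
  simp [jetA, Matrix.transpose_sub, Matrix.transpose_smul, h1]

lemma hasEntryDerivAt_jetA {z : ℝ → ℝ} {p : ℝ → ι → ℝ} {H : ℝ → Matrix ι ι ℝ} {z' : ℝ}
    {p' : ι → ℝ} {H' : Matrix ι ι ℝ} {t : ℝ} (hz : HasDerivAt z z' t)
    (hp : ∀ a, HasDerivAt (fun s => p s a) (p' a) t) (hH : HasEntryDerivAt H H' t) :
    HasEntryDerivAt (fun s => jetA (z s) (p s) (H s)) (djetA (z t) (p t) (H t) z' p' H') t := by
  intro i j
  have h1 := hz.mul (hH i j)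
  have h2 := ((hasDerivAt_dotProduct_self hp).const_mul (1 / 2 : ℝ)).mul_const
    ((1 : Matrix ι ι ℝ) i j)
  refine (h1.sub h2).congr_deriv ?_
  simp only [djetA, Matrix.sub_apply, Matrix.add_apply, Matrix.smul_apply, smul_eq_mul]
  ring

lemma smul_hessian_eq (z : ℝ) (p : ι → ℝ) (H : Matrix ι ι ℝ) :
    z • H = jetA z p H + ((1 / 2 : ℝ) * (p ⬝ᵥ p)) • 1 := by
  rw [jetA]; abel

/-- First derivatives of `A` on a jet field: the terms in `|p|²` cancel. -/
lemma smul_djetA_self (z : ℝ) (p : ι → ℝ) (H : Matrix ι ι ℝ)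
    (W : ι → Matrix ι ι ℝ) (i : ι) :
    z • djetA z p H (p i) (H i) (W i) =
      p i • jetA z p H - ((jetA z p H).mulVec p i) • 1 + z ^ 2 • W i := by
  have h1 := smul_hessian_eq z p H
  have h2 : z * (p ⬝ᵥ H i) = (jetA z p H).mulVec p i + 1 / 2 * (p ⬝ᵥ p) * p i := by
    have := congrFun (congrArg (fun M => Matrix.mulVec M p) h1) i
    simp only [Matrix.smul_mulVec, Matrix.add_mulVec, Pi.smul_apply, Pi.add_apply, smul_eq_mul,
      Matrix.one_mulVec] at this
    rw [← this, Matrix.mulVec, dotProduct_comm]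
  rw [djetA, smul_sub, smul_add, smul_smul, smul_smul z z, mul_comm z (p i), ← smul_smul (p i), h1,
    smul_smul z, h2]
  module

/-- The divergence of the Newton tensors of `A`: `z div T_m = n T_m p - (n - m) σ_m p`. No third
derivatives of the function remain. -/
lemma sum_dnewtonT (z : ℝ) (p : ι → ℝ) (H : Matrix ι ι ℝ)
    {W : ι → Matrix ι ι ℝ} (hW : ∀ i a b, W i a b = W a i b)
    (m : ℕ) (i : ι) :
    z * ∑ j, dnewtonT (jetA z p H) (djetA z p H (p j) (H j) (W j)) m i j =
      Fintype.card ι * ((newtonT (jetA z p H) m).mulVec p i) -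
        (Fintype.card ι - m) * sig (jetA z p H) m * p i := by
  set A := jetA z p H with hA
  induction m generalizing i with
  | zero => simp [dnewtonT, newtonT_zero, sig_zero]
  | succ m ih =>
    set T := newtonT A m with hT
    set B : ι → Matrix ι ι ℝ := fun j => djetA z p H (p j) (H j) (W j) with hB
    have hzB : ∀ j a b, z * B j a b =
        p j * A a b - A.mulVec p j * (1 : Matrix ι ι ℝ) a b + z ^ 2 * W j a b := by
      intro j a b
      have := congrFun (congrFun (smul_djetA_self z p H W j) a) b
      simpa only [Matrix.smul_apply, Matrix.add_apply, Matrix.sub_apply, smul_eq_mul] using this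
    have e1 : ∑ j, dnewtonT A (B j) (m + 1) i j =
        (T * B i).trace - ∑ j, ∑ a, B j i a * T a j -
          ∑ a, A i a * ∑ j, dnewtonT A (B j) m a j := by
      simp only [dnewtonT, Matrix.sub_apply, Matrix.add_apply, Matrix.smul_apply, smul_eq_mul,
        Finset.sum_sub_distrib, Finset.sum_add_distrib, Matrix.one_apply, mul_ite, mul_one,
        mul_zero, Finset.sum_ite_eq, Finset.mem_univ, if_true, Matrix.mul_apply]
      rw [sub_sub]
      congr 2
      simp only [Finset.mul_sum]
      exact Finset.sum_comm
    have e2 : z * ((T * B i).trace - ∑ j, ∑ a, B j i a * T a j) =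
        p i * (A * T).trace - A.mulVec p i * T.trace - (A.mulVec (T.mulVec p)) i
          + (T.mulVec (A.mulVec p)) i := by
      have t1 : (T * B i).trace = ∑ j, ∑ a, T a j * B i j a := by
        rw [Matrix.trace, Finset.sum_comm]
        refine Finset.sum_congr rfl fun a _ => ?_
        rw [Matrix.diag_apply, Matrix.mul_apply]
      have t2 : p i * (A * T).trace = ∑ j, ∑ a, p i * A j a * T a j := by
        simp only [Matrix.trace, Matrix.diag_apply, Matrix.mul_apply, Finset.mul_sum, mul_assoc]
      have t3 : A.mulVec p i * T.trace =
          ∑ j, ∑ a, A.mulVec p i * (1 : Matrix ι ι ℝ) j a * T a j := by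
        simp [Matrix.trace, Matrix.one_apply, Finset.mul_sum]
      have t4 : (A.mulVec (T.mulVec p)) i = ∑ j, ∑ a, p j * A i a * T a j := by
        simp only [Matrix.mulVec, dotProduct, Finset.mul_sum]
        rw [Finset.sum_comm]
        refine Finset.sum_congr rfl fun j _ => Finset.sum_congr rfl fun a _ => ?_
        ring
      have t5 : (T.mulVec (A.mulVec p)) i =
          ∑ j, ∑ a, A.mulVec p j * (1 : Matrix ι ι ℝ) i a * T a j := by
        simp only [Matrix.one_apply, mul_ite, mul_one, mul_zero, ite_mul, zero_mul,
          Finset.sum_ite_eq, Finset.mem_univ, if_true]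
        rw [Matrix.mulVec, dotProduct]
        exact Finset.sum_congr rfl fun j _ => mul_comm _ _
      rw [t1, t2, t3, t4, t5, mul_sub, Finset.mul_sum, Finset.mul_sum,
        ← Finset.sum_sub_distrib, ← Finset.sum_sub_distrib, ← Finset.sum_sub_distrib,
        ← Finset.sum_add_distrib]
      refine Finset.sum_congr rfl fun j _ => ?_
      rw [Finset.mul_sum, Finset.mul_sum,
        ← Finset.sum_sub_distrib, ← Finset.sum_sub_distrib, ← Finset.sum_sub_distrib,
        ← Finset.sum_add_distrib]
      refine Finset.sum_congr rfl fun a _ => ?_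
      have g1 := hzB i j a
      have g2 := hzB j i a
      rw [hW j i a] at g2
      linear_combination T a j * g1 - T a j * g2
    have e3 : z * ∑ a, A i a * ∑ j, dnewtonT A (B j) m a j =
        Fintype.card ι * (A.mulVec (T.mulVec p)) i -
          (Fintype.card ι - m) * sig A m * A.mulVec p i := by
      have f1 : (A.mulVec (T.mulVec p)) i = ∑ a, A i a * T.mulVec p a := rfl
      have f2 : A.mulVec p i = ∑ a, A i a * p a := rfl
      rw [f1, f2, Finset.mul_sum, Finset.mul_sum, Finset.mul_sum, ← Finset.sum_sub_distrib]
      refine Finset.sum_congr rfl fun a _ => ?_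
      linear_combination A i a * ih a
    have c1 : (T.mulVec (A.mulVec p)) i = (A.mulVec (T.mulVec p)) i := by
      rw [Matrix.mulVec_mulVec, Matrix.mulVec_mulVec, (newtonT_commute A m).eq]
    have c2 : (newtonT A (m + 1)).mulVec p i = sig A (m + 1) * p i - (A.mulVec (T.mulVec p)) i := by
      rw [newtonT_succ, Matrix.sub_mulVec, Matrix.smul_mulVec, Matrix.one_mulVec,
        ← Matrix.mulVec_mulVec]
      rfl
    rw [e1, mul_sub, e2, e3, c1, c2, trace_mul_newtonT, trace_newtonT]
    push_cast
    ring

end Divergence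

/-! ### Tensor fields with a divergence of second order -/

section JetTensor

variable {ι : Type*} [Fintype ι] [DecidableEq ι]

/-- The tensor `z^(a+1) |p|^(2l) T_m(A)` of a 2-jet `(z, p, H)`. -/
def tensorX (a : ℝ) (l m : ℕ) (z : ℝ) (p : ι → ℝ) (H : Matrix ι ι ℝ) : Matrix ι ι ℝ :=
  (z ^ (a + 1) * (p ⬝ᵥ p) ^ l) • newtonT (jetA z p H) m

/-- The divergence of `tensorX` along the jet of a function. -/
def divX (a : ℝ) (l m : ℕ) (z : ℝ) (p : ι → ℝ) (H : Matrix ι ι ℝ) : ι → ℝ :=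
  z ^ a • (((a + 1 + Fintype.card ι + l) * (p ⬝ᵥ p) ^ l) • (newtonT (jetA z p H) m).mulVec p
    - ((Fintype.card ι - m) * (p ⬝ᵥ p) ^ l * sig (jetA z p H) m) • p
    + (2 * l * (p ⬝ᵥ p) ^ (l - 1)) •
      (sig (jetA z p H) (m + 1) • p - (newtonT (jetA z p H) (m + 1)).mulVec p))

/-- The derivative of `tensorX` in the direction `(z', p', H')`. -/
def dtensorX (a : ℝ) (l m : ℕ) (z : ℝ) (p : ι → ℝ) (H : Matrix ι ι ℝ)
    (z' : ℝ) (p' : ι → ℝ) (H' : Matrix ι ι ℝ) : Matrix ι ι ℝ :=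
  ((a + 1) * z ^ a * z' * (p ⬝ᵥ p) ^ l +
      z ^ (a + 1) * (l * (p ⬝ᵥ p) ^ (l - 1) * (2 * (p ⬝ᵥ p')))) • newtonT (jetA z p H) m +
    (z ^ (a + 1) * (p ⬝ᵥ p) ^ l) • dnewtonT (jetA z p H) (djetA z p H z' p' H') m

lemma hasEntryDerivAt_tensorX (a : ℝ) (l m : ℕ) {z : ℝ → ℝ} {p : ℝ → ι → ℝ}
    {H : ℝ → Matrix ι ι ℝ} {z' : ℝ} {p' : ι → ℝ} {H' : Matrix ι ι ℝ} {t : ℝ}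
    (hz0 : 0 < z t) (hz : HasDerivAt z z' t)
    (hp : ∀ a, HasDerivAt (fun s => p s a) (p' a) t) (hH : HasEntryDerivAt H H' t) :
    HasEntryDerivAt (fun s => tensorX a l m (z s) (p s) (H s))
      (dtensorX a l m (z t) (p t) (H t) z' p' H') t := by
  intro i j
  have h1 := hz.rpow_const (p := a + 1) (Or.inl hz0.ne')
  have h2 := (hasDerivAt_dotProduct_self hp).fun_pow l
  have h3 := hasEntryDerivAt_newtonT (hasEntryDerivAt_jetA hz hp hH) m i j
  refine ((h1.mul h2).mul h3).congr_deriv ?_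
  simp only [dtensorX, Pi.mul_apply, Matrix.add_apply, Matrix.smul_apply, smul_eq_mul,
    add_sub_cancel_right]
  ring

/-- The divergence of `tensorX` along a jet field, at a point where the derivative of the Hessian is
`W`: by `sum_dnewtonT` no third derivatives remain. -/
lemma sum_dtensorX (a : ℝ) (l m : ℕ) {z : ℝ} (hz : 0 < z) (p : ι → ℝ) {H : Matrix ι ι ℝ}
    (hH : H.IsHermitian) {W : ι → Matrix ι ι ℝ} (hW : ∀ i a b, W i a b = W a i b) (j : ι) :
    ∑ i, dtensorX a l m z p H (p i) (H i) (W i) j i = divX a l m z p H j := by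
  have hT := sum_dnewtonT z p H hW m j
  have hAs : (jetA z p H).IsHermitian := jetA_isHermitian hH
  have hcomm := (newtonT_commute (jetA z p H) m).eq
  have hsucc := newtonT_succ (jetA z p H) m
  have h1 := smul_hessian_eq z p H
  set A := jetA z p H with hA
  set T := newtonT A m with hTdef
  set r := p ⬝ᵥ p with hr
  have e1 : ∑ i, T j i * p i = T.mulVec p j := rfl
  have e2 : ∑ i, T j i * (z * (p ⬝ᵥ H i)) = T.mulVec (A.mulVec p) j + 1 / 2 * r * T.mulVec p j := by
    have : ∀ i, z * (p ⬝ᵥ H i) = A.mulVec p i + 1 / 2 * r * p i := by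
      intro i
      have := congrFun (congrArg (fun M => Matrix.mulVec M p) h1) i
      simp only [Matrix.smul_mulVec, Matrix.add_mulVec, Pi.smul_apply, Pi.add_apply, smul_eq_mul,
        Matrix.one_mulVec] at this
      rw [← this, Matrix.mulVec, dotProduct_comm]
    simp only [this, mul_add, Finset.sum_add_distrib]
    congr 1
    rw [← e1, Finset.mul_sum]
    exact Finset.sum_congr rfl fun i _ => by ring
  have e3 : (newtonT A (m + 1)).mulVec p j = sig A (m + 1) * p j - T.mulVec (A.mulVec p) j := by
    rw [hsucc, Matrix.sub_mulVec, Matrix.smul_mulVec, Matrix.one_mulVec, hcomm,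
      ← Matrix.mulVec_mulVec]
    rfl
  have hza : z ^ (a + 1) = z ^ a * z := Real.rpow_add_one hz.ne' a
  have hl : (l : ℝ) * r ^ (l - 1) * r = l * r ^ l := by
    cases l with
    | zero => simp
    | succ l => rw [Nat.add_sub_cancel, mul_assoc, ← pow_succ]
  have expand : ∑ i, dtensorX a l m z p H (p i) (H i) (W i) j i =
      (a + 1) * z ^ a * r ^ l * ∑ i, T j i * p i +
      2 * l * r ^ (l - 1) * z ^ a * ∑ i, T j i * (z * (p ⬝ᵥ H i)) +
      z ^ a * r ^ l * (z * ∑ i, dnewtonT A (djetA z p H (p i) (H i) (W i)) m j i) := by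
    simp only [Finset.mul_sum, ← Finset.sum_add_distrib]
    refine Finset.sum_congr rfl fun i _ => ?_
    simp only [dtensorX, Matrix.add_apply, Matrix.smul_apply, smul_eq_mul, hza]
    ring
  rw [expand, e1, e2, hT]
  simp only [divX, Pi.smul_apply, Pi.add_apply, Pi.sub_apply, smul_eq_mul, ← hA, ← hTdef, ← hr]
  rw [e3]
  linear_combination z ^ a * T.mulVec p j * hl

end JetTensor

/-! ### Jets of functions -/

section Jets

variable {n : ℕ}

/-- The coordinates of the gradient. -/
def grd (w : EuclideanSpace ℝ (Fin n) → ℝ) (x : EuclideanSpace ℝ (Fin n)) : Fin n → ℝ :=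
  fun i => fderiv ℝ w x (EuclideanSpace.single i 1)

lemma hasDerivAt_line {F : Type*} [NormedAddCommGroup F] [NormedSpace ℝ F]
    {f : EuclideanSpace ℝ (Fin n) → F} {x : EuclideanSpace ℝ (Fin n)}
    (hf : DifferentiableAt ℝ f x) (v : EuclideanSpace ℝ (Fin n)) :
    HasDerivAt (fun t : ℝ => f (x + t • v)) (fderiv ℝ f x v) 0 :=
  hf.hasFDerivAt.hasLineDerivAt v

lemma hessian_isHermitian {w : EuclideanSpace ℝ (Fin n) → ℝ} {x : EuclideanSpace ℝ (Fin n)}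
    (hw : ContDiffAt ℝ 2 w x) : (hessian w x).IsHermitian := by
  ext i j
  simp only [Matrix.conjTranspose_apply, hessian, Matrix.of_apply, star_trivial]
  exact (hw.isSymmSndFDerivAt (by simp)) _ _

lemma contDiff_grd {w : EuclideanSpace ℝ (Fin n) → ℝ} {d e : WithTop ℕ∞} (hw : ContDiff ℝ d w)
    (hd : e + 1 ≤ d) (i : Fin n) : ContDiff ℝ e fun x => grd w x i :=
  (hw.fderiv_right hd).clm_apply contDiff_const

lemma contDiff_hessian {w : EuclideanSpace ℝ (Fin n) → ℝ} {d e : WithTop ℕ∞}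
    (hw : ContDiff ℝ d w) (hd : e + 1 + 1 ≤ d) (i j : Fin n) :
    ContDiff ℝ e fun x => hessian w x i j :=
  (((hw.fderiv_right hd).fderiv_right le_rfl).clm_apply contDiff_const).clm_apply contDiff_const

lemma contDiff_dotProduct_self {X : Type*} [NormedAddCommGroup X] [NormedSpace ℝ X]
    {d : WithTop ℕ∞} {p : X → Fin n → ℝ} (hp : ∀ i, ContDiff ℝ d fun x => p x i) :
    ContDiff ℝ d fun x => p x ⬝ᵥ p x :=
  ContDiff.sum fun i _ => (hp i).mul (hp i)

lemma contDiff_jetA {X : Type*} [NormedAddCommGroup X] [NormedSpace ℝ X]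
    {d : WithTop ℕ∞} {z : X → ℝ} {p : X → Fin n → ℝ} {H : X → Matrix (Fin n) (Fin n) ℝ}
    (hz : ContDiff ℝ d z) (hp : ∀ i, ContDiff ℝ d fun x => p x i)
    (hH : ∀ i j, ContDiff ℝ d fun x => H x i j) (i j : Fin n) :
    ContDiff ℝ d fun x => jetA (z x) (p x) (H x) i j :=
  (hz.mul (hH i j)).sub ((contDiff_const.mul (contDiff_dotProduct_self hp)).mul contDiff_const)

lemma contDiff_tensorX (a : ℝ) (l m : ℕ) {w : EuclideanSpace ℝ (Fin n) → ℝ}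
    (hw : ContDiff ℝ 3 w) (hpos : ∀ x, 0 < w x) (i j : Fin n) :
    ContDiff ℝ 1 fun x => tensorX a l m (w x) (grd w x) (hessian w x) i j := by
  have h1 : ContDiff ℝ 1 w := hw.of_le (by norm_num)
  have h2 : ∀ i, ContDiff ℝ 1 fun x => grd w x i := contDiff_grd hw (by norm_num)
  have h3 : ∀ i j, ContDiff ℝ 1 fun x => hessian w x i j := contDiff_hessian hw (by norm_num)
  exact ((h1.rpow_const_of_ne fun x => (hpos x).ne').mul ((contDiff_dotProduct_self h2).pow l)).mul
    ((newtonT_sig_entries_contDiff (contDiff_jetA h1 h2 h3) m).1 i j)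

lemma sum_fderiv_tensorX (a : ℝ) (l m : ℕ) {w : EuclideanSpace ℝ (Fin n) → ℝ}
    (hw : ContDiff ℝ 3 w) (hpos : ∀ x, 0 < w x) (x : EuclideanSpace ℝ (Fin n)) (j : Fin n) :
    ∑ i, fderiv ℝ (fun y => tensorX a l m (w y) (grd w y) (hessian w y) j i) x
      (EuclideanSpace.single i 1) = divX a l m (w x) (grd w x) (hessian w x) j := by
  have hd1 : ContDiff ℝ 2 (fderiv ℝ w) := hw.fderiv_right (by norm_num)
  have hd2 : ContDiff ℝ 1 (fderiv ℝ (fderiv ℝ w)) := hd1.fderiv_right (by norm_num)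
  set W : Fin n → Matrix (Fin n) (Fin n) ℝ := fun i => Matrix.of fun a b =>
    fderiv ℝ (fderiv ℝ (fderiv ℝ w)) x (EuclideanSpace.single i 1) (EuclideanSpace.single a 1)
      (EuclideanSpace.single b 1) with hWdef
  have hW : ∀ i a b, W i a b = W a i b := by
    intro i a b
    have := (hd1.contDiffAt (x := x)).isSymmSndFDerivAt (by simp) (EuclideanSpace.single i 1)
      (EuclideanSpace.single a 1)
    exact congrArg (fun f => f (EuclideanSpace.single b 1)) this
  rw [← sum_dtensorX a l m (hpos x) (grd w x)
    (hessian_isHermitian ((hw.of_le (by norm_num)).contDiffAt)) hW j]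
  refine Finset.sum_congr rfl fun i _ => ?_
  set v : EuclideanSpace ℝ (Fin n) := EuclideanSpace.single i 1
  have l1 := hasDerivAt_line ((contDiff_tensorX a l m hw hpos j i).differentiable (by norm_num) x) v
  have c1 : HasDerivAt (fun t : ℝ => w (x + t • v)) (grd w x i) 0 :=
    hasDerivAt_line (hw.differentiable (by norm_num) x) v
  have c2 : ∀ b, HasDerivAt (fun t : ℝ => grd w (x + t • v) b) (hessian w x i b) 0 := by
    intro b
    have := hasDerivAt_line (hd1.differentiable (by norm_num) x) v
    exact (this.clm_apply (hasDerivAt_const (0 : ℝ) (EuclideanSpace.single b (1 : ℝ)))).congr_deriv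
      (by simp [hessian, v])
  have c3 : HasEntryDerivAt (fun t : ℝ => hessian w (x + t • v)) (W i) 0 := by
    intro b c
    have := hasDerivAt_line (hd2.differentiable (by norm_num) x) v
    have := this.clm_apply (hasDerivAt_const (0 : ℝ) (EuclideanSpace.single b (1 : ℝ)))
    exact (this.clm_apply (hasDerivAt_const (0 : ℝ) (EuclideanSpace.single c (1 : ℝ)))).congr_deriv
      (by simp [hWdef, v])
  have l2 := hasEntryDerivAt_tensorX a l m (t := 0) (z := fun t => w (x + t • v))
    (p := fun t => grd w (x + t • v)) (H := fun t => hessian w (x + t • v))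
    (by simpa using hpos x) c1 c2 c3 j i
  have := l1.unique l2
  simpa using this

lemma integral_fderiv_eq_zero {f : EuclideanSpace ℝ (Fin n) → ℝ} (hf : ContDiff ℝ 1 f)
    (hc : HasCompactSupport f) (v : EuclideanSpace ℝ (Fin n)) : ∫ x, fderiv ℝ f x v = 0 := by
  have hi : Integrable fun x => fderiv ℝ f x v :=
    ((hf.continuous_fderiv (by norm_num)).clm_apply continuous_const).integrable_of_hasCompactSupport
      (hc.fderiv_apply ℝ v)
  have := integral_mul_fderiv_eq_neg_fderiv_mul_of_integrable (μ := volume) (𝕜 := ℝ)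
    (f := fun _ : EuclideanSpace ℝ (Fin n) => (1 : ℝ)) (g := f) (v := v) (by simp) (by simpa using hi)
    (by simpa using hf.continuous.integrable_of_hasCompactSupport hc)
    (fun _ _ => differentiableAt_const _) (fun x _ => hf.differentiable (by norm_num) x)
  simpa using this

/-- The weak form of `div tensorX = divX`, for a function of class `C³`. -/
lemma integral_tensorX_of_contDiff_three (a : ℝ) (l m : ℕ) {w : EuclideanSpace ℝ (Fin n) → ℝ}
    (hw : ContDiff ℝ 3 w) (hpos : ∀ x, 0 < w x) {η : EuclideanSpace ℝ (Fin n) → ℝ}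
    (hη : ContDiff ℝ 1 η) (hc : HasCompactSupport η) (j : Fin n) :
    ∫ x, ((tensorX a l m (w x) (grd w x) (hessian w x)).mulVec (grd η x) j +
      η x * divX a l m (w x) (grd w x) (hessian w x) j) = 0 := by
  have hX := fun i => contDiff_tensorX a l m hw hpos j i
  have h1 : ∀ x, (tensorX a l m (w x) (grd w x) (hessian w x)).mulVec (grd η x) j +
      η x * divX a l m (w x) (grd w x) (hessian w x) j =
      ∑ i, fderiv ℝ (fun y => η y * tensorX a l m (w y) (grd w y) (hessian w y) j i) x
        (EuclideanSpace.single i 1) := by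
    intro x
    rw [← sum_fderiv_tensorX a l m hw hpos x j, Matrix.mulVec, dotProduct, Finset.mul_sum,
      ← Finset.sum_add_distrib]
    refine Finset.sum_congr rfl fun i _ => ?_
    rw [fderiv_fun_mul (hη.differentiable (by norm_num) x)
      ((hX i).differentiable (by norm_num) x)]
    simp only [add_apply, smul_apply, smul_eq_mul, grd]
    ring
  simp only [h1]
  rw [integral_finsetSum]
  · refine Finset.sum_eq_zero fun i _ => ?_
    exact integral_fderiv_eq_zero (hη.mul (hX i)) hc.mul_right _
  · intro i _
    exact (((hη.mul (hX i)).continuous_fderiv (by norm_num)).clm_apply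
      continuous_const).integrable_of_hasCompactSupport
      ((HasCompactSupport.mul_right hc).fderiv_apply ℝ _)

end Jets

/-! ### The divergence identity for functions of class `C²` -/

section Mollify

variable {n : ℕ}

open scoped Convolution in
/-- Mollification converges in `C²`, uniformly, for compactly supported functions of class `C²`. -/
lemma exists_contDiff_three_approx {f : EuclideanSpace ℝ (Fin n) → ℝ} (hf : ContDiff ℝ 2 f)
    (hc : HasCompactSupport f) :
    ∃ g : ℕ → EuclideanSpace ℝ (Fin n) → ℝ, (∀ k, ContDiff ℝ 3 (g k)) ∧
      ∀ ε > 0, ∀ᶠ k in atTop, ∀ x, ‖g k x - f x‖ ≤ ε ∧ ‖fderiv ℝ (g k) x - fderiv ℝ f x‖ ≤ ε ∧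
        ‖fderiv ℝ (fderiv ℝ (g k)) x - fderiv ℝ (fderiv ℝ f) x‖ ≤ ε := by
  set φ : ℕ → ContDiffBump (0 : EuclideanSpace ℝ (Fin n)) := fun k =>
    ⟨1 / (2 * ((k : ℝ) + 1)), 1 / ((k : ℝ) + 1), by positivity, by
      rw [div_lt_div_iff₀ (by positivity) (by positivity)]; linarith⟩ with hφ
  have hr : Tendsto (fun k => (φ k).rOut) atTop (𝓝 0) := tendsto_one_div_add_atTop_nhds_zero_nat
  have hunif : ∀ {F : Type} [NormedAddCommGroup F] [NormedSpace ℝ F] [CompleteSpace F]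
      (h : EuclideanSpace ℝ (Fin n) → F), Continuous h → HasCompactSupport h → ∀ ε > 0,
      ∀ᶠ k in atTop, ∀ x,
        ‖((φ k).normed volume ⋆[ContinuousLinearMap.lsmul ℝ ℝ, volume] h) x - h x‖ ≤ ε := by
    intro F _ _ _ h hh hhc ε hε
    obtain ⟨δ, hδ, hδ'⟩ := Metric.uniformContinuous_iff.1
      (hhc.uniformContinuous_of_continuous hh) ε hε
    filter_upwards [hr.eventually (gt_mem_nhds hδ)] with k hk x
    rw [← dist_eq_norm]
    refine ContDiffBump.dist_normed_convolution_le hh.aestronglyMeasurable fun y hy => ?_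
    exact (hδ' ((Metric.mem_ball.1 hy).trans hk)).le
  have hpre : ∀ {F : Type} [NormedAddCommGroup F] [NormedSpace ℝ F],
      (ContinuousLinearMap.lsmul ℝ ℝ).precompR (EuclideanSpace ℝ (Fin n)) =
        (ContinuousLinearMap.lsmul ℝ ℝ : ℝ →L[ℝ] (EuclideanSpace ℝ (Fin n) →L[ℝ] F) →L[ℝ] _) := by
    intro F _ _
    ext; simp
  have hli : ∀ k, LocallyIntegrable ((φ k).normed volume) volume := fun k =>
    ((φ k).continuous_normed).locallyIntegrable
  have hfd : ∀ k {F : Type} [NormedAddCommGroup F] [NormedSpace ℝ F] [CompleteSpace F]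
      (h : EuclideanSpace ℝ (Fin n) → F), ContDiff ℝ 1 h → HasCompactSupport h →
      fderiv ℝ ((φ k).normed volume ⋆[ContinuousLinearMap.lsmul ℝ ℝ, volume] h) =
        ((φ k).normed volume ⋆[ContinuousLinearMap.lsmul ℝ ℝ, volume] fderiv ℝ h) := by
    intro k F _ _ _ h hh hhc
    funext x
    have := (hhc.hasFDerivAt_convolution_right (ContinuousLinearMap.lsmul ℝ ℝ) (hli k) hh x).fderiv
    rwa [hpre] at this
  have hf1 : ContDiff ℝ 1 (fderiv ℝ f) := hf.fderiv_right (by norm_num)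
  refine ⟨fun k => (φ k).normed volume ⋆[ContinuousLinearMap.lsmul ℝ ℝ, volume] f,
    fun k => ?_, fun ε hε => ?_⟩
  · have h3 : ContDiff ℝ ((3 : ℕ∞) : WithTop ℕ∞) ((φ k).normed volume) := (φ k).contDiff_normed
    have h4 := HasCompactSupport.contDiff_convolution_left
      (ContinuousLinearMap.lsmul ℝ ℝ : ℝ →L[ℝ] ℝ →L[ℝ] ℝ) (μ := volume)
      (φ k).hasCompactSupport_normed h3 hf.continuous.locallyIntegrable
    exact h4
  · have hc1 : HasCompactSupport (fderiv ℝ f) := hc.fderiv ℝ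
    have hunif' : ∀ {F : Type} [NormedAddCommGroup F] [NormedSpace ℝ F] [CompleteSpace F]
        (h : EuclideanSpace ℝ (Fin n) → F), ContDiff ℝ 1 h → HasCompactSupport h →
        ∀ᶠ k in atTop, ∀ x, ‖((φ k).normed volume ⋆[ContinuousLinearMap.lsmul ℝ ℝ, volume]
          fderiv ℝ h) x - fderiv ℝ h x‖ ≤ ε := fun h hh hhc =>
      hunif _ (hh.continuous_fderiv (by norm_num)) (hhc.fderiv ℝ) ε hε
    have u0 := hunif f hf.continuous hc ε hε
    have u1 := hunif' f (hf.of_le (by norm_num)) hc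
    have u2 := hunif' (fderiv ℝ f) hf1 hc1
    filter_upwards [u0, u1, u2] with k h0 h1 h2 x
    rw [hfd k f (hf.of_le (by norm_num)) hc, hfd k (fderiv ℝ f) hf1 (hc.fderiv ℝ)]
    exact ⟨h0 x, h1 x, h2 x⟩

/-- The space of 2-jets `(z, p, H)`, with the sup norm. -/
abbrev Jet (n : ℕ) : Type := ℝ × (Fin n → ℝ) × (Fin n → Fin n → ℝ)

/-- The 2-jet of a function at a point. -/
def jetOf (w : EuclideanSpace ℝ (Fin n) → ℝ) (x : EuclideanSpace ℝ (Fin n)) : Jet n :=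
  (w x, grd w x, fun i j => hessian w x i j)

lemma continuous_jetOf {w : EuclideanSpace ℝ (Fin n) → ℝ} (hw : ContDiff ℝ 2 w) :
    Continuous (jetOf w) := by
  refine hw.continuous.prodMk (Continuous.prodMk ?_ ?_)
  · exact continuous_pi fun i => (contDiff_grd (e := 0) hw (by norm_num) i).continuous
  · exact continuous_pi fun i => continuous_pi fun j =>
      (contDiff_hessian (e := 0) hw (by norm_num) i j).continuous

/-- `T_m(A)` and `σ_m(A)` are polynomials in the jet. -/
lemma jet_entries_contDiff (m : ℕ) :
    (∀ i j, ContDiff ℝ 1 fun J : Jet n => newtonT (jetA J.1 J.2.1 (Matrix.of J.2.2)) m i j) ∧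
      ContDiff ℝ 1 fun J : Jet n => sig (jetA J.1 J.2.1 (Matrix.of J.2.2)) m := by
  refine newtonT_sig_entries_contDiff (fun i j => contDiff_jetA contDiff_fst ?_ ?_ i j) m
  · intro i; fun_prop
  · intro i j; simp only [Matrix.of_apply]; fun_prop

lemma continuous_jet_newtonT (m : ℕ) (i j : Fin n) :
    Continuous fun J : Jet n => newtonT (jetA J.1 J.2.1 (Matrix.of J.2.2)) m i j :=
  ((jet_entries_contDiff m).1 i j).continuous

lemma continuous_jet_sig (m : ℕ) :
    Continuous fun J : Jet n => sig (jetA J.1 J.2.1 (Matrix.of J.2.2)) m :=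
  (jet_entries_contDiff m).2.continuous

lemma continuous_jet_dotProduct_self : Continuous fun J : Jet n => J.2.1 ⬝ᵥ J.2.1 := by
  simp only [dotProduct]; fun_prop

lemma continuousOn_jet_rpow (a : ℝ) : ContinuousOn (fun J : Jet n => J.1 ^ a) {J | 0 < J.1} :=
  continuousOn_fst.rpow_const fun _ hJ => Or.inl (ne_of_gt hJ)

lemma continuousOn_tensorX (a : ℝ) (l m : ℕ) (i j : Fin n) :
    ContinuousOn (fun J : Jet n => tensorX a l m J.1 J.2.1 (Matrix.of J.2.2) i j)
      {J | 0 < J.1} :=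
  ((continuousOn_jet_rpow _).mul (continuous_jet_dotProduct_self.pow l).continuousOn).mul
    (continuous_jet_newtonT m i j).continuousOn

lemma continuous_jet_newtonT_mulVec (m : ℕ) (j : Fin n) : Continuous fun J : Jet n =>
    (newtonT (jetA J.1 J.2.1 (Matrix.of J.2.2)) m).mulVec J.2.1 j := by
  simp only [Matrix.mulVec, dotProduct]
  refine continuous_finsetSum _ fun i _ => (continuous_jet_newtonT m j i).mul ?_
  fun_prop

lemma continuousOn_divX (a : ℝ) (l m : ℕ) (j : Fin n) :
    ContinuousOn (fun J : Jet n => divX a l m J.1 J.2.1 (Matrix.of J.2.2) j) {J | 0 < J.1} := by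
  have hr := continuous_jet_dotProduct_self (n := n)
  have hp : Continuous fun J : Jet n => J.2.1 j := by fun_prop
  refine (continuousOn_jet_rpow _).mul (Continuous.continuousOn ?_)
  refine (((continuous_const.mul (hr.pow l)).mul (continuous_jet_newtonT_mulVec m j)).sub
    (((continuous_const.mul (hr.pow l)).mul (continuous_jet_sig m)).mul hp)).add
    ((continuous_const.mul (hr.pow (l - 1))).mul
      (((continuous_jet_sig (m + 1)).mul hp).sub (continuous_jet_newtonT_mulVec (m + 1) j)))

/-- The weak form of `div tensorX = divX` for a positive function of class `C²` that is constant
near infinity: both sides only involve the 2-jet, so one may pass to the limit in the identity for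
mollifications. -/
lemma integral_tensorX (a : ℝ) (l m : ℕ) {w : EuclideanSpace ℝ (Fin n) → ℝ}
    (hw : ContDiff ℝ 2 w) (hpos : ∀ x, 0 < w x) (hw1 : HasCompactSupport fun x => w x - 1)
    {η : EuclideanSpace ℝ (Fin n) → ℝ}
    (hη : ContDiff ℝ 1 η) (hc : HasCompactSupport η) (j : Fin n) :
    ∫ x, ((tensorX a l m (w x) (grd w x) (hessian w x)).mulVec (grd η x) j +
      η x * divX a l m (w x) (grd w x) (hessian w x) j) = 0 := by
  obtain ⟨g, hg3, hg⟩ := exists_contDiff_three_approx (hw.sub contDiff_const) hw1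
  set W : ℕ → EuclideanSpace ℝ (Fin n) → ℝ := fun k x => g k x + 1 with hW
  have hW3 : ∀ k, ContDiff ℝ 3 (W k) := fun k => (hg3 k).add contDiff_const
  -- the jets of the mollifications are uniformly close to those of `w`
  have hjet : ∀ ε > 0, ∀ᶠ k in atTop, ∀ x, dist (jetOf (W k) x) (jetOf w x) ≤ ε := by
    intro ε hε
    filter_upwards [hg ε hε] with k hk x
    obtain ⟨h0, h1, h2⟩ := hk x
    have d1 : fderiv ℝ (W k) = fderiv ℝ (g k) := by
      funext y; exact fderiv_add_const 1
    have d2 : fderiv ℝ (fun y => w y - 1) = fderiv ℝ w := by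
      funext y; rw [fderiv_sub_const]
    rw [← d1, d2] at h1 h2
    have hone : ∀ i : Fin n, ‖(EuclideanSpace.single i (1 : ℝ))‖ = 1 := by intro i; simp
    rw [dist_eq_norm, jetOf, jetOf, Prod.mk_sub_mk, Prod.mk_sub_mk, Prod.norm_mk, Prod.norm_mk]
    refine max_le ?_ (max_le ?_ ?_)
    · have e0 : W k x - w x = g k x - (w x - 1) := by rw [hW]; ring
      rw [e0]; exact h0
    · refine (pi_norm_le_iff_of_nonneg hε.le).2 fun i => ?_
      have := (fderiv ℝ (W k) x - fderiv ℝ w x).le_opNorm (EuclideanSpace.single i 1)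
      rw [hone, mul_one] at this
      exact this.trans h1
    · refine (pi_norm_le_iff_of_nonneg hε.le).2 fun i => (pi_norm_le_iff_of_nonneg hε.le).2
        fun j => ?_
      have e1 := (fderiv ℝ (fderiv ℝ (W k)) x - fderiv ℝ (fderiv ℝ w) x).le_opNorm
        (EuclideanSpace.single i 1)
      have e2 := ((fderiv ℝ (fderiv ℝ (W k)) x - fderiv ℝ (fderiv ℝ w) x)
        (EuclideanSpace.single i 1)).le_opNorm (EuclideanSpace.single j 1)
      rw [hone, mul_one] at e1 e2
      exact e2.trans (e1.trans h2)
  -- a compact set of jets with positive value that contains all of them from some index on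
  have hcomp : IsCompact (Set.range (jetOf w)) := by
    have h1 : Set.range (jetOf w) ⊆
        jetOf w '' (tsupport fun x => w x - 1) ∪ {((1, 0, 0) : Jet n)} := by
      rintro _ ⟨x, rfl⟩
      by_cases hx : x ∈ tsupport fun x => w x - 1
      · exact Or.inl ⟨x, hx, rfl⟩
      · right
        have hev : w =ᶠ[𝓝 x] fun _ => 1 := by
          filter_upwards [notMem_tsupport_iff_eventuallyEq.1 hx] with y hy
          simpa [sub_eq_zero] using hy
        have e1 : fderiv ℝ w =ᶠ[𝓝 x] fun _ => 0 := by
          filter_upwards [hev.eventuallyEq_nhds] with y hy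
          rw [hy.fderiv_eq]; simp
        have e2 : fderiv ℝ (fderiv ℝ w) x = 0 := by rw [e1.fderiv_eq]; simp
        rw [Set.mem_singleton_iff, jetOf, hev.eq_of_nhds]
        congr 2
        · funext i; simp [grd, e1.eq_of_nhds]
        · funext i j; simp [hessian, e2]
    have h2 : IsCompact (jetOf w '' (tsupport fun x => w x - 1) ∪ {((1, 0, 0) : Jet n)}) :=
      (hw1.image (continuous_jetOf hw)).union isCompact_singleton
    have h3 : Set.range (jetOf w) = jetOf w '' (tsupport fun x => w x - 1) ∪
        (Set.range (jetOf w) ∩ {((1, 0, 0) : Jet n)}) := by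
      apply Set.Subset.antisymm
      · intro J hJ
        rcases h1 hJ with h | h
        · exact Or.inl h
        · exact Or.inr ⟨hJ, h⟩
      · rintro J (⟨x, -, rfl⟩ | h)
        · exact ⟨x, rfl⟩
        · exact h.1
    rw [h3]
    exact (hw1.image (continuous_jetOf hw)).union
      ((Set.finite_singleton _).subset Set.inter_subset_right).isCompact
  have hopen : IsOpen {J : Jet n | 0 < J.1} := isOpen_lt continuous_const continuous_fst
  obtain ⟨δ, hδ, hδ'⟩ := hcomp.exists_cthickening_subset_open hopen
    (by rintro _ ⟨x, rfl⟩; exact hpos x)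
  set S := Metric.cthickening δ (Set.range (jetOf w)) with hS
  have hSc : IsCompact S := hcomp.cthickening
  have hmem : ∀ᶠ k in atTop, ∀ x, jetOf (W k) x ∈ S := by
    filter_upwards [hjet δ hδ] with k hk x
    exact Metric.mem_cthickening_of_dist_le _ _ _ _ ⟨x, rfl⟩ (hk x)
  have hlim : ∀ x, Tendsto (fun k => jetOf (W k) x) atTop (𝓝 (jetOf w x)) := by
    intro x
    rw [Metric.tendsto_nhds]
    intro ε hε
    filter_upwards [hjet (ε / 2) (half_pos hε)] with k hk
    exact (hk x).trans_lt (half_lt_self hε)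
  set F : Jet n → EuclideanSpace ℝ (Fin n) → ℝ := fun J x =>
    (tensorX a l m J.1 J.2.1 (Matrix.of J.2.2)).mulVec (grd η x) j +
      η x * divX a l m J.1 J.2.1 (Matrix.of J.2.2) j with hF
  have hFc : ∀ x, ContinuousOn (fun J => F J x) {J | 0 < J.1} := by
    intro x
    simp only [hF, Matrix.mulVec, dotProduct]
    exact (continuousOn_finsetSum _ fun i _ => (continuousOn_tensorX a l m j i).mul
      continuousOn_const).add (continuousOn_const.mul (continuousOn_divX a l m j))
  have hgη : ∀ i, Continuous fun x => grd η x i := fun i =>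
    (contDiff_grd (e := 0) hη (by norm_num) i).continuous
  have hbX : ∀ i, ∃ C, ∀ J ∈ S, ‖tensorX a l m J.1 J.2.1 (Matrix.of J.2.2) j i‖ ≤ C := fun i =>
    hSc.exists_bound_of_continuousOn ((continuousOn_tensorX a l m j i).mono hδ')
  choose C hC using hbX
  obtain ⟨C', hC'⟩ := hSc.exists_bound_of_continuousOn ((continuousOn_divX a l m j).mono hδ')
  have hbound : ∀ J ∈ S, ∀ x, ‖F J x‖ ≤ ∑ i, C i * ‖grd η x i‖ + ‖η x‖ * C' := by
    intro J hJ x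
    refine (norm_add_le _ _).trans (add_le_add ?_ ?_)
    · simp only [Matrix.mulVec, dotProduct]
      refine (norm_sum_le _ _).trans (Finset.sum_le_sum fun i _ => ?_)
      rw [norm_mul]
      exact mul_le_mul_of_nonneg_right (hC i J hJ) (norm_nonneg _)
    · rw [norm_mul]
      exact mul_le_mul_of_nonneg_left (hC' J hJ) (norm_nonneg _)
  have hbint : Integrable fun x => ∑ i, C i * ‖grd η x i‖ + ‖η x‖ * C' := by
    refine (integrable_finsetSum _ fun i _ => Integrable.const_mul ?_ _).add
      (Integrable.mul_const ?_ _)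
    · exact ((hgη i).integrable_of_hasCompactSupport (hc.fderiv_apply ℝ _)).norm
    · exact (hη.continuous.integrable_of_hasCompactSupport hc).norm
  have hT : Tendsto (fun k => ∫ x, F (jetOf (W k) x) x) atTop (𝓝 (∫ x, F (jetOf w x) x)) := by
    refine tendsto_integral_filter_of_dominated_convergence _ ?_ ?_ hbint ?_
    · filter_upwards [hmem] with k hk
      have hc1 : Continuous (jetOf (W k)) := continuous_jetOf ((hW3 k).of_le (by norm_num))
      have hpk : ∀ x, jetOf (W k) x ∈ {J : Jet n | 0 < J.1} := fun x => hδ' (hk x)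
      refine Continuous.aestronglyMeasurable ?_
      simp only [hF, Matrix.mulVec, dotProduct]
      refine (continuous_finsetSum _ fun i _ => Continuous.mul ?_ (hgη i)).add
        (hη.continuous.mul ?_)
      · exact (continuousOn_tensorX a l m j i).comp_continuous hc1 hpk
      · exact (continuousOn_divX a l m j).comp_continuous hc1 hpk
    · filter_upwards [hmem] with k hk
      exact Eventually.of_forall fun x => hbound _ (hk x) x
    · refine Eventually.of_forall fun x => ?_
      exact ((hFc x).continuousAt (hopen.mem_nhds (hpos x))).tendsto.comp (hlim x)
  have hzero : ∀ᶠ k in atTop, ∫ x, F (jetOf (W k) x) x = 0 := by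
    filter_upwards [hmem] with k hk
    exact integral_tensorX_of_contDiff_three a l m (hW3 k) (fun x => hδ' (hk x)) hη hc j
  exact tendsto_nhds_unique hT ((tendsto_congr' hzero).2 tendsto_const_nhds)

end Mollify

/-! ### The linearization and its adjoint -/

section Linearization

variable {ι : Type*} [Fintype ι] [DecidableEq ι]

/-- The value of `ψ` on a 2-jet. -/
def psiJ (k : ℕ) (a : ℝ) (b : ℕ → ℝ) (z : ℝ) (p : ι → ℝ) (H : Matrix ι ι ℝ) : ℝ :=
  ∑ l ∈ Finset.range (k + 1), b l * z ^ a * (p ⬝ᵥ p) ^ l * sig (jetA z p H) (k - l)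

/-- The derivative of `σ_m` at `A` in the direction `B`. -/
def dsig (A B : Matrix ι ι ℝ) : ℕ → ℝ
  | 0 => 0
  | m + 1 => (newtonT A m * B).trace

/-- The derivative of `psiJ` at the jet `(z, p, H)` in the direction `(f, g, K)`. -/
def dpsiJ (k : ℕ) (a : ℝ) (b : ℕ → ℝ) (z : ℝ) (p : ι → ℝ) (H : Matrix ι ι ℝ)
    (f : ℝ) (g : ι → ℝ) (K : Matrix ι ι ℝ) : ℝ :=
  ∑ l ∈ Finset.range (k + 1), b l *
    ((a * z ^ (a - 1) * f * (p ⬝ᵥ p) ^ l + z ^ a * (l * (p ⬝ᵥ p) ^ (l - 1) * (2 * (p ⬝ᵥ g)))) *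
        sig (jetA z p H) (k - l) +
      z ^ a * (p ⬝ᵥ p) ^ l * dsig (jetA z p H) (djetA z p H f g K) (k - l))

/-- The zeroth order coefficient of the linearization of `ψ`. -/
def zeroCoeff (k : ℕ) (a : ℝ) (b : ℕ → ℝ) (z : ℝ) (p : ι → ℝ) (H : Matrix ι ι ℝ) : ℝ :=
  z ^ (a - 1) * (∑ l ∈ Finset.range (k + 1),
      b l * (a + k - l) * ((p ⬝ᵥ p) ^ l * sig (jetA z p H) (k - l)) +
    ∑ l ∈ Finset.range k, b l * (1 / 2 * (Fintype.card ι - k + l + 1)) *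
      ((p ⬝ᵥ p) ^ (l + 1) * sig (jetA z p H) (k - (l + 1))))

/-- The coefficients `e_j` of the first order term `- ∑ e_j z^a |p|^(2j) (T_(k-1-j) p) · g` that
remains when the second order part of the linearization of `ψ` is put in divergence form; `N` stands
for the dimension. -/
def fluxCoeff (N a : ℝ) (b : ℕ → ℝ) (j : ℕ) : ℝ :=
  (a + N + 1 + j) * b j - 2 * (j + 1) * b (j + 1)

lemma hasDerivAt_psiJ (k : ℕ) (a : ℝ) (b : ℕ → ℝ) {z : ℝ → ℝ} {p : ℝ → ι → ℝ}
    {H : ℝ → Matrix ι ι ℝ} {z' : ℝ} {p' : ι → ℝ} {H' : Matrix ι ι ℝ} {t : ℝ}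
    (hz0 : 0 < z t) (hz : HasDerivAt z z' t)
    (hp : ∀ a, HasDerivAt (fun s => p s a) (p' a) t) (hH : HasEntryDerivAt H H' t) :
    HasDerivAt (fun s => psiJ k a b (z s) (p s) (H s))
      (dpsiJ k a b (z t) (p t) (H t) z' p' H') t := by
  refine HasDerivAt.fun_sum fun l _ => ?_
  have h1 := hz.rpow_const (p := a) (Or.inl hz0.ne')
  have h2 := (hasDerivAt_dotProduct_self hp).fun_pow l
  have h3 : HasDerivAt (fun s => sig (jetA (z s) (p s) (H s)) (k - l))
      (dsig (jetA (z t) (p t) (H t)) (djetA (z t) (p t) (H t) z' p' H') (k - l)) t := by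
    cases k - l with
    | zero => exact hasDerivAt_const t _
    | succ m => exact hasDerivAt_sig (hasEntryDerivAt_jetA hz hp hH) m
  refine (((h1.const_mul (b l)).mul h2).mul h3).congr_deriv ?_
  simp only [Pi.mul_apply]
  ring

lemma trace_newtonT_mul_hessian (z : ℝ) (p : ι → ℝ) (H : Matrix ι ι ℝ) (m : ℕ) :
    z * (newtonT (jetA z p H) m * H).trace = (m + 1) * sig (jetA z p H) (m + 1) +
      1 / 2 * (p ⬝ᵥ p) * ((Fintype.card ι - m) * sig (jetA z p H) m) := by
  have h1 := congrArg (fun M => (newtonT (jetA z p H) m * M).trace) (smul_hessian_eq z p H)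
  simp only [Matrix.mul_smul, Matrix.trace_smul, mul_add, Matrix.trace_add, mul_one, smul_eq_mul]
    at h1
  rw [h1, Matrix.trace_mul_comm, trace_mul_newtonT, trace_newtonT]

/-- The linearization of `ψ` at a 2-jet, in a direction `(f, g, K)`. On jets of functions the first
sum is a divergence, since `divX` is the divergence of `tensorX`. -/
lemma linearization_eq {k : ℕ} (a : ℝ) (b : ℕ → ℝ) {z : ℝ} (hz : 0 < z)
    (p : ι → ℝ) (H : Matrix ι ι ℝ) (f : ℝ) (g : ι → ℝ) (K : Matrix ι ι ℝ) :
    dpsiJ k a b z p H f g K =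
      ∑ l ∈ Finset.range k, b l * ((tensorX a l (k - 1 - l) z p H * K).trace +
        divX a l (k - 1 - l) z p H ⬝ᵥ g) -
      ∑ j ∈ Finset.range k, fluxCoeff (Fintype.card ι) a b j *
        ((tensorX (a - 1) j (k - 1 - j) z p H).mulVec p ⬝ᵥ g) +
      zeroCoeff k a b z p H * f := by
  set A := jetA z p H with hA
  set r := p ⬝ᵥ p with hr
  have hza : z ^ a = z ^ (a - 1) * z := by
    rw [← Real.rpow_add_one hz.ne', sub_add_cancel]
  have hza1 : z ^ (a + 1) = z ^ a * z := Real.rpow_add_one hz.ne' a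
  set τ : ℕ → ℝ := fun j => z ^ a * r ^ j * ((newtonT A (k - 1 - j)).mulVec p ⬝ᵥ g) with hτ
  have hY : ∀ j, (tensorX (a - 1) j (k - 1 - j) z p H).mulVec p ⬝ᵥ g = τ j := by
    intro j
    rw [tensorX, sub_add_cancel, Matrix.smul_mulVec, smul_dotProduct, smul_eq_mul]
  -- the terms with `l < k`
  have hterm : ∀ l ∈ Finset.range k, b l *
      ((a * z ^ (a - 1) * f * r ^ l + z ^ a * (l * r ^ (l - 1) * (2 * (p ⬝ᵥ g)))) * sig A (k - l) +
        z ^ a * r ^ l * dsig A (djetA z p H f g K) (k - l)) =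
      b l * ((tensorX a l (k - 1 - l) z p H * K).trace + divX a l (k - 1 - l) z p H ⬝ᵥ g) +
      (2 * l * b l * τ (l - 1) - (a + Fintype.card ι + 1 + l) * b l * τ l) +
      z ^ (a - 1) * (b l * (a + k - l) * (r ^ l * sig A (k - l)) +
        b l * (1 / 2 * (Fintype.card ι - k + l + 1)) * (r ^ (l + 1) * sig A (k - (l + 1)))) * f := by
    intro l hl
    rw [Finset.mem_range] at hl
    obtain ⟨m, rfl⟩ : ∃ m, k = l + 1 + m := ⟨k - (l + 1), by omega⟩
    have i1 : l + 1 + m - l = m + 1 := by omega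
    have i2 : l + 1 + m - 1 - l = m := by omega
    have i3 : l + 1 + m - (l + 1) = m := by omega
    have e1 := trace_newtonT_mul_hessian z p H m
    rw [← hA, ← hr] at e1
    have e2 : dsig A (djetA z p H f g K) (m + 1) = f * (newtonT A m * H).trace +
        z * (newtonT A m * K).trace - (p ⬝ᵥ g) * ((Fintype.card ι - m) * sig A m) := by
      simp only [dsig, djetA, mul_sub, mul_add, Matrix.mul_smul, Matrix.trace_sub,
        Matrix.trace_add, Matrix.trace_smul, smul_eq_mul, mul_one, trace_newtonT]
    have e3 : (tensorX a l m z p H * K).trace = z ^ (a + 1) * r ^ l * (newtonT A m * K).trace := by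
      rw [tensorX, Matrix.smul_mul, Matrix.trace_smul, smul_eq_mul]
    have e4 : divX a l m z p H ⬝ᵥ g = z ^ a *
        ((a + 1 + Fintype.card ι + l) * r ^ l * ((newtonT A m).mulVec p ⬝ᵥ g) -
          (Fintype.card ι - m) * r ^ l * sig A m * (p ⬝ᵥ g) +
          2 * l * r ^ (l - 1) * (sig A (m + 1) * (p ⬝ᵥ g) -
            (newtonT A (m + 1)).mulVec p ⬝ᵥ g)) := by
      simp only [divX, smul_dotProduct, add_dotProduct, sub_dotProduct, smul_eq_mul, ← hA, ← hr]
    have e5 : (l : ℝ) * τ (l - 1) =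
        l * (z ^ a * r ^ (l - 1) * ((newtonT A (m + 1)).mulVec p ⬝ᵥ g)) := by
      cases l with
      | zero => simp
      | succ l =>
        simp only [hτ, Nat.add_sub_cancel]
        rw [show l + 1 + 1 + m - 1 - l = m + 1 by omega]
    have e6 : τ l = z ^ a * r ^ l * ((newtonT A m).mulVec p ⬝ᵥ g) := by simp only [hτ, i2]
    rw [hza] at e5
    rw [i1, i2, i3, e2, e3, e4, e6, hza1, hza]
    push_cast
    linear_combination b l * z ^ (a - 1) * r ^ l * f * e1 - 2 * b l * e5
  have hlast : b k *
      ((a * z ^ (a - 1) * f * r ^ k + z ^ a * (k * r ^ (k - 1) * (2 * (p ⬝ᵥ g)))) * sig A (k - k) +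
        z ^ a * r ^ k * dsig A (djetA z p H f g K) (k - k)) =
      2 * k * b k * τ (k - 1) + z ^ (a - 1) * (b k * (a + k - k) * (r ^ k * sig A (k - k))) * f := by
    have : (k : ℝ) * τ (k - 1) = k * (z ^ a * r ^ (k - 1) * (p ⬝ᵥ g)) := by
      simp [hτ, newtonT_zero]
    simp only [Nat.sub_self, sig_zero, dsig]
    linear_combination -2 * b k * this
  have hshift : ∑ l ∈ Finset.range k, 2 * (l : ℝ) * b l * τ (l - 1) + 2 * k * b k * τ (k - 1) =
      ∑ j ∈ Finset.range k, 2 * ((j : ℝ) + 1) * b (j + 1) * τ j := by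
    rw [← Finset.sum_range_succ (fun l => 2 * (l : ℝ) * b l * τ (l - 1)), Finset.sum_range_succ']
    simp
  have hflux : ∑ j ∈ Finset.range k, fluxCoeff (Fintype.card ι) a b j *
        ((tensorX (a - 1) j (k - 1 - j) z p H).mulVec p ⬝ᵥ g) =
      ∑ j ∈ Finset.range k, (a + Fintype.card ι + 1 + j) * b j * τ j -
        ∑ j ∈ Finset.range k, 2 * ((j : ℝ) + 1) * b (j + 1) * τ j := by
    rw [← Finset.sum_sub_distrib]
    refine Finset.sum_congr rfl fun j _ => ?_
    rw [hY, fluxCoeff]; ring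
  rw [hflux, ← hshift, dpsiJ, zeroCoeff, Finset.sum_range_succ, ← hA, ← hr, hlast,
    Finset.sum_congr rfl hterm, Finset.sum_range_succ (fun l => b l * (a + k - l) * _),
    Finset.sum_add_distrib, Finset.sum_add_distrib, Finset.sum_sub_distrib, ← Finset.sum_mul,
    ← Finset.mul_sum, Finset.sum_add_distrib]
  ring

/-- The adjoint of the linearization applied to the constant `1`; it only involves the 2-jet. -/
def adjointOne (k : ℕ) (a : ℝ) (b : ℕ → ℝ) (z : ℝ) (p : ι → ℝ) (H : Matrix ι ι ℝ) : ℝ :=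
  zeroCoeff k a b z p H + ∑ j ∈ Finset.range k, fluxCoeff (Fintype.card ι) a b j *
    ((tensorX (a - 1) j (k - 1 - j) z p H * H).trace + divX (a - 1) j (k - 1 - j) z p H ⬝ᵥ p)

/-- Rearrangement of the coefficients of `adjointOne`: under the inequalities on `b` only the
coefficient of `s 0` matters. -/
lemma coefficient_sum_le {k : ℕ} (hk : 1 ≤ k) (N a : ℝ) (b : ℕ → ℝ) (s t : ℕ → ℝ)
    (hs : ∀ j ≤ k, 0 ≤ s j) (ht : ∀ j < k, 0 ≤ t j) (hst : t (k - 1) = s k)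
    (h2 : b k * (a + k * N + 2 * k * (a + N + k + 1))
        - 1 / 2 * (a + N + k - 1) * N * b (k - 1)
        - 4 * k * (a + N + k) * b k
        + b (k - 1) * (a + N + k) * (a + N + k - 1) ≤ 0)
    (h3 : ∀ l : ℕ, 1 ≤ l → l + 1 ≤ k →
      b l * (a + k - l + l * (N + l - k) + (a + N + l + 1) * (k + l))
        - 2 * (l + 1) * (k + l) * b (l + 1)
        - 1 / 2 * (a + N + l - 1) * (N + l - k) * b (l - 1) ≤ 0)
    (h4 : ∀ l : ℕ, l + 2 ≤ k →
      b l * (a + N + l + 1) * (a + N + l)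
        - 4 * (l + 1) * (a + N + l + 1) * b (l + 1)
        + 4 * (l + 2) * (l + 1) * b (l + 2) ≤ 0) :
    ∑ l ∈ Finset.range (k + 1), b l * (a + k - l) * s l +
      ∑ l ∈ Finset.range k, b l * (1 / 2 * (N - k + l + 1)) * s (l + 1) +
      ∑ j ∈ Finset.range k, fluxCoeff N a b j * ((a + N + j) * t j -
        1 / 2 * (N - k + 1 + j) * s (j + 1) + (k + j) * s j - 2 * j * t (j - 1)) ≤
      (b 0 * (a + k + (a + N + 1) * k) - 2 * k * b 1) * s 0 := by
  obtain ⟨q, rfl⟩ : ∃ q, k = q + 1 := ⟨k - 1, by omega⟩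
  rw [Nat.add_sub_cancel] at hst h2
  have e3 : ∑ j ∈ Finset.range (q + 1), fluxCoeff N a b j * ((a + N + j) * t j -
        1 / 2 * (N - (q + 1 : ℕ) + 1 + j) * s (j + 1) + ((q + 1 : ℕ) + j) * s j
          - 2 * j * t (j - 1)) =
      ∑ j ∈ Finset.range (q + 1), fluxCoeff N a b j * ((a + N + j) * t j -
        1 / 2 * (N - (q + 1 : ℕ) + 1 + j) * s (j + 1)) +
      ∑ j ∈ Finset.range (q + 1), fluxCoeff N a b j * (((q + 1 : ℕ) + j) * s j
          - 2 * j * t (j - 1)) := by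
    rw [← Finset.sum_add_distrib]
    exact Finset.sum_congr rfl fun j _ => by ring
  rw [e3, Finset.sum_range_succ' (fun l => b l * (a + (q + 1 : ℕ) - l) * s l),
    Finset.sum_range_succ' (fun j => fluxCoeff N a b j * (((q + 1 : ℕ) + j) * s j
          - 2 * j * t (j - 1)))]
  simp only [Finset.sum_range_succ _ q]
  rw [hst]
  simp only [Nat.add_sub_cancel]
  have hmain : ∑ l ∈ Finset.range q, (b (l + 1) * (a + (q + 1 : ℕ) - (l + 1 : ℕ)) * s (l + 1) +
      b l * (1 / 2 * (N - (q + 1 : ℕ) + l + 1)) * s (l + 1) +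
      fluxCoeff N a b l * ((a + N + l) * t l - 1 / 2 * (N - (q + 1 : ℕ) + 1 + l) * s (l + 1)) +
      fluxCoeff N a b (l + 1) * (((q + 1 : ℕ) + (l + 1 : ℕ)) * s (l + 1) -
        2 * (l + 1 : ℕ) * t l)) ≤ 0 := by
    refine Finset.sum_nonpos fun l hl => ?_
    rw [Finset.mem_range] at hl
    have a3 := h3 (l + 1) (by omega) (by omega)
    have a4 := h4 l (by omega)
    rw [Nat.add_sub_cancel] at a3
    have s3 := mul_nonpos_of_nonpos_of_nonneg a3 (hs (l + 1) (by omega))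
    have s4 := mul_nonpos_of_nonpos_of_nonneg a4 (ht l (by omega))
    refine le_of_eq_of_le ?_ (add_nonpos s3 s4)
    simp only [fluxCoeff]
    push_cast
    ring
  have hlast := mul_nonpos_of_nonpos_of_nonneg h2 (hs (q + 1) le_rfl)
  simp only [Finset.sum_add_distrib] at hmain
  have hE : b (q + 1) * (a + (q + 1 : ℕ) - (q + 1 : ℕ)) * s (q + 1) +
      b q * (1 / 2 * (N - (q + 1 : ℕ) + q + 1)) * s (q + 1) +
      fluxCoeff N a b q * ((a + N + q) * s (q + 1) -
        1 / 2 * (N - (q + 1 : ℕ) + 1 + q) * s (q + 1)) ≤ 0 := by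
    refine le_of_eq_of_le ?_ hlast
    simp only [fluxCoeff]
    push_cast
    ring
  have h0 : b 0 * (a + (q + 1 : ℕ) - (0 : ℕ)) * s 0 +
      fluxCoeff N a b 0 * (((q + 1 : ℕ) + (0 : ℕ)) * s 0 - 2 * (0 : ℕ) * t (0 - 1)) =
      (b 0 * (a + (q + 1 : ℕ) + (a + N + 1) * (q + 1 : ℕ)) - 2 * (q + 1 : ℕ) * b 1) * s 0 := by
    simp only [fluxCoeff]
    push_cast
    ring
  rw [← h0]
  linarith

lemma dotProduct_mulVec_nonneg {ι : Type*} [Fintype ι] {M : Matrix ι ι ℝ}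
    (hM : M.PosSemidef) (p : ι → ℝ) :
    0 ≤ M.mulVec p ⬝ᵥ p := by
  have := hM.dotProduct_mulVec_nonneg p
  rw [dotProduct_comm]
  simpa using this

/-- The place where the inequalities on the coefficients enter: all terms of the adjoint operator
applied to `1` except that of `σ_k(A)` have a favourable sign on the Gårding cone. -/
lemma adjointOne_le {k : ℕ} (hk : 1 ≤ k) (hkn : k ≤ Fintype.card ι) (a : ℝ) (b : ℕ → ℝ)
    (h2 : b k * (a + k * Fintype.card ι + 2 * k * (a + Fintype.card ι + k + 1))
        - 1 / 2 * (a + Fintype.card ι + k - 1) * Fintype.card ι * b (k - 1)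
        - 4 * k * (a + Fintype.card ι + k) * b k
        + b (k - 1) * (a + Fintype.card ι + k) * (a + Fintype.card ι + k - 1) ≤ 0)
    (h3 : ∀ l : ℕ, 1 ≤ l → l + 1 ≤ k →
      b l * (a + k - l + l * (Fintype.card ι + l - k) + (a + Fintype.card ι + l + 1) * (k + l))
        - 2 * (l + 1) * (k + l) * b (l + 1)
        - 1 / 2 * (a + Fintype.card ι + l - 1) * (Fintype.card ι + l - k) * b (l - 1) ≤ 0)
    (h4 : ∀ l : ℕ, l + 2 ≤ k →
      b l * (a + Fintype.card ι + l + 1) * (a + Fintype.card ι + l)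
        - 4 * (l + 1) * (a + Fintype.card ι + l + 1) * b (l + 1)
        + 4 * (l + 2) * (l + 1) * b (l + 2) ≤ 0)
    {z : ℝ} (hz : 0 < z) (p : ι → ℝ) (H : Matrix ι ι ℝ) (hA : jetA z p H ∈ matCone ι k) :
    adjointOne k a b z p H ≤ (b 0 * (a + k + (a + Fintype.card ι + 1) * k) - 2 * k * b 1) *
      (z ^ (a - 1) * sig (jetA z p H) k) := by
  set A := jetA z p H with hAdef
  set r := p ⬝ᵥ p with hr
  have hr0 : 0 ≤ r := Finset.sum_nonneg fun i _ => mul_self_nonneg (p i)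
  set s : ℕ → ℝ := fun j => r ^ j * sig A (k - j) with hs
  set t : ℕ → ℝ := fun j => r ^ j * ((newtonT A (k - 1 - j)).mulVec p ⬝ᵥ p) with ht
  have hza : z ^ a = z ^ (a - 1) * z := by
    rw [← Real.rpow_add_one hz.ne', sub_add_cancel]
  have hdiv : ∀ j ∈ Finset.range k, fluxCoeff (Fintype.card ι) a b j *
      ((tensorX (a - 1) j (k - 1 - j) z p H * H).trace + divX (a - 1) j (k - 1 - j) z p H ⬝ᵥ p) =
      z ^ (a - 1) * (fluxCoeff (Fintype.card ι) a b j * ((a + Fintype.card ι + j) * t j -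
        1 / 2 * (Fintype.card ι - k + 1 + j) * s (j + 1) + (k + j) * s j
          - 2 * j * t (j - 1))) := by
    intro j hj
    rw [Finset.mem_range] at hj
    obtain ⟨m, rfl⟩ : ∃ m, k = j + 1 + m := ⟨k - (j + 1), by omega⟩
    have i1 : j + 1 + m - j = m + 1 := by omega
    have i2 : j + 1 + m - 1 - j = m := by omega
    have i3 : j + 1 + m - (j + 1) = m := by omega
    have e1 := trace_newtonT_mul_hessian z p H m
    rw [← hAdef, ← hr] at e1
    have e3 : (tensorX (a - 1) j m z p H * H).trace =
        z ^ (a - 1) * r ^ j * (z * (newtonT A m * H).trace) := by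
      rw [tensorX, Matrix.smul_mul, Matrix.trace_smul, smul_eq_mul, sub_add_cancel, hza]
      ring
    have e4 : divX (a - 1) j m z p H ⬝ᵥ p = z ^ (a - 1) *
        ((a - 1 + 1 + Fintype.card ι + j) * r ^ j * ((newtonT A m).mulVec p ⬝ᵥ p) -
          (Fintype.card ι - m) * r ^ j * sig A m * r +
          2 * j * r ^ (j - 1) * (sig A (m + 1) * r - (newtonT A (m + 1)).mulVec p ⬝ᵥ p)) := by
      simp only [divX, smul_dotProduct, add_dotProduct, sub_dotProduct, smul_eq_mul, ← hAdef,
        ← hr]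
    have e5 : (j : ℝ) * t (j - 1) = j * (r ^ (j - 1) * ((newtonT A (m + 1)).mulVec p ⬝ᵥ p)) := by
      cases j with
      | zero => simp
      | succ j =>
        simp only [ht, Nat.add_sub_cancel]
        rw [show j + 1 + 1 + m - 1 - j = m + 1 by omega]
    have e6 : (j : ℝ) * r ^ (j - 1) * r = j * r ^ j := by
      cases j with
      | zero => simp
      | succ j => rw [Nat.add_sub_cancel, mul_assoc, ← pow_succ]
    rw [mul_assoc 2 (j : ℝ) (t _), e5]
    simp only [hs, ht, i1, i2, i3]
    rw [e3, e4, e1]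
    push_cast
    linear_combination 2 * z ^ (a - 1) * sig A (m + 1) * fluxCoeff (Fintype.card ι) a b j * e6
  have hle := coefficient_sum_le hk (Fintype.card ι) a b s t
    (fun j hj => mul_nonneg (pow_nonneg hr0 _) (hA.2 _ (by omega)))
    (fun j hj => mul_nonneg (pow_nonneg hr0 _)
      (dotProduct_mulVec_nonneg (newtonT_posSemidef hkn (by omega) hA) p))
    (by
      simp only [ht, hs, Nat.sub_self, newtonT_zero, sig_zero, Matrix.one_mulVec, mul_one]
      rw [← hr, ← pow_succ, Nat.sub_add_cancel hk]) h2 h3 h4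
  rw [adjointOne, Finset.sum_congr rfl hdiv, zeroCoeff, ← Finset.mul_sum, ← mul_add]
  have hzp : 0 ≤ z ^ (a - 1) := Real.rpow_nonneg hz.le _
  have := mul_le_mul_of_nonneg_left hle hzp
  have hs0 : s 0 = sig A k := by simp [hs]
  rw [hs0] at this
  refine this.trans (le_of_eq (by ring))

end Linearization

/-! ### The first variation formula -/

section FirstVariation

variable {n : ℕ}

lemma continuous_tensorX_jetOf (a : ℝ) (l m : ℕ) {w : EuclideanSpace ℝ (Fin n) → ℝ}
    (hw : ContDiff ℝ 2 w) (hpos : ∀ x, 0 < w x) (i j : Fin n) :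
    Continuous fun x => tensorX a l m (w x) (grd w x) (hessian w x) i j :=
  (continuousOn_tensorX a l m i j).comp_continuous (continuous_jetOf hw) hpos

lemma continuous_divX_jetOf (a : ℝ) (l m : ℕ) {w : EuclideanSpace ℝ (Fin n) → ℝ}
    (hw : ContDiff ℝ 2 w) (hpos : ∀ x, 0 < w x) (j : Fin n) :
    Continuous fun x => divX a l m (w x) (grd w x) (hessian w x) j :=
  (continuousOn_divX a l m j).comp_continuous (continuous_jetOf hw) hpos

lemma grd_mul {f g : EuclideanSpace ℝ (Fin n) → ℝ} {x : EuclideanSpace ℝ (Fin n)}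
    (hf : DifferentiableAt ℝ f x) (hg : DifferentiableAt ℝ g x) (i : Fin n) :
    grd (fun y => f y * g y) x i = f x * grd g x i + g x * grd f x i := by
  simp only [grd]
  rw [fderiv_fun_mul hf hg]
  simp

lemma grd_comp {G : ℝ → ℝ} {f : EuclideanSpace ℝ (Fin n) → ℝ} {x : EuclideanSpace ℝ (Fin n)}
    {G' : ℝ} (hG : HasDerivAt G G' (f x)) (hf : DifferentiableAt ℝ f x) :
    grd (fun y => G (f y)) x = G' • grd f x := by
  funext i
  have := (hG.comp_hasFDerivAt x hf.hasFDerivAt).fderiv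
  rw [grd, show (fun y => G (f y)) = G ∘ f from rfl, this]
  rfl

lemma grd_grd {f : EuclideanSpace ℝ (Fin n) → ℝ} (hf : ContDiff ℝ 2 f)
    (x : EuclideanSpace ℝ (Fin n)) (i j : Fin n) :
    grd (fun y => grd f y j) x i = hessian f x i j := by
  have hd : DifferentiableAt ℝ (fderiv ℝ f) x :=
    (hf.fderiv_right (m := 1) (by norm_num)).differentiable (by norm_num) x
  have := hd.hasFDerivAt.clm_apply (hasFDerivAt_const (EuclideanSpace.single j (1 : ℝ)) x)
  simp only [grd, hessian, Matrix.of_apply]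
  rw [this.fderiv]
  simp

/-- The integrand obtained by testing `div tensorX = divX` against `ζ ∇f`. -/
def testIntegrand (a : ℝ) (l m : ℕ) (w ζ f : EuclideanSpace ℝ (Fin n) → ℝ)
    (x : EuclideanSpace ℝ (Fin n)) : ℝ :=
  (tensorX a l m (w x) (grd w x) (hessian w x)).mulVec (grd ζ x) ⬝ᵥ grd f x +
    ζ x * ((tensorX a l m (w x) (grd w x) (hessian w x) * hessian f x).trace +
      divX a l m (w x) (grd w x) (hessian w x) ⬝ᵥ grd f x)

/-- Integration by parts against the vector field `ζ ∇f`. -/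
lemma integral_testIntegrand (a : ℝ) (l m : ℕ) {w : EuclideanSpace ℝ (Fin n) → ℝ}
    (hw : ContDiff ℝ 2 w) (hpos : ∀ x, 0 < w x) (hw1 : HasCompactSupport fun x => w x - 1)
    {ζ f : EuclideanSpace ℝ (Fin n) → ℝ} (hζ : ContDiff ℝ 1 ζ) (hc : HasCompactSupport ζ)
    (hf : ContDiff ℝ 2 f) :
    Integrable (testIntegrand a l m w ζ f) ∧ ∫ x, testIntegrand a l m w ζ f x = 0 := by
  have hgf : ∀ j, ContDiff ℝ 1 fun x => grd f x j := contDiff_grd hf (by norm_num)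
  set η : Fin n → EuclideanSpace ℝ (Fin n) → ℝ := fun j x => ζ x * grd f x j with hη
  have hη1 : ∀ j, ContDiff ℝ 1 (η j) := fun j => hζ.mul (hgf j)
  have hηc : ∀ j, HasCompactSupport (η j) := fun j => hc.mul_right
  have hX := fun i j => continuous_tensorX_jetOf a l m hw hpos i j
  have hsum : testIntegrand a l m w ζ f = fun x => ∑ j,
      ((tensorX a l m (w x) (grd w x) (hessian w x)).mulVec (grd (η j) x) j +
        η j x * divX a l m (w x) (grd w x) (hessian w x) j) := by
    funext x
    have e1 : ∀ i j, grd (fun x => ζ x * grd f x j) x i =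
        ζ x * hessian f x i j + grd f x j * grd ζ x i := by
      intro i j
      rw [grd_mul (hζ.differentiable (by norm_num) x)
        ((hgf j).differentiable (by norm_num) x), grd_grd hf]
    simp only [testIntegrand, Matrix.mulVec, dotProduct, e1, Matrix.trace, Matrix.diag_apply,
      Matrix.mul_apply, mul_add, Finset.mul_sum, Finset.sum_mul, Finset.sum_add_distrib, hη]
    have r1 : ∀ j i, tensorX a l m (w x) (grd w x) (hessian w x) j i * grd ζ x i * grd f x j =
        tensorX a l m (w x) (grd w x) (hessian w x) j i * (grd f x j * grd ζ x i) := by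
      intros; ring
    have r2 : ∀ j i, ζ x * (tensorX a l m (w x) (grd w x) (hessian w x) j i * hessian f x i j) =
        tensorX a l m (w x) (grd w x) (hessian w x) j i * (ζ x * hessian f x i j) := by
      intros; ring
    have r3 : ∀ j, ζ x * (divX a l m (w x) (grd w x) (hessian w x) j * grd f x j) =
        ζ x * grd f x j * divX a l m (w x) (grd w x) (hessian w x) j := by
      intros; ring
    simp only [r1, r2, r3]
    ring
  have hint : ∀ j, Integrable fun x =>
      (tensorX a l m (w x) (grd w x) (hessian w x)).mulVec (grd (η j) x) j +
        η j x * divX a l m (w x) (grd w x) (hessian w x) j := by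
    intro j
    refine Integrable.add ?_ ?_
    · simp only [Matrix.mulVec, dotProduct]
      refine integrable_finsetSum _ fun i _ => ?_
      exact ((hX j i).mul (contDiff_grd (e := 0) (hη1 j) (by norm_num)
        i).continuous).integrable_of_hasCompactSupport
        (((hηc j).fderiv_apply ℝ (EuclideanSpace.single i 1)).mul_left)
    · exact ((hη1 j).continuous.mul (continuous_divX_jetOf a l m hw hpos
        j)).integrable_of_hasCompactSupport (hηc j).mul_right
  rw [hsum]
  refine ⟨integrable_finsetSum _ fun j _ => hint j, ?_⟩
  rw [integral_finsetSum _ fun j _ => hint j]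
  exact Finset.sum_eq_zero fun j _ => integral_tensorX a l m hw hpos hw1 (hη1 j) (hηc j) j

lemma tensorX_isHermitian (a : ℝ) (l m : ℕ) {z : ℝ} {p : Fin n → ℝ}
    {H : Matrix (Fin n) (Fin n) ℝ} (hH : H.IsHermitian) : (tensorX a l m z p H).IsHermitian := by
  have := newtonT_isHermitian (jetA_isHermitian (z := z) (p := p) hH) m
  rw [Matrix.IsHermitian, tensorX, Matrix.conjTranspose_smul, this.eq]
  simp

lemma mulVec_dotProduct_comm {M : Matrix (Fin n) (Fin n) ℝ} (hM : M.IsHermitian)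
    (p q : Fin n → ℝ) : M.mulVec p ⬝ᵥ q = M.mulVec q ⬝ᵥ p := by
  have h := hM.eq
  rw [Matrix.conjTranspose_eq_transpose_of_trivial] at h
  rw [dotProduct_comm, Matrix.dotProduct_mulVec, ← Matrix.mulVec_transpose, h]

/-- The right-hand side of the first variation formula: with `φ` the variation and `Γ' = G`, it
consists of a gradient term of the form `- G'(φ) a(∇φ, ∇φ)`, an error term carrying
`G(φ) φ - Γ(φ)`, and `Γ(φ)` times the adjoint operator applied to `1`. -/
def variationIntegrand (k : ℕ) (a : ℝ) (b : ℕ → ℝ) (G Γ : ℝ → ℝ)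
    (w φ : EuclideanSpace ℝ (Fin n) → ℝ) (x : EuclideanSpace ℝ (Fin n)) : ℝ :=
  -(deriv G (φ x) * ∑ l ∈ Finset.range k, b l *
      ((tensorX a l (k - 1 - l) (w x) (grd w x) (hessian w x)).mulVec (grd φ x) ⬝ᵥ grd φ x)) +
    (G (φ x) * φ x - Γ (φ x)) * zeroCoeff k a b (w x) (grd w x) (hessian w x) +
    Γ (φ x) * adjointOne k a b (w x) (grd w x) (hessian w x)

/-- First variation formula for `∫ G(φ) ψ(w + t φ)`. -/
lemma integral_variationIntegrand (k : ℕ) (a : ℝ) (b : ℕ → ℝ) {G Γ : ℝ → ℝ}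
    (hG : ContDiff ℝ 1 G) (hΓ : ∀ s, HasDerivAt Γ (G s) s) (hG0 : G 0 = 0) (hΓ0 : Γ 0 = 0)
    {w φ : EuclideanSpace ℝ (Fin n) → ℝ}
    (hw : ContDiff ℝ 2 w) (hpos : ∀ x, 0 < w x) (hw1 : HasCompactSupport fun x => w x - 1)
    (hφ : ContDiff ℝ 2 φ) (hφc : HasCompactSupport φ)
    (hint : Integrable fun x => G (φ x) * dpsiJ k a b (w x) (grd w x) (hessian w x)
      (φ x) (grd φ x) (hessian φ x)) :
    Integrable (variationIntegrand k a b G Γ w φ) ∧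
    ∫ x, G (φ x) * dpsiJ k a b (w x) (grd w x) (hessian w x) (φ x) (grd φ x) (hessian φ x) =
      ∫ x, variationIntegrand k a b G Γ w φ x := by
  have hφ1 : ContDiff ℝ 1 φ := hφ.of_le (by norm_num)
  have hΓ1 : ContDiff ℝ 1 Γ := by
    rw [contDiff_one_iff_deriv]
    refine ⟨fun s => (hΓ s).differentiableAt, ?_⟩
    rw [show deriv Γ = G from funext fun s => (hΓ s).deriv]
    exact hG.continuous
  have i1 := fun l => integral_testIntegrand a l (k - 1 - l) hw hpos hw1
    (ζ := fun x => G (φ x)) (f := φ) (hG.comp hφ1) (hφc.comp_left hG0) hφ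
  have i2 := fun l => integral_testIntegrand (a - 1) l (k - 1 - l) hw hpos hw1
    (ζ := fun x => Γ (φ x)) (f := w) (hΓ1.comp hφ1) (hφc.comp_left hΓ0) hw
  set S : EuclideanSpace ℝ (Fin n) → ℝ := fun x =>
    ∑ l ∈ Finset.range k, b l * testIntegrand a l (k - 1 - l) w (fun x => G (φ x)) φ x -
    ∑ j ∈ Finset.range k, fluxCoeff n a b j *
      testIntegrand (a - 1) j (k - 1 - j) w (fun x => Γ (φ x)) w x with hS
  have hS1 : Integrable fun x =>
      ∑ l ∈ Finset.range k, b l * testIntegrand a l (k - 1 - l) w (fun x => G (φ x)) φ x :=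
    integrable_finsetSum _ fun l _ => (i1 l).1.const_mul _
  have hS2 : Integrable fun x => ∑ j ∈ Finset.range k, fluxCoeff n a b j *
      testIntegrand (a - 1) j (k - 1 - j) w (fun x => Γ (φ x)) w x :=
    integrable_finsetSum _ fun l _ => (i2 l).1.const_mul _
  have hS0 : ∫ x, S x = 0 := by
    rw [hS, integral_sub hS1 hS2, integral_finsetSum _ fun l _ => (i1 l).1.const_mul _,
      integral_finsetSum _ fun l _ => (i2 l).1.const_mul _]
    simp only [integral_const_mul, (i1 _).2, (i2 _).2, mul_zero, Finset.sum_const_zero, sub_zero]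
  have key : variationIntegrand k a b G Γ w φ = fun x =>
      G (φ x) * dpsiJ k a b (w x) (grd w x) (hessian w x) (φ x) (grd φ x) (hessian φ x) - S x := by
    funext x
    have hd : DifferentiableAt ℝ φ x := hφ1.differentiable (by norm_num) x
    have g1 : grd (fun x => G (φ x)) x = deriv G (φ x) • grd φ x :=
      grd_comp (hG.differentiable (by norm_num) (φ x)).hasDerivAt hd
    have g2 : grd (fun x => Γ (φ x)) x = G (φ x) • grd φ x := grd_comp (hΓ (φ x)) hd
    have hY : ∀ j, (tensorX (a - 1) j (k - 1 - j) (w x) (grd w x) (hessian w x)).mulVec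
        (grd φ x) ⬝ᵥ grd w x = (tensorX (a - 1) j (k - 1 - j) (w x) (grd w x)
        (hessian w x)).mulVec (grd w x) ⬝ᵥ grd φ x := fun j =>
      mulVec_dotProduct_comm (tensorX_isHermitian _ _ _
        (hessian_isHermitian hw.contDiffAt)) _ _
    rw [linearization_eq a b (hpos x)]
    simp only [hS, variationIntegrand, adjointOne, testIntegrand, g1, g2, Matrix.mulVec_smul,
      smul_dotProduct, smul_eq_mul, hY, Fintype.card_fin]
    simp only [mul_add, mul_sub, Finset.mul_sum, Finset.sum_add_distrib]
    have c : ∀ (f : ℕ → ℝ) (c : ℝ), ∑ i ∈ Finset.range k, b i * (c * f i) =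
        ∑ i ∈ Finset.range k, c * (b i * f i) := fun f c =>
      Finset.sum_congr rfl fun _ _ => by ring
    have c' : ∀ (f : ℕ → ℝ) (c : ℝ), ∑ i ∈ Finset.range k, fluxCoeff n a b i * (c * f i) =
        ∑ i ∈ Finset.range k, c * (fluxCoeff n a b i * f i) := fun f c =>
      Finset.sum_congr rfl fun _ _ => by ring
    simp only [c, c']
    ring
  have hSi : Integrable S := hS1.sub hS2
  rw [key]
  refine ⟨hint.sub hSi, ?_⟩
  rw [integral_sub hint hSi, hS0, sub_zero]

end FirstVariation

/-! ### Cutoff functions and jets -/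

section Cutoff

variable {n : ℕ}

open scoped Manifold ContDiff in
/-- A `C²` cutoff function that equals `1` near a compact subset of an open set. -/
lemma exists_cutoff {K Ω : Set (EuclideanSpace ℝ (Fin n))} (hK : IsCompact K) (hΩ : IsOpen Ω)
    (hKΩ : K ⊆ Ω) : ∃ χ : EuclideanSpace ℝ (Fin n) → ℝ, ContDiff ℝ 2 χ ∧ HasCompactSupport χ ∧
      tsupport χ ⊆ Ω ∧ (∀ x ∈ K, ∀ᶠ y in 𝓝 x, χ y = 1) ∧ ∀ x, 0 ≤ χ x ∧ χ x ≤ 1 := by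
  obtain ⟨L, hL, hKL, hLΩ⟩ := exists_compact_between hK hΩ hKΩ
  obtain ⟨f, h1, h0, h⟩ := exists_contMDiffMap_one_nhds_of_subset_interior (n := 2)
    𝓘(ℝ, EuclideanSpace ℝ (Fin n)) hK.isClosed hKL
  have hts : tsupport (f : EuclideanSpace ℝ (Fin n) → ℝ) ⊆ L :=
    closure_minimal (fun x hx => by
      by_contra hxL
      exact hx (h0 x hxL)) hL.isClosed
  refine ⟨f, f.contMDiff.contDiff, hL.of_isClosed_subset (isClosed_tsupport _) hts,
    hts.trans hLΩ, fun x hx => ?_, h⟩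
  exact eventually_nhdsSet_iff_forall.1 h1 x hx

lemma contDiff_cutoff_mul {Ω : Set (EuclideanSpace ℝ (Fin n))} (hΩ : IsOpen Ω)
    {χ f : EuclideanSpace ℝ (Fin n) → ℝ} {d : WithTop ℕ∞} (hχ : ContDiff ℝ d χ)
    (hs : tsupport χ ⊆ Ω) (hf : ContDiffOn ℝ d f Ω) : ContDiff ℝ d fun x => χ x * f x := by
  rw [contDiff_iff_contDiffAt]
  intro x
  by_cases hx : x ∈ Ω
  · exact hχ.contDiffAt.mul (hf.contDiffAt (hΩ.mem_nhds hx))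
  · have : (fun x => χ x * f x) =ᶠ[𝓝 x] fun _ => 0 := by
      filter_upwards [notMem_tsupport_iff_eventuallyEq.1 fun h => hx (hs h)] with y hy
      simp [hy]
    exact contDiffAt_const.congr_of_eventuallyEq this

lemma grd_congr {f g : EuclideanSpace ℝ (Fin n) → ℝ} {x : EuclideanSpace ℝ (Fin n)}
    (h : f =ᶠ[𝓝 x] g) : grd f x = grd g x := by
  funext i; rw [grd, grd, h.fderiv_eq]

lemma hessian_congr {f g : EuclideanSpace ℝ (Fin n) → ℝ} {x : EuclideanSpace ℝ (Fin n)}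
    (h : f =ᶠ[𝓝 x] g) : hessian f x = hessian g x := by
  have : fderiv ℝ f =ᶠ[𝓝 x] fderiv ℝ g := h.eventuallyEq_nhds.mono fun y hy => hy.fderiv_eq
  ext i j; simp only [hessian, Matrix.of_apply, this.fderiv_eq]

lemma jetOf_congr {f g : EuclideanSpace ℝ (Fin n) → ℝ} {x : EuclideanSpace ℝ (Fin n)}
    (h : f =ᶠ[𝓝 x] g) : jetOf f x = jetOf g x := by
  rw [jetOf, jetOf, h.eq_of_nhds, grd_congr h, hessian_congr h]

lemma norm_gradient_sq (w : EuclideanSpace ℝ (Fin n) → ℝ) (x : EuclideanSpace ℝ (Fin n)) :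
    ‖gradient w x‖ ^ 2 = grd w x ⬝ᵥ grd w x := by
  have h : ∀ i, gradient w x i = grd w x i := by
    intro i
    have h1 : inner ℝ (gradient w x) (EuclideanSpace.single i (1 : ℝ)) = grd w x i := by
      rw [gradient, InnerProductSpace.toDual_symm_apply]; rfl
    rw [← h1, EuclideanSpace.inner_single_right]; simp
  rw [EuclideanSpace.norm_sq_eq, dotProduct]
  exact Finset.sum_congr rfl fun i _ => by rw [h, Real.norm_eq_abs, sq_abs, sq]

lemma schouten_eq_jetA (w : EuclideanSpace ℝ (Fin n) → ℝ) (x : EuclideanSpace ℝ (Fin n)) :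
    schouten w x = jetA (w x) (grd w x) (hessian w x) := by
  rw [schouten, jetA, norm_gradient_sq]

/-- `psi` depends on the 2-jet only, polynomially apart from the power of `w`. -/
lemma psi_eq_psiJ (k : ℕ) (a : ℝ) (b : ℕ → ℝ) {w : EuclideanSpace ℝ (Fin n) → ℝ}
    {x : EuclideanSpace ℝ (Fin n)} (hw : ContDiffAt ℝ 2 w x) :
    psi k a b w x = psiJ k a b (w x) (grd w x) (hessian w x) := by
  refine Finset.sum_congr rfl fun l _ => ?_
  rw [yamabeOp, schouten_eq_jetA, sig_eq_sigma_eigenvec (jetA_isHermitian (hessian_isHermitian hw)),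
    pow_mul, norm_gradient_sq]

end Cutoff

/-! ### Limits of admissible functions -/

section Closedness

variable {n : ℕ}

/-- The constant coefficient operator `∑ c_ij ∂_i ∂_j + ∑ d_i ∂_i + e`. -/
def constOp (c : Fin n → Fin n → ℝ) (d : Fin n → ℝ) (e : ℝ)
    (g : EuclideanSpace ℝ (Fin n) → ℝ) (x : EuclideanSpace ℝ (Fin n)) : ℝ :=
  ∑ i, ∑ j, c i j * hessian g x i j + ∑ i, d i * grd g x i + e * g x

lemma integral_linear_combination {X : Type*} [MeasurableSpace X] {μ : Measure X}
    (c : Fin n → Fin n → ℝ) (d : Fin n → ℝ) (e : ℝ)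
    {P : Fin n → Fin n → X → ℝ} {Q : Fin n → X → ℝ} {R : X → ℝ}
    (hP : ∀ i j, Integrable (P i j) μ) (hQ : ∀ i, Integrable (Q i) μ) (hR : Integrable R μ) :
    ∫ x, (∑ i, ∑ j, c i j * P i j x + ∑ i, d i * Q i x + e * R x) ∂μ =
      ∑ i, ∑ j, c i j * (∫ x, P i j x ∂μ) + ∑ i, d i * (∫ x, Q i x ∂μ) + e * (∫ x, R x ∂μ) := by
  have h1 : ∀ i, Integrable (fun x => ∑ j, c i j * P i j x) μ := fun i =>
    integrable_finsetSum _ fun j _ => (hP i j).const_mul _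
  have h2 : Integrable (fun x => ∑ i, ∑ j, c i j * P i j x) μ :=
    integrable_finsetSum _ fun i _ => h1 i
  have h3 : Integrable (fun x => ∑ i, d i * Q i x) μ :=
    integrable_finsetSum _ fun i _ => (hQ i).const_mul _
  have h4 : Integrable (fun x => ∑ i, ∑ j, c i j * P i j x + ∑ i, d i * Q i x) μ := h2.add h3
  rw [integral_add h4 (hR.const_mul e), integral_add h2 h3, integral_finsetSum _ fun i _ => h1 i,
    integral_finsetSum _ fun i _ => (hQ i).const_mul _]
  simp only [integral_const_mul]
  congr 2
  refine Finset.sum_congr rfl fun i _ => ?_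
  rw [integral_finsetSum _ fun j _ => (hP i j).const_mul _]
  simp only [integral_const_mul]

lemma integral_mul_grd {η g : EuclideanSpace ℝ (Fin n) → ℝ} (hη : ContDiff ℝ 1 η)
    (hc : HasCompactSupport η) (hg : ContDiff ℝ 1 g) (i : Fin n) :
    ∫ x, η x * grd g x i = -∫ x, grd η x i * g x := by
  have c1 : Continuous fun x => grd g x i := (contDiff_grd (e := 0) hg (by norm_num) i).continuous
  have c2 : Continuous fun x => grd η x i := (contDiff_grd (e := 0) hη (by norm_num) i).continuous
  have hc2 : HasCompactSupport fun x => grd η x i := hc.fderiv_apply ℝ _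
  exact integral_mul_fderiv_eq_neg_fderiv_mul_of_integrable (μ := volume) (𝕜 := ℝ)
    (v := EuclideanSpace.single i (1 : ℝ))
    ((c2.mul hg.continuous).integrable_of_hasCompactSupport hc2.mul_right)
    ((hη.continuous.mul c1).integrable_of_hasCompactSupport hc.mul_right)
    ((hη.continuous.mul hg.continuous).integrable_of_hasCompactSupport hc.mul_right)
    (fun x _ => hη.differentiable (by norm_num) x)
    (fun x _ => hg.differentiable (by norm_num) x)

/-- The formal adjoint of `constOp` has the sign of its first order part reversed. -/
lemma integral_mul_constOp (c : Fin n → Fin n → ℝ) (d : Fin n → ℝ) (e : ℝ)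
    {η g : EuclideanSpace ℝ (Fin n) → ℝ} (hη : ContDiff ℝ 2 η)
    (hc : HasCompactSupport η) (hg : ContDiff ℝ 2 g) :
    ∫ x, η x * constOp c d e g x = ∫ x, g x * constOp c (-d) e η x := by
  have hη1 : ContDiff ℝ 1 η := hη.of_le (by norm_num)
  have hg1 : ContDiff ℝ 1 g := hg.of_le (by norm_num)
  have hgrd : ∀ (f : EuclideanSpace ℝ (Fin n) → ℝ), ContDiff ℝ 2 f → ∀ i,
      ContDiff ℝ 1 fun x => grd f x i := fun f hf => contDiff_grd hf (by norm_num)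
  have hhes : ∀ (f : EuclideanSpace ℝ (Fin n) → ℝ), ContDiff ℝ 2 f → ∀ i j,
      Continuous fun x => hessian f x i j := fun f hf i j =>
    (contDiff_hessian (e := 0) hf (by norm_num) i j).continuous
  have hcg : ∀ i, HasCompactSupport fun x => grd η x i := fun i => hc.fderiv_apply ℝ _
  have hch : ∀ i j, HasCompactSupport fun x => hessian η x i j := by
    intro i j
    have : (fun x => hessian η x i j) = fun x => grd (fun y => grd η y j) x i := by
      funext x; rw [grd_grd hη]
    rw [this]
    exact (hcg j).fderiv_apply ℝ _
  have b1 : ∀ i, ∫ x, η x * grd g x i = ∫ x, -(g x * grd η x i) := by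
    intro i
    rw [integral_mul_grd hη1 hc hg1 i, ← integral_neg]
    exact integral_congr_ae (Eventually.of_forall fun x => by ring)
  have b2 : ∀ i j, ∫ x, η x * hessian g x i j = ∫ x, g x * hessian η x i j := by
    intro i j
    have s1 : ∀ x, hessian g x i j = grd (fun y => grd g y j) x i := fun x =>
      (grd_grd hg x i j).symm
    have s2 : ∀ x, hessian η x i j = grd (fun y => grd η y i) x j := fun x => by
      rw [grd_grd hη]
      have := (hessian_isHermitian (x := x) hη.contDiffAt).apply i j
      simpa using this.symm
    simp only [s1, s2]
    rw [integral_mul_grd hη1 hc (hgrd g hg j)]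
    have h := integral_mul_grd (hgrd η hη i) (hcg i) hg1 j
    rw [h, neg_neg]
    exact integral_congr_ae (Eventually.of_forall fun x => by ring)
  have L : ∫ x, η x * constOp c d e g x = ∑ i, ∑ j, c i j * (∫ x, η x * hessian g x i j) +
      ∑ i, d i * (∫ x, η x * grd g x i) + e * (∫ x, η x * g x) := by
    rw [← integral_linear_combination c d e (P := fun i j x => η x * hessian g x i j)
      (Q := fun i x => η x * grd g x i) (R := fun x => η x * g x)
      (fun i j => (hη.continuous.mul (hhes g hg i j)).integrable_of_hasCompactSupport hc.mul_right)
      (fun i => (hη.continuous.mul (hgrd g hg i).continuous).integrable_of_hasCompactSupport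
        hc.mul_right)
      ((hη.continuous.mul hg.continuous).integrable_of_hasCompactSupport hc.mul_right)]
    refine integral_congr_ae (Eventually.of_forall fun x => ?_)
    simp only [constOp, mul_add, Finset.mul_sum, mul_left_comm (η x)]
  have R : ∫ x, g x * constOp c (-d) e η x = ∑ i, ∑ j, c i j * (∫ x, g x * hessian η x i j) +
      ∑ i, d i * (∫ x, -(g x * grd η x i)) + e * (∫ x, η x * g x) := by
    rw [← integral_linear_combination c d e (P := fun i j x => g x * hessian η x i j)
      (Q := fun i x => -(g x * grd η x i)) (R := fun x => η x * g x)
      (fun i j => (hg.continuous.mul (hhes η hη i j)).integrable_of_hasCompactSupport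
        (hch i j).mul_left)
      (fun i => ((hg.continuous.mul (hgrd η hη i).continuous).integrable_of_hasCompactSupport
        (hcg i).mul_left).neg)
      ((hη.continuous.mul hg.continuous).integrable_of_hasCompactSupport hc.mul_right)]
    refine integral_congr_ae (Eventually.of_forall fun x => ?_)
    simp only [constOp, mul_add, Finset.mul_sum, mul_left_comm (g x), Pi.neg_apply, neg_mul,
      mul_neg, mul_comm (g x) (η x)]
  rw [L, R]
  simp only [b1, b2]

lemma isClosed_matCone (k : ℕ) :
    IsClosed {B : Fin n → Fin n → ℝ | Matrix.of B ∈ matCone (Fin n) k} := by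
  have h1 : {B : Fin n → Fin n → ℝ | Matrix.of B ∈ matCone (Fin n) k} =
      {B | ∀ i j, B j i = B i j} ∩ ⋂ j ∈ Set.Iic k, {B | 0 ≤ sig (Matrix.of B) j} := by
    ext B
    simp only [matCone, Set.mem_ofPred_eq, Set.mem_inter_iff, Set.mem_iInter, Set.mem_Iic]
    refine and_congr ⟨fun h i j => ?_, fun h => ?_⟩ Iff.rfl
    · simpa using h.apply i j
    · ext i j; simpa using h i j
  rw [h1]
  refine IsClosed.inter ?_ (isClosed_biInter fun j _ => ?_)
  · simp only [Set.ofPred_forall]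
    refine isClosed_iInter fun i => isClosed_iInter fun j => isClosed_eq ?_ ?_ <;> fun_prop
  · refine isClosed_le continuous_const ?_
    refine (newtonT_sig_entries_contDiff (d := 0) (fun i j => ?_) j).2.continuous
    simp only [Matrix.of_apply]; fun_prop

/-- A symmetric matrix outside the Gårding cone is separated from it by a linear functional. -/
lemma exists_separating {k : ℕ} (hk : k ≤ n) {A : Matrix (Fin n) (Fin n) ℝ}
    (hA : A ∉ matCone (Fin n) k) : ∃ c : Fin n → Fin n → ℝ,
      (∀ B ∈ matCone (Fin n) k, 0 ≤ ∑ i, ∑ j, c i j * B i j) ∧ ∑ i, ∑ j, c i j * A i j < 0 := by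
  have hcard : k ≤ Fintype.card (Fin n) := by simpa using hk
  set S := {B : Fin n → Fin n → ℝ | Matrix.of B ∈ matCone (Fin n) k} with hS
  have hconv : Convex ℝ S := by
    intro B hB B' hB' s t hs ht _
    have := add_mem_matCone hcard (smul_mem_matCone hs hB) (smul_mem_matCone ht hB')
    exact this
  obtain ⟨f, r, hfA, hfB⟩ := geometric_hahn_banach_point_closed hconv (isClosed_matCone k)
    (x := fun i j => A i j) hA
  have hf : ∀ B : Fin n → Fin n → ℝ,
      f B = ∑ i, ∑ j, f (Pi.single i (Pi.single j 1)) * B i j := by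
    intro B
    have hB : B = ∑ i, ∑ j, B i j • (Pi.single i (Pi.single j 1) : Fin n → Fin n → ℝ) := by
      ext a b
      simp only [Finset.sum_apply, Pi.smul_apply, smul_eq_mul]
      rw [Finset.sum_eq_single a]
      · rw [Finset.sum_eq_single b] <;> simp +contextual [eq_comm]
      · intro i _ hi; simp [Pi.single_eq_of_ne hi.symm]
      · simp
    conv_lhs => rw [hB]
    simp only [map_sum, map_smul, smul_eq_mul]
    exact Finset.sum_congr rfl fun i _ => Finset.sum_congr rfl fun j _ => mul_comm _ _
  have hr : r < 0 := by
    have h0 : (0 : Fin n → Fin n → ℝ) ∈ S := by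
      have := smul_one_mem_matCone (ι := Fin n) (le_refl (0 : ℝ)) k
      rw [zero_smul] at this
      exact this
    simpa using hfB 0 h0
  refine ⟨fun i j => f (Pi.single i (Pi.single j 1)), fun B hB => ?_, ?_⟩
  · rw [← hf fun i j => B i j]
    by_contra! hneg
    have hs : 0 ≤ r / f (fun i j => B i j) := (div_pos_of_neg_of_neg hr hneg).le
    have h1 : (r / f (fun i j => B i j)) • (fun i j => B i j) ∈ S := smul_mem_matCone hs hB
    have h2 := hfB _ h1
    rw [map_smul, smul_eq_mul, div_mul_cancel₀ _ hneg.ne] at h2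
    exact lt_irrefl _ h2
  · rw [← hf fun i j => A i j]
    exact hfA.trans hr

lemma constOp_congr (c : Fin n → Fin n → ℝ) (d : Fin n → ℝ) (e : ℝ)
    {f g : EuclideanSpace ℝ (Fin n) → ℝ} {x : EuclideanSpace ℝ (Fin n)}
    (h : f =ᶠ[𝓝 x] g) : constOp c d e f x = constOp c d e g x := by
  simp only [constOp, grd_congr h, hessian_congr h, h.eq_of_nhds]

lemma constOp_eq_zero (c : Fin n → Fin n → ℝ) (d : Fin n → ℝ) (e : ℝ)
    {f : EuclideanSpace ℝ (Fin n) → ℝ} {x : EuclideanSpace ℝ (Fin n)} (h : x ∉ tsupport f) :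
    constOp c d e f x = 0 := by
  rw [constOp_congr c d e (notMem_tsupport_iff_eventuallyEq.1 h)]
  have h1 : grd (0 : EuclideanSpace ℝ (Fin n) → ℝ) x = 0 := by
    funext i; simp [grd]
  have h2 : hessian (0 : EuclideanSpace ℝ (Fin n) → ℝ) x = 0 := by
    ext i j
    simp [hessian]
  simp [constOp, h1, h2]

lemma continuous_constOp (c : Fin n → Fin n → ℝ) (d : Fin n → ℝ) (e : ℝ)
    {g : EuclideanSpace ℝ (Fin n) → ℝ} (hg : ContDiff ℝ 2 g) : Continuous (constOp c d e g) := by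
  have h1 : ∀ i, Continuous fun x => grd g x i := fun i =>
    (contDiff_grd (e := 1) hg (by norm_num) i).continuous
  have h2 : ∀ i j, Continuous fun x => hessian g x i j := fun i j =>
    (contDiff_hessian (e := 0) hg (by norm_num) i j).continuous
  exact ((continuous_finsetSum _ fun i _ => continuous_finsetSum _ fun j _ =>
    continuous_const.mul (h2 i j)).add (continuous_finsetSum _ fun i _ =>
    continuous_const.mul (h1 i))).add (continuous_const.mul hg.continuous)

/-- Integration by parts against a test function supported in the domain of smoothness. -/
lemma integral_mul_constOp_of_tsupport_subset (c : Fin n → Fin n → ℝ) (d : Fin n → ℝ) (e : ℝ)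
    {Ω : Set (EuclideanSpace ℝ (Fin n))} (hΩ : IsOpen Ω)
    {η g : EuclideanSpace ℝ (Fin n) → ℝ} (hη : ContDiff ℝ 2 η)
    (hc : HasCompactSupport η) (hs : tsupport η ⊆ Ω) (hg : ContDiffOn ℝ 2 g Ω) :
    (Continuous fun x => η x * constOp c d e g x) ∧
      ∫ x, η x * constOp c d e g x = ∫ x, g x * constOp c (-d) e η x := by
  obtain ⟨χ, hχ, -, hχΩ, hχ1, -⟩ := exists_cutoff hc hΩ hs
  have hgχ := contDiff_cutoff_mul hΩ hχ hχΩ hg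
  have h1 : (fun x => η x * constOp c d e g x) =
      fun x => η x * constOp c d e (fun y => χ y * g y) x := by
    funext x
    by_cases hx : x ∈ tsupport η
    · rw [constOp_congr c d e (f := g) (g := fun y => χ y * g y)]
      filter_upwards [hχ1 x hx] with y hy
      rw [hy, one_mul]
    · rw [image_eq_zero_of_notMem_tsupport hx, zero_mul, zero_mul]
  refine ⟨?_, ?_⟩
  · rw [h1]; exact hη.continuous.mul (continuous_constOp c d e hgχ)
  · rw [h1, integral_mul_constOp c d e hη hc hgχ]
    refine integral_congr_ae (Eventually.of_forall fun x => ?_)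
    by_cases hx : x ∈ tsupport η
    · simp only [(hχ1 x hx).self_of_nhds, one_mul]
    · simp only [constOp_eq_zero c (-d) e hx, mul_zero]

lemma sum_mul_jetA (c : Fin n → Fin n → ℝ) (z : ℝ) (p : Fin n → ℝ)
    (H : Matrix (Fin n) (Fin n) ℝ) : ∑ i, ∑ j, c i j * jetA z p H i j =
      z * (∑ i, ∑ j, c i j * H i j) - 1 / 2 * (p ⬝ᵥ p) * ∑ i, c i i := by
  have h : ∀ i, c i i = ∑ j, c i j * (1 : Matrix (Fin n) (Fin n) ℝ) i j := by
    intro i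
    simp [Matrix.one_apply]
  simp only [h, Finset.mul_sum, ← Finset.sum_sub_distrib]
  refine Finset.sum_congr rfl fun i _ => Finset.sum_congr rfl fun j _ => ?_
  simp only [jetA, Matrix.sub_apply, Matrix.smul_apply, smul_eq_mul]
  ring

/-- For a functional `c` that is nonnegative on the Gårding cone and any vector `ξ`, membership of
`A(U)` in the cone gives a linear differential inequality for `U`; it follows from
`|∇U - U ξ|² ≥ 0`. -/
lemma constOp_nonneg {k : ℕ} {c : Fin n → Fin n → ℝ}
    (hc : ∀ B ∈ matCone (Fin n) k, 0 ≤ ∑ i, ∑ j, c i j * B i j) (ξ : Fin n → ℝ)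
    {U : EuclideanSpace ℝ (Fin n) → ℝ} {x : EuclideanSpace ℝ (Fin n)} (hpos : 0 < U x)
    (hU : jetA (U x) (grd U x) (hessian U x) ∈ matCone (Fin n) k) :
    0 ≤ constOp c (fun i => -((∑ i, c i i) * ξ i)) (1 / 2 * (∑ i, c i i) * (ξ ⬝ᵥ ξ)) U x := by
  set t := ∑ i, c i i with ht
  set p := grd U x with hp
  have ht0 : 0 ≤ t := by
    have := hc _ (smul_one_mem_matCone (ι := Fin n) zero_le_one k)
    rw [one_smul] at this
    simpa [Matrix.one_apply] using this
  have h1 := hc _ hU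
  rw [sum_mul_jetA] at h1
  have h3 : 0 ≤ (p - U x • ξ) ⬝ᵥ (p - U x • ξ) :=
    Finset.sum_nonneg fun i _ => mul_self_nonneg _
  have h4 : (p - U x • ξ) ⬝ᵥ (p - U x • ξ) =
      p ⬝ᵥ p - 2 * U x * (ξ ⬝ᵥ p) + U x ^ 2 * (ξ ⬝ᵥ ξ) := by
    simp only [sub_dotProduct, dotProduct_sub, smul_dotProduct, dotProduct_smul, smul_eq_mul,
      dotProduct_comm p ξ]
    ring
  have h5 : ∑ i, -(t * ξ i) * p i = -(t * (ξ ⬝ᵥ p)) := by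
    simp only [dotProduct, Finset.mul_sum, ← Finset.sum_neg_distrib]
    exact Finset.sum_congr rfl fun i _ => by ring
  have h6 : U x * constOp c (fun i => -(t * ξ i)) (1 / 2 * t * (ξ ⬝ᵥ ξ)) U x =
      (U x * (∑ i, ∑ j, c i j * hessian U x i j) - 1 / 2 * (p ⬝ᵥ p) * t) +
        1 / 2 * t * ((p - U x • ξ) ⬝ᵥ (p - U x • ξ)) := by
    rw [constOp, ← hp, h5, h4]; ring
  refine nonneg_of_mul_nonneg_right ?_ hpos
  rw [h6]
  exact add_nonneg h1 (mul_nonneg (by positivity) h3)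

/-- A function that is `C²` and an `L¹_loc` limit of admissible functions is admissible. By duality,
admissibility amounts to the linear differential inequalities of `constOp_nonneg`, which pass to
`L¹_loc` limits in the sense of distributions. -/
theorem jetA_mem_matCone_of_mem_Phi {k : ℕ} (hk : k ≤ n) {Ω : Set (EuclideanSpace ℝ (Fin n))}
    (hΩ : IsOpen Ω) {u : EuclideanSpace ℝ (Fin n) → ℝ} (hu : ContDiffOn ℝ 2 u Ω)
    (huΦ : u ∈ Phi k Ω) {x : EuclideanSpace ℝ (Fin n)} (hx : x ∈ Ω) :
    jetA (u x) (grd u x) (hessian u x) ∈ matCone (Fin n) k := by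
  by_contra hmem
  obtain ⟨c, hc, hneg⟩ := exists_separating hk hmem
  obtain ⟨-, hupos, U, hU, hlim⟩ := huΦ
  set t := ∑ i, c i i with ht
  -- this choice of `ξ` makes the differential inequality sharp at `x`
  set ξ : Fin n → ℝ := (u x)⁻¹ • grd u x with hξ
  set d : Fin n → ℝ := fun i => -(t * ξ i) with hd
  set e : ℝ := 1 / 2 * t * (ξ ⬝ᵥ ξ) with he
  have hxneg : constOp c d e u x < 0 := by
    have hux := hupos x hx
    have h0 : ∑ i, ∑ j, c i j * jetA (u x) (grd u x) (hessian u x) i j =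
        u x * constOp c d e u x := by
      have h5 : ∑ i, d i * grd u x i = -(t * (ξ ⬝ᵥ grd u x)) := by
        simp only [hd, dotProduct, Finset.mul_sum, ← Finset.sum_neg_distrib]
        exact Finset.sum_congr rfl fun i _ => by ring
      rw [sum_mul_jetA, constOp, h5, he, hξ]
      simp only [smul_dotProduct, dotProduct_smul, smul_eq_mul]
      field_simp
      ring
    rw [h0] at hneg
    exact neg_of_mul_neg_right hneg hux.le
  -- the operator applied to `u` is negative near `x`
  obtain ⟨χ, hχ, -, hχΩ, hχ1, -⟩ := exists_cutoff (isCompact_singleton (x := x)) hΩ (by simpa)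
  have hnear : ∀ᶠ y in 𝓝 x, y ∈ Ω ∧ constOp c d e u y < 0 := by
    have hcont := continuous_constOp c d e (contDiff_cutoff_mul hΩ hχ hχΩ hu)
    have heq : ∀ᶠ y in 𝓝 x, constOp c d e u y = constOp c d e (fun y => χ y * u y) y := by
      filter_upwards [(hχ1 x rfl).eventually_nhds] with y hy
      refine constOp_congr c d e ?_
      filter_upwards [hy] with z hz
      rw [hz, one_mul]
    have h0 : constOp c d e (fun y => χ y * u y) x < 0 := heq.self_of_nhds ▸ hxneg
    filter_upwards [heq, hΩ.mem_nhds hx, hcont.continuousAt.eventually (gt_mem_nhds h0)]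
      with y h1 h2 h3
    exact ⟨h2, h1 ▸ h3⟩
  obtain ⟨η, hηs, hηc, hη, hηr, hηx⟩ := exists_contDiff_tsupport_subset (n := 2) hnear
  have hη0 : ∀ y, 0 ≤ η y := fun y => (hηr ⟨y, rfl⟩).1
  have hηΩ : tsupport η ⊆ Ω := fun y hy => (hηs hy).1
  have hparts := fun g hg => integral_mul_constOp_of_tsupport_subset c d e hΩ hη hηc hηΩ (g := g) hg
  have hstrict : ∫ y, η y * constOp c d e u y < 0 := by
    have h1 : 0 < ∫ y, -(η y * constOp c d e u y) := by
      refine ((hparts u hu).1.neg).integral_pos_of_hasCompactSupport_nonneg_nonzero (x := x)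
        (hηc.mul_right (f' := constOp c d e u)).neg (fun y => ?_) ?_
      · by_cases hy : y ∈ tsupport η
        · exact neg_nonneg.2 (mul_nonpos_of_nonneg_of_nonpos (hη0 y) (hηs hy).2.le)
        · simp [image_eq_zero_of_notMem_tsupport hy]
      · rw [hηx, one_mul]; exact neg_ne_zero.2 hxneg.ne
    rw [integral_neg] at h1
    linarith
  set F := constOp c (-d) e η with hF
  have hFc : Continuous F := continuous_constOp c (-d) e hη
  have hF0 : ∀ y ∉ tsupport η, F y = 0 := fun y hy => constOp_eq_zero c (-d) e hy
  have hset : ∀ g : EuclideanSpace ℝ (Fin n) → ℝ,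
      ∫ y in tsupport η, g y * F y = ∫ y, g y * F y := fun g =>
    setIntegral_eq_integral_of_forall_compl_eq_zero fun y hy => by rw [hF0 y hy, mul_zero]
  have hint : ∀ g : EuclideanSpace ℝ (Fin n) → ℝ, ContDiffOn ℝ 2 g Ω →
      IntegrableOn (fun y => g y * F y) (tsupport η) := fun g hg =>
    ((hg.continuousOn.mono hηΩ).mul hFc.continuousOn).integrableOn_compact hηc
  obtain ⟨C, hC⟩ := (hηc.image hFc.norm).bddAbove
  have hconv : Tendsto (fun m => ∫ y in tsupport η, U m y * F y) atTop
      (𝓝 (∫ y in tsupport η, u y * F y)) := by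
    refine tendsto_integral_of_L1' _ (hint u hu).aestronglyMeasurable
      (Eventually.of_forall fun m => hint _ (hU m).1) ?_
    have hbound : ∀ m, eLpNorm ((fun y => U m y * F y) - fun y => u y * F y) 1
        (volume.restrict (tsupport η)) ≤
        ENNReal.ofReal C * eLpNorm (U m - u) 1 (volume.restrict (tsupport η)) := by
      intro m
      refine eLpNorm_le_mul_eLpNorm_of_ae_le_mul ?_ 1
      refine (ae_restrict_iff' (isClosed_tsupport η).measurableSet).2
        (Eventually.of_forall fun y hy => ?_)
      rw [Pi.sub_apply, Pi.sub_apply, ← sub_mul, norm_mul, mul_comm]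
      exact mul_le_mul_of_nonneg_right (hC ⟨y, hy, rfl⟩) (norm_nonneg _)
    have h0 := ENNReal.Tendsto.const_mul (hlim _ hηΩ hηc)
      (Or.inr (ENNReal.ofReal_ne_top (r := C)))
    rw [mul_zero] at h0
    exact tendsto_of_tendsto_of_tendsto_of_le_of_le tendsto_const_nhds h0 (fun _ => zero_le)
      hbound
  have hlimnonneg : 0 ≤ ∫ y in tsupport η, u y * F y := by
    refine ge_of_tendsto' hconv fun m => ?_
    rw [hset, ← (hparts _ (hU m).1).2]
    refine integral_nonneg fun y => ?_
    by_cases hy : y ∈ tsupport η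
    · have hUy := (hU m).2 y (hηΩ hy)
      refine mul_nonneg (hη0 y) (constOp_nonneg hc ξ hUy.1 ?_)
      have hherm := jetA_isHermitian (z := U m y) (p := grd (U m) y) (hessian_isHermitian
        ((hU m).1.contDiffAt (hΩ.mem_nhds (hηΩ hy))))
      rw [mem_matCone_iff hherm, ← schouten_eq_jetA]
      exact hUy.2
    · simp [image_eq_zero_of_notMem_tsupport hy]
  rw [hset, ← (hparts u hu).2] at hlimnonneg
  exact absurd hstrict hlimnonneg.not_gt

end Closedness

/-! ### Convexity of the admissible class -/

section Combination

variable {ι : Type*} [Fintype ι] [DecidableEq ι]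

/-- `A(w) / w` is superadditive in `w`: the defect is a nonnegative multiple of the identity. -/
lemma jetA_combination {z₀ z₁ s t : ℝ} (h₀ : 0 < z₀) (h₁ : 0 < z₁) (p₀ p₁ : ι → ℝ)
    (H₀ H₁ : Matrix ι ι ℝ) :
    jetA (s * z₀ + t * z₁) (s • p₀ + t • p₁) (s • H₀ + t • H₁) =
      ((s * z₀ + t * z₁) * s / z₀) • jetA z₀ p₀ H₀ +
      ((s * z₀ + t * z₁) * t / z₁) • jetA z₁ p₁ H₁ +
      (1 / 2 * (s * t / (z₀ * z₁)) * ((z₁ • p₀ - z₀ • p₁) ⬝ᵥ (z₁ • p₀ - z₀ • p₁))) • 1 := by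
  ext i j
  simp only [jetA, Matrix.sub_apply, Matrix.add_apply, Matrix.smul_apply, smul_eq_mul,
    add_dotProduct, dotProduct_add, sub_dotProduct, dotProduct_sub, smul_dotProduct,
    dotProduct_smul, dotProduct_comm p₁ p₀]
  field_simp
  ring

/-- The set of jets with `z > 0` and `A` in the Gårding cone is convex. -/
lemma jetA_combination_mem_matCone {k : ℕ} (hk : k ≤ Fintype.card ι) {z₀ z₁ s t : ℝ}
    (h₀ : 0 < z₀) (h₁ : 0 < z₁) (hs : 0 ≤ s) (ht : 0 ≤ t) {p₀ p₁ : ι → ℝ} {H₀ H₁ : Matrix ι ι ℝ}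
    (hA₀ : jetA z₀ p₀ H₀ ∈ matCone ι k) (hA₁ : jetA z₁ p₁ H₁ ∈ matCone ι k) :
    jetA (s * z₀ + t * z₁) (s • p₀ + t • p₁) (s • H₀ + t • H₁) ∈ matCone ι k := by
  rw [jetA_combination h₀ h₁]
  refine add_mem_matCone hk (add_mem_matCone hk (smul_mem_matCone (by positivity) hA₀)
    (smul_mem_matCone (by positivity) hA₁)) (smul_one_mem_matCone ?_ k)
  exact mul_nonneg (by positivity) (Finset.sum_nonneg fun i _ => mul_self_nonneg _)

end Combination

/-! ### A maximum principle -/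

section MaximumPrinciple

variable {n : ℕ}

lemma jetOf_linear {f g : EuclideanSpace ℝ (Fin n) → ℝ} {x : EuclideanSpace ℝ (Fin n)}
    (hf : ContDiffAt ℝ 2 f x) (hg : ContDiffAt ℝ 2 g x) (s t : ℝ) :
    jetOf (fun y => s * f y + t * g y) x = s • jetOf f x + t • jetOf g x := by
  have key : ∀ y, ContDiffAt ℝ 2 f y → ContDiffAt ℝ 2 g y →
      fderiv ℝ (fun y => s * f y + t * g y) y = s • fderiv ℝ f y + t • fderiv ℝ g y := by
    intro y hf hg
    have h1 := (hf.differentiableAt (by norm_num)).hasFDerivAt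
    have h2 := (hg.differentiableAt (by norm_num)).hasFDerivAt
    exact ((h1.const_mul s).add (h2.const_mul t)).fderiv
  have hev : fderiv ℝ (fun y => s * f y + t * g y) =ᶠ[𝓝 x]
      fun y => s • fderiv ℝ f y + t • fderiv ℝ g y := by
    filter_upwards [hf.eventually (by simp), hg.eventually (by simp)] with y h1 h2
    exact key y h1 h2
  have h1 := ((hf.fderiv_right (m := 1) (by norm_num)).differentiableAt (by norm_num)).hasFDerivAt
  have h2 := ((hg.fderiv_right (m := 1) (by norm_num)).differentiableAt (by norm_num)).hasFDerivAt
  have hsnd := hev.fderiv_eq.trans ((h1.const_smul s).add (h2.const_smul t)).fderiv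
  refine Prod.ext rfl (Prod.ext ?_ ?_)
  · funext i
    simp [jetOf, grd, key x hf hg]
  · funext i j
    simp [jetOf, hessian, hsnd]

/-- First and second derivative tests at a local maximum. -/
lemma grd_hessian_of_isLocalMax {h : EuclideanSpace ℝ (Fin n) → ℝ} {x : EuclideanSpace ℝ (Fin n)}
    (hh : ContDiffAt ℝ 2 h x) (hmax : IsLocalMax h x) :
    grd h x = 0 ∧ (-hessian h x).PosSemidef := by
  have h0 := hmax.fderiv_eq_zero
  refine ⟨by funext i; simp [grd, h0], ?_⟩
  refine Matrix.PosSemidef.of_dotProduct_mulVec_nonneg (hessian_isHermitian hh).neg fun ξ => ?_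
  set e : EuclideanSpace ℝ (Fin n) := WithLp.toLp 2 ξ with he
  have hsum : e = ∑ i, ξ i • EuclideanSpace.single i (1 : ℝ) := by
    ext j
    simp [he, Finset.sum_apply, Pi.single_apply]
  have hquad : fderiv ℝ (fderiv ℝ h) x e e = ξ ⬝ᵥ (hessian h x).mulVec ξ := by
    rw [hsum]
    simp only [map_sum, map_smul, sum_apply, smul_apply, smul_eq_mul,
      dotProduct, Matrix.mulVec, hessian, Matrix.of_apply, Finset.mul_sum]
    rw [Finset.sum_comm]
    exact Finset.sum_congr rfl fun i _ => Finset.sum_congr rfl fun j _ => by ring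
  simp only [star_trivial, Matrix.neg_mulVec, dotProduct_neg, ← hquad, Left.nonneg_neg_iff]
  by_contra! hpos
  set φ : ℝ → ℝ := fun t => h (x + t • e) with hφ
  have hline : ContinuousAt (fun t : ℝ => x + t • e) 0 := by fun_prop
  have hline0 : x + (0 : ℝ) • e = x := by simp
  have hderiv : deriv φ =ᶠ[𝓝 0] fun t => fderiv ℝ h (x + t • e) e := by
    have hev : ∀ᶠ y in 𝓝 (x + (0 : ℝ) • e), ContDiffAt ℝ 2 h y := by
      rw [hline0]; exact hh.eventually (by simp)
    filter_upwards [hline.eventually hev] with t ht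
    have h1 : HasDerivAt (fun t : ℝ => x + t • e) e t := by
      simpa using ((hasDerivAt_id t).smul_const e).const_add x
    exact ((ht.differentiableAt (by norm_num)).hasFDerivAt.comp_hasDerivAt t h1).deriv
  have hderiv2 : deriv (deriv φ) 0 = fderiv ℝ (fderiv ℝ h) x e e := by
    rw [hderiv.deriv_eq]
    have h1 := hasDerivAt_line
      ((hh.fderiv_right (m := 1) (by norm_num)).differentiableAt (by norm_num)) e
    have h2 := h1.clm_apply (hasDerivAt_const (0 : ℝ) e)
    rw [h2.deriv]; simp
  have hφ0 : deriv φ 0 = 0 := by simp [hderiv.self_of_nhds, h0]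
  have hcont : ContinuousAt φ 0 := by
    refine ContinuousAt.comp (f := fun t : ℝ => x + t • e) ?_ hline
    simpa using hh.continuousAt
  have hmin := isLocalMin_of_deriv_deriv_pos (by rw [hderiv2]; exact hpos) hφ0 hcont
  have hmaxφ : IsLocalMax φ 0 := by
    have : ∀ᶠ y in 𝓝 (x + (0 : ℝ) • e), h y ≤ h x := by rw [hline0]; exact hmax
    filter_upwards [hline.eventually this] with t ht
    simpa [hφ] using ht
  have hconst : φ =ᶠ[𝓝 0] fun _ => φ 0 := by
    filter_upwards [hmin, hmaxφ] with t h1 h2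
    exact le_antisymm h2 h1
  have : deriv (deriv φ) 0 = 0 := by
    have h1 : deriv φ =ᶠ[𝓝 0] fun _ => 0 := by
      filter_upwards [hconst.eventually_nhds] with t ht
      rw [Filter.EventuallyEq.deriv_eq ht, deriv_const]
    rw [h1.deriv_eq, deriv_const]
  rw [hderiv2] at this
  exact hpos.ne' this

lemma norm_sq_eq_dotProduct (x : EuclideanSpace ℝ (Fin n)) : ‖x‖ ^ 2 = x ⬝ᵥ x := by
  rw [EuclideanSpace.norm_sq_eq, dotProduct]
  exact Finset.sum_congr rfl fun i _ => by rw [Real.norm_eq_abs, sq_abs, sq]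

lemma jetOf_one_add_norm_sq (x : EuclideanSpace ℝ (Fin n)) :
    jetOf (fun y => 1 + ‖y‖ ^ 2) x =
      (1 + x ⬝ᵥ x, fun i => 2 * x i, fun i j => 2 * (1 : Matrix (Fin n) (Fin n) ℝ) i j) := by
  have h1 : fderiv ℝ (fun y : EuclideanSpace ℝ (Fin n) => 1 + ‖y‖ ^ 2) =
      (2 : ℝ) • ⇑(innerSL ℝ (E := EuclideanSpace ℝ (Fin n))) := by
    funext y
    have h := (fderiv_const_add (𝕜 := ℝ) (f := fun y : EuclideanSpace ℝ (Fin n) => ‖y‖ ^ 2)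
      (x := y) 1).trans (fderiv_norm_sq_apply y)
    rw [h]
    ext z
    simp
  refine Prod.ext ?_ (Prod.ext ?_ ?_)
  · rw [jetOf, norm_sq_eq_dotProduct]
  · funext i
    simp [jetOf, grd, EuclideanSpace.inner_single_right]
  · funext i j
    simp only [jetOf, hessian, Matrix.of_apply, h1]
    have : fderiv ℝ ((2 : ℝ) • ⇑(innerSL ℝ (E := EuclideanSpace ℝ (Fin n)))) x =
        (2 : ℝ) • innerSL ℝ :=
      ((2 : ℝ) • innerSL ℝ (E := EuclideanSpace ℝ (Fin n)) :
        EuclideanSpace ℝ (Fin n) →L[ℝ] EuclideanSpace ℝ (Fin n) →L[ℝ] ℝ).fderiv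
    rw [this]
    have h2 : ∀ y z, (innerSL ℝ : EuclideanSpace ℝ (Fin n) →L[ℝ] EuclideanSpace ℝ (Fin n) →L[ℝ] ℝ)
        y z = inner ℝ y z := fun _ _ => rfl
    simp [h2, Matrix.one_apply, EuclideanSpace.inner_single_right, eq_comm]

/-- If `v < u` somewhere, then `v < u` at some point where `σ_k(A(v))` is positive. Such a point is
a maximum point of `(u + ε (1 + |x|²)) / v` for small `ε > 0`: there the gradients are proportional
and the Hessians are ordered, while `A(1 + |x|²) = 2 I` makes `A(u + ε (1 + |x|²))` lie in the
interior of the Gårding cone. -/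
lemma exists_sig_pos {k : ℕ} (hk : k ≤ n) {Ω : Set (EuclideanSpace ℝ (Fin n))} (hΩ : IsOpen Ω)
    (hΩb : Bornology.IsBounded Ω) {u v : EuclideanSpace ℝ (Fin n) → ℝ}
    (hu : ContDiffOn ℝ 2 u Ω) (huc : ContinuousOn u (closure Ω)) (hupos : ∀ x ∈ Ω, 0 < u x)
    (hv : ContDiffOn ℝ 2 v Ω) (hvc : ContinuousOn v (closure Ω))
    (hvpos : ∀ x ∈ closure Ω, 0 < v x)
    (huA : ∀ x ∈ Ω, jetA (u x) (grd u x) (hessian u x) ∈ matCone (Fin n) k)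
    (hbdry : ∀ x ∈ frontier Ω, u x ≤ v x) {x₁ : EuclideanSpace ℝ (Fin n)} (hx₁ : x₁ ∈ Ω)
    (hlt : v x₁ < u x₁) :
    ∃ x ∈ Ω, v x < u x ∧ 0 < sig (jetA (v x) (grd v x) (hessian v x)) k := by
  have hcard : k ≤ Fintype.card (Fin n) := by simpa using hk
  have hcomp : IsCompact (closure Ω) := hΩb.isCompact_closure
  set q : EuclideanSpace ℝ (Fin n) → ℝ := fun y => 1 + ‖y‖ ^ 2 with hq
  have hqpos : ∀ y, 0 < q y := fun y => by positivity
  have hqs : ContDiff ℝ 2 q := contDiff_const.add (contDiff_norm_sq ℝ)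
  obtain ⟨C, hC⟩ := (hcomp.image_of_continuousOn (f := fun y => q y / v y)
    (hqs.continuous.continuousOn.div hvc fun y hy => (hvpos y hy).ne')).bddAbove
  have hC' : ∀ y ∈ closure Ω, q y / v y ≤ C := fun y hy => hC ⟨y, hy, rfl⟩
  have hx₁c := subset_closure hx₁
  have hCpos : 0 < C := (div_pos (hqpos x₁) (hvpos x₁ hx₁c)).trans_le (hC' x₁ hx₁c)
  have hδ : 0 < u x₁ / v x₁ - 1 := by
    rw [sub_pos, one_lt_div (hvpos x₁ hx₁c)]; exact hlt
  set ε : ℝ := (u x₁ / v x₁ - 1) / (2 * C) with hε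
  have hεpos : 0 < ε := by positivity
  have hεC : ε * C < u x₁ / v x₁ - 1 := by
    have : ε * C = (u x₁ / v x₁ - 1) / 2 := by rw [hε]; field_simp
    linarith
  obtain ⟨x, hxc, hmax⟩ := hcomp.exists_isMaxOn ⟨x₁, hx₁c⟩ (f := fun y => (u y + ε * q y) / v y)
    ((huc.add (continuousOn_const.mul hqs.continuous.continuousOn)).div hvc
      fun y hy => (hvpos y hy).ne')
  set c : ℝ := (u x + ε * q x) / v x with hc
  have hvx := hvpos x hxc
  have hc1 : u x₁ / v x₁ ≤ c := by
    refine le_trans ?_ (hmax hx₁c)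
    exact div_le_div_of_nonneg_right (by nlinarith [hqpos x₁]) (hvpos x₁ hx₁c).le
  have hcx : c = u x / v x + ε * (q x / v x) := by rw [hc]; ring
  have hux : v x < u x := by
    rw [← one_lt_div hvx]
    nlinarith [hC' x hxc]
  have hx : x ∈ Ω := by
    by_contra hxΩ
    have : x ∈ frontier Ω := by rw [hΩ.frontier_eq]; exact ⟨hxc, hxΩ⟩
    exact absurd hux (hbdry x this).not_gt
  refine ⟨x, hx, hux, ?_⟩
  have hcpos : 0 < c := by linarith
  have hu2 := hu.contDiffAt (hΩ.mem_nhds hx)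
  have hv2 := hv.contDiffAt (hΩ.mem_nhds hx)
  have hq2 : ContDiffAt ℝ 2 q x := hqs.contDiffAt
  have huq : ContDiffAt ℝ 2 (fun y => 1 * u y + ε * q y) x :=
    (contDiffAt_const.mul hu2).add (contDiffAt_const.mul hq2)
  have hcv : c * v x = u x + ε * q x := by rw [hc]; field_simp
  have hlm : IsLocalMax (fun y => 1 * (1 * u y + ε * q y) + -c * v y) x := by
    filter_upwards [hΩ.mem_nhds hx] with y hy
    have h1 : (u y + ε * q y) / v y ≤ c := hmax (subset_closure hy)
    rw [div_le_iff₀ (hvpos y (subset_closure hy))] at h1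
    linarith
  obtain ⟨hg, hH⟩ := grd_hessian_of_isLocalMax
    ((contDiffAt_const.mul huq).add (contDiffAt_const.mul hv2)) hlm
  have hj := jetOf_linear huq hv2 1 (-c)
  have hjq : jetOf q x = _ := jetOf_one_add_norm_sq x
  rw [jetOf_linear hu2 hq2 1 ε, hjq] at hj
  set P := -hessian (fun y => 1 * (1 * u y + ε * q y) + -c * v y) x with hP
  have e1 : (1 : ℝ) • grd u x + ε • (fun i => 2 * x i) = c • grd v x := by
    funext i
    have := congrFun (congrArg (fun J : Jet n => J.2.1) hj) i
    simp only [jetOf, hg, Prod.snd_add, Prod.smul_snd, Prod.fst_add, Prod.smul_fst, one_smul,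
      Pi.add_apply, Pi.smul_apply, smul_eq_mul, Pi.zero_apply] at this ⊢
    linarith
  have e2 : (1 : ℝ) • hessian u x + ε • ((2 : ℝ) • (1 : Matrix (Fin n) (Fin n) ℝ)) =
      c • hessian v x - P := by
    ext i j
    have := congrFun (congrFun (congrArg (fun J : Jet n => J.2.2) hj) i) j
    simp only [jetOf, Prod.snd_add, Prod.smul_snd, one_smul,
      Pi.add_apply, Pi.smul_apply, smul_eq_mul] at this
    simp only [hP, Matrix.add_apply, Matrix.sub_apply, Matrix.smul_apply, smul_eq_mul,
      Matrix.neg_apply, one_smul]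
    linarith
  have hq1 : (1 : ℝ) + x ⬝ᵥ x = q x := by rw [← norm_sq_eq_dotProduct]
  have e0 : 1 * u x + ε * (1 + x ⬝ᵥ x) = c * v x := by rw [hcv, hq1, one_mul]
  have hqx : 0 < 1 + x ⬝ᵥ x := hq1 ▸ hqpos x
  have hA := jetA_combination (s := 1) (t := ε) (hupos x hx) hqx (grd u x) (fun i => 2 * x i)
    (hessian u x) ((2 : ℝ) • 1)
  have hAq : jetA (1 + x ⬝ᵥ x) (fun i => 2 * x i) ((2 : ℝ) • (1 : Matrix (Fin n) (Fin n) ℝ)) =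
      (2 : ℝ) • 1 := by
    have : (fun i => 2 * x i) ⬝ᵥ (fun i => 2 * x i) = 4 * (x ⬝ᵥ x) := by
      simp only [dotProduct, Finset.mul_sum]
      exact Finset.sum_congr rfl fun i _ => by ring
    rw [jetA, this, smul_smul, ← sub_smul]
    congr 1; ring
  have hAv : jetA (c * v x) (c • grd v x) (c • hessian v x - P) =
      c ^ 2 • jetA (v x) (grd v x) (hessian v x) - (c * v x) • P := by
    ext i j
    simp only [jetA, Matrix.sub_apply, Matrix.smul_apply, smul_eq_mul, smul_dotProduct,
      dotProduct_smul]
    ring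
  rw [e0, e1, e2, hAq, hAv, sub_eq_iff_eq_add] at hA
  have hcvpos : 0 < c * v x := mul_pos hcpos hvx
  set M := (c * v x * 1 / u x) • jetA (u x) (grd u x) (hessian u x) +
    (1 / 2 * (1 * ε / (u x * (1 + x ⬝ᵥ x))) *
      (((1 + x ⬝ᵥ x) • grd u x - u x • fun i => 2 * x i) ⬝ᵥ
        ((1 + x ⬝ᵥ x) • grd u x - u x • fun i => 2 * x i))) • (1 : Matrix (Fin n) (Fin n) ℝ) +
    (c * v x) • P with hM
  have hux0 := hupos x hx
  have hMmem : M ∈ matCone (Fin n) k := by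
    refine add_mem_matCone hcard (add_mem_matCone hcard
      (smul_mem_matCone (by positivity) (huA x hx)) (smul_one_mem_matCone ?_ k))
      (smul_mem_matCone hcvpos.le (posSemidef_mem_matCone hH k))
    exact mul_nonneg (by positivity) (Finset.sum_nonneg fun i _ => mul_self_nonneg _)
  have hsum : c ^ 2 • jetA (v x) (grd v x) (hessian v x) =
      M + (c * v x * ε / (1 + x ⬝ᵥ x) * 2) • (1 : Matrix (Fin n) (Fin n) ℝ) := by
    rw [hA, hM, mul_smul (c * v x * ε / (1 + x ⬝ᵥ x))]
    abel
  have hpos := sig_add_smul_one_pos hcard hMmem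
    (ε := c * v x * ε / (1 + x ⬝ᵥ x) * 2) (by positivity)
  rw [← hsum, (sig_newtonT_smul _ _ _).2] at hpos
  exact pos_of_mul_pos_right hpos (by positivity)

end MaximumPrinciple

/-! ### Differentiation along a segment -/

section Segment

variable {n : ℕ}

/-- The function `psiJ` on the jet space. -/
def psiJet (k : ℕ) (a : ℝ) (b : ℕ → ℝ) (J : Jet n) : ℝ :=
  psiJ k a b J.1 J.2.1 (Matrix.of J.2.2)

lemma isOpen_jet_pos : IsOpen {J : Jet n | 0 < J.1} := isOpen_lt continuous_const continuous_fst

lemma contDiffOn_psiJet (k : ℕ) (a : ℝ) (b : ℕ → ℝ) :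
    ContDiffOn ℝ 1 (psiJet (n := n) k a b) {J | 0 < J.1} := by
  unfold psiJet psiJ
  refine ContDiffOn.sum fun l _ => ?_
  have h1 : ContDiffOn ℝ 1 (fun J : Jet n => J.1 ^ a) {J | 0 < J.1} :=
    contDiffOn_fst.rpow_const_of_ne fun J hJ => ne_of_gt hJ
  have h2 : ContDiff ℝ 1 fun J : Jet n => J.2.1 ⬝ᵥ J.2.1 := by
    simp only [dotProduct]; fun_prop
  exact ((contDiffOn_const.mul h1).mul (h2.pow l).contDiffOn).mul
    (jet_entries_contDiff (k - l)).2.contDiffOn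

lemma fderiv_psiJet (k : ℕ) (a : ℝ) (b : ℕ → ℝ) {J : Jet n} (hJ : 0 < J.1) (J' : Jet n) :
    fderiv ℝ (psiJet k a b) J J' =
      dpsiJ k a b J.1 J.2.1 (Matrix.of J.2.2) J'.1 J'.2.1 (Matrix.of J'.2.2) := by
  have h1 : HasDerivAt (fun t : ℝ => psiJet k a b (J + t • J'))
      (fderiv ℝ (psiJet k a b) J J') 0 :=
    (((contDiffOn_psiJet k a b).contDiffAt (isOpen_jet_pos.mem_nhds hJ)).differentiableAt
      (by norm_num)).hasFDerivAt.hasLineDerivAt J'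
  have h2 : ∀ c d : ℝ, HasDerivAt (fun t : ℝ => c + t * d) d 0 := fun c d => by
    simpa using ((hasDerivAt_id (0 : ℝ)).mul_const d).const_add c
  have h3 := hasDerivAt_psiJ k a b (z := fun t : ℝ => J.1 + t * J'.1)
    (p := fun t i => J.2.1 i + t * J'.2.1 i)
    (H := fun t => Matrix.of fun i j => J.2.2 i j + t * J'.2.2 i j) (t := 0)
    (by simpa using hJ) (h2 _ _) (fun i => h2 _ _)
    (H' := Matrix.of J'.2.2) (fun i j => h2 _ _)
  have h4 := h1.unique h3
  simpa using h4

/-- Differentiation under the integral sign for `∫ g Ψ(f + t f')`, with `f`, `f'` maps to the jet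
space and `g` of compact support. -/
lemma hasDerivAt_integral_comp_jet {Ψ : Jet n → ℝ} (hΨ : ContDiffOn ℝ 1 Ψ {J | 0 < J.1})
    {g : EuclideanSpace ℝ (Fin n) → ℝ} (hg : Continuous g) (hgc : HasCompactSupport g)
    {f f' : EuclideanSpace ℝ (Fin n) → Jet n} (hf : Continuous f) (hf' : Continuous f')
    (hpos : ∀ t ∈ Set.Icc (0 : ℝ) 1, ∀ x, 0 < (f x + t • f' x).1) :
    (∀ t ∈ Set.Icc (0 : ℝ) 1, Integrable fun x => g x * Ψ (f x + t • f' x)) ∧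
    ContinuousOn (fun t : ℝ => ∫ x, g x * Ψ (f x + t • f' x)) (Set.Icc 0 1) ∧
    ∀ t ∈ Set.Ioo (0 : ℝ) 1, Integrable (fun x => g x * fderiv ℝ Ψ (f x + t • f' x) (f' x)) ∧
      HasDerivAt (fun t : ℝ => ∫ x, g x * Ψ (f x + t • f' x))
        (∫ x, g x * fderiv ℝ Ψ (f x + t • f' x) (f' x)) t := by
  set I := Set.Icc (0 : ℝ) 1 with hI
  have hline : Continuous fun q : ℝ × EuclideanSpace ℝ (Fin n) => f q.2 + q.1 • f' q.2 := by
    fun_prop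
  have hmaps : Set.MapsTo (fun q : ℝ × EuclideanSpace ℝ (Fin n) => f q.2 + q.1 • f' q.2)
      (I ×ˢ Set.univ) {J : Jet n | 0 < J.1} := fun q hq => hpos q.1 hq.1 q.2
  have c1 : ContinuousOn (fun q : ℝ × EuclideanSpace ℝ (Fin n) =>
      g q.2 * Ψ (f q.2 + q.1 • f' q.2)) (I ×ˢ Set.univ) :=
    (hg.comp continuous_snd).continuousOn.mul
      (hΨ.continuousOn.comp hline.continuousOn hmaps)
  have c2 : ContinuousOn (fun q : ℝ × EuclideanSpace ℝ (Fin n) =>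
      g q.2 * fderiv ℝ Ψ (f q.2 + q.1 • f' q.2) (f' q.2)) (I ×ˢ Set.univ) :=
    (hg.comp continuous_snd).continuousOn.mul
      (((hΨ.continuousOn_fderiv_of_isOpen isOpen_jet_pos le_rfl).comp hline.continuousOn
        hmaps).clm_apply (hf'.comp continuous_snd).continuousOn)
  have bound : ∀ F : ℝ × EuclideanSpace ℝ (Fin n) → ℝ,
      ContinuousOn (fun q => g q.2 * F q) (I ×ˢ Set.univ) →
      ∃ B : EuclideanSpace ℝ (Fin n) → ℝ, Integrable B ∧
        ∀ t ∈ I, ∀ x, ‖g x * F (t, x)‖ ≤ B x := by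
    intro F hF
    obtain ⟨C, hC⟩ := ((isCompact_Icc.prod hgc).image_of_continuousOn
      (hF.mono (Set.prod_mono_right (Set.subset_univ _))).norm).bddAbove
    refine ⟨(tsupport g).indicator fun _ => C, ?_, fun t ht x => ?_⟩
    · exact (integrable_indicator_iff (isClosed_tsupport g).measurableSet).2
        (integrableOn_const hgc.measure_lt_top.ne)
    · by_cases hx : x ∈ tsupport g
      · rw [Set.indicator_of_mem hx]
        exact hC ⟨(t, x), ⟨ht, hx⟩, rfl⟩
      · rw [Set.indicator_of_notMem hx, image_eq_zero_of_notMem_tsupport hx, zero_mul, norm_zero]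
  obtain ⟨B1, hB1, hB1'⟩ := bound _ c1
  obtain ⟨B2, hB2, hB2'⟩ := bound _ c2
  have m1 : ∀ t ∈ I, Continuous fun x => g x * Ψ (f x + t • f' x) := fun t ht =>
    c1.comp_continuous (f := fun x => (t, x)) (by fun_prop) fun x => ⟨ht, trivial⟩
  have m2 : ∀ t ∈ I, Continuous fun x => g x * fderiv ℝ Ψ (f x + t • f' x) (f' x) := fun t ht =>
    c2.comp_continuous (f := fun x => (t, x)) (by fun_prop) fun x => ⟨ht, trivial⟩
  have int1 : ∀ t ∈ I, Integrable fun x => g x * Ψ (f x + t • f' x) := fun t ht =>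
    hB1.mono' (m1 t ht).aestronglyMeasurable (Eventually.of_forall (hB1' t ht))
  refine ⟨int1, ?_, fun t ht => ?_⟩
  · refine continuousOn_of_dominated (fun t ht => (m1 t ht).aestronglyMeasurable)
      (fun t ht => Eventually.of_forall (hB1' t ht)) hB1 (Eventually.of_forall fun x => ?_)
    exact c1.comp (f := fun t => (t, x)) (by fun_prop) fun t ht => ⟨ht, trivial⟩
  · have hnhds : Set.Ioo (0 : ℝ) 1 ∈ 𝓝 t := isOpen_Ioo.mem_nhds ht
    have htI := Set.Ioo_subset_Icc_self ht
    refine hasDerivAt_integral_of_dominated_loc_of_deriv_le (bound := B2)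
      (F := fun t x => g x * Ψ (f x + t • f' x))
      (F' := fun t x => g x * fderiv ℝ Ψ (f x + t • f' x) (f' x)) hnhds ?_ (int1 t htI)
      (m2 t htI).aestronglyMeasurable
      (Eventually.of_forall fun x s hs => hB2' s (Set.Ioo_subset_Icc_self hs) x) hB2
      (Eventually.of_forall fun x s hs => ?_)
    · filter_upwards [hnhds] with s hs
      exact (m1 s (Set.Ioo_subset_Icc_self hs)).aestronglyMeasurable
    · have h1 : HasDerivAt (fun s : ℝ => f x + s • f' x) (f' x) s := by
        simpa using ((hasDerivAt_id s).smul_const (f' x)).const_add (f x)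
      have h2 := ((hΨ.contDiffAt (isOpen_jet_pos.mem_nhds
        (hpos s (Set.Ioo_subset_Icc_self hs) x))).differentiableAt (by norm_num)).hasFDerivAt
      exact (h2.comp_hasDerivAt s h1).const_mul (g x)

/-- The derivative of `t ↦ ∫ G(φ) ψ(w + t φ)` in divergence form. -/
lemma hasDerivAt_integral_psiJet (k : ℕ) (a : ℝ) (b : ℕ → ℝ) {G Γ : ℝ → ℝ}
    (hG : ContDiff ℝ 1 G) (hΓ : ∀ s, HasDerivAt Γ (G s) s) (hG0 : G 0 = 0) (hΓ0 : Γ 0 = 0)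
    {w φ : EuclideanSpace ℝ (Fin n) → ℝ} (hw : ContDiff ℝ 2 w)
    (hw1 : HasCompactSupport fun x => w x - 1) (hφ : ContDiff ℝ 2 φ) (hφc : HasCompactSupport φ)
    (hpos : ∀ t ∈ Set.Icc (0 : ℝ) 1, ∀ x, 0 < w x + t * φ x) :
    (∀ t ∈ Set.Icc (0 : ℝ) 1,
      Integrable fun x => G (φ x) * psiJet k a b (jetOf w x + t • jetOf φ x)) ∧
    ContinuousOn (fun t : ℝ => ∫ x, G (φ x) * psiJet k a b (jetOf w x + t • jetOf φ x))
      (Set.Icc 0 1) ∧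
    ∀ t ∈ Set.Ioo (0 : ℝ) 1, Integrable (variationIntegrand k a b G Γ (fun x => w x + t * φ x) φ) ∧
      HasDerivAt (fun t : ℝ => ∫ x, G (φ x) * psiJet k a b (jetOf w x + t • jetOf φ x))
        (∫ x, variationIntegrand k a b G Γ (fun x => w x + t * φ x) φ x) t := by
  have hGc : HasCompactSupport fun x => G (φ x) := hφc.comp_left hG0
  obtain ⟨h1, h2, h3⟩ := hasDerivAt_integral_comp_jet (contDiffOn_psiJet k a b)
    (hG.continuous.comp hφ.continuous) hGc (continuous_jetOf hw) (continuous_jetOf hφ) hpos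
  refine ⟨h1, h2, fun t ht => ?_⟩
  obtain ⟨hint, hder⟩ := h3 t ht
  have htI := Set.Ioo_subset_Icc_self ht
  have hwt : ContDiff ℝ 2 fun x => w x + t * φ x := hw.add (contDiff_const.mul hφ)
  have hjet : ∀ x, jetOf (fun x => w x + t * φ x) x = jetOf w x + t • jetOf φ x := fun x => by
    have := jetOf_linear (x := x) hw.contDiffAt hφ.contDiffAt 1 t
    simpa only [one_mul, one_smul] using this
  have heq : (fun x => G (φ x) * fderiv ℝ (psiJet k a b) (jetOf w x + t • jetOf φ x) (jetOf φ x)) =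
      fun x => G (φ x) * dpsiJ k a b (w x + t * φ x) (grd (fun x => w x + t * φ x) x)
        (hessian (fun x => w x + t * φ x) x) (φ x) (grd φ x) (hessian φ x) := by
    funext x
    rw [fderiv_psiJet k a b (hpos t htI x), ← hjet]
    rfl
  have hsupp : HasCompactSupport fun x => w x + t * φ x - 1 := by
    have h : (fun x => w x + t * φ x - 1) = (fun x => w x - 1) + (fun _ => t) * φ := by
      funext x
      simp only [Pi.add_apply, Pi.mul_apply]
      ring
    rw [h]
    exact hw1.add hφc.mul_left
  obtain ⟨v1, v2⟩ := integral_variationIntegrand k a b hG hΓ hG0 hΓ0 hwt (hpos t htI) hsupp hφ hφc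
    (by rw [← heq]; exact hint)
  refine ⟨v1, ?_⟩
  rw [← v2, ← heq]
  exact hder

end Segment

/-! ### Truncation -/

section Truncation

/-- A smooth nondecreasing function `G` that vanishes for `s ≤ δ` and equals `1` for `s ≥ 2δ`, and
its primitive `Γ`, which differs from `max s 0` and from `G(s) s` by at most `2δ`. -/
lemma exists_truncation {δ : ℝ} (hδ : 0 < δ) : ∃ G Γ : ℝ → ℝ, ContDiff ℝ 1 G ∧
    (∀ s, HasDerivAt Γ (G s) s) ∧ (∀ s, 0 ≤ G s) ∧ (∀ s, 0 ≤ deriv G s) ∧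
    (∀ s ≤ δ, G s = 0 ∧ deriv G s = 0 ∧ Γ s = 0) ∧
    ∀ s, 0 ≤ s → 0 ≤ Γ s ∧ s - 2 * δ ≤ Γ s ∧ |G s * s - Γ s| ≤ 2 * δ := by
  set G : ℝ → ℝ := fun s => Real.smoothTransition (s / δ - 1) with hG
  have hGs : ContDiff ℝ 1 G :=
    Real.smoothTransition.contDiff.comp ((contDiff_id.div_const δ).sub contDiff_const)
  have hG0 : ∀ s, 0 ≤ G s := fun s => Real.smoothTransition.nonneg _
  have hG1 : ∀ s, G s ≤ 1 := fun s => Real.smoothTransition.le_one _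
  have hGz : ∀ s ≤ δ, G s = 0 := fun s hs => by
    refine Real.smoothTransition.zero_of_nonpos ?_
    rw [sub_nonpos, div_le_one hδ]; exact hs
  have hGo : ∀ s, 2 * δ ≤ s → G s = 1 := fun s hs => by
    refine Real.smoothTransition.one_of_one_le ?_
    rw [le_sub_iff_add_le, le_div_iff₀ hδ]; linarith
  have hmono : Monotone G := fun s t hst =>
    Real.smoothTransition.monotone (by gcongr)
  have hint : ∀ s t, IntervalIntegrable G volume s t := fun s t =>
    hGs.continuous.intervalIntegrable s t
  set Γ : ℝ → ℝ := fun s => ∫ r in (0 : ℝ)..s, G r with hΓ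
  have hΓ0 : ∀ s, 0 ≤ s → 0 ≤ Γ s := fun s hs =>
    intervalIntegral.integral_nonneg hs fun r _ => hG0 r
  have hΓs : ∀ s, 0 ≤ s → Γ s ≤ s := fun s hs => by
    have := intervalIntegral.integral_mono_on hs (hint 0 s) intervalIntegrable_const
      (g := fun _ => (1 : ℝ)) fun r _ => hG1 r
    simpa using this
  have hΓl : ∀ s, 0 ≤ s → s - 2 * δ ≤ Γ s := fun s hs => by
    rcases le_total s (2 * δ) with h | h
    · linarith [hΓ0 s hs]
    · have h1 : Γ s = Γ (2 * δ) + ∫ r in (2 * δ)..s, G r :=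
        (intervalIntegral.integral_add_adjacent_intervals (hint _ _) (hint _ _)).symm
      have h2 : ∫ r in (2 * δ)..s, G r = s - 2 * δ := by
        rw [intervalIntegral.integral_congr (g := fun _ => (1 : ℝ))]
        · simp
        · intro r hr
          rw [Set.uIcc_of_le h] at hr
          exact hGo r hr.1
      linarith [hΓ0 (2 * δ) (by linarith)]
  refine ⟨G, Γ, hGs, fun s => ?_, hG0, fun s => hmono.deriv_nonneg, fun s hs => ⟨hGz s hs, ?_, ?_⟩,
    fun s hs => ⟨hΓ0 s hs, hΓl s hs, ?_⟩⟩
  · exact intervalIntegral.integral_hasDerivAt_right (hint _ _)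
      (hGs.continuous.stronglyMeasurableAtFilter _ _) hGs.continuous.continuousAt
  · have : IsLocalMin G s := Eventually.of_forall fun r => by rw [hGz s hs]; exact hG0 r
    exact this.deriv_eq_zero
  · rw [hΓ]
    refine (intervalIntegral.integral_congr (g := fun _ => (0 : ℝ)) fun r hr => ?_).trans (by simp)
    refine hGz r (hr.2.trans (max_le hδ.le hs))
  · have e1 := hΓ0 s hs
    have e2 := hΓl s hs
    have e3 := hΓs s hs
    rcases le_total s (2 * δ) with h | h
    · have h1 : 0 ≤ G s * s := mul_nonneg (hG0 s) hs
      have h2 : G s * s ≤ s := mul_le_of_le_one_left hs (hG1 s)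
      rw [abs_le]; constructor <;> linarith
    · rw [hGo s h, abs_le]; constructor <;> linarith

end Truncation

/-! ### Global extension and bounds for the first variation -/

section Bounds

variable {n : ℕ}

/-- Replacing `v` and `u - v` by globally defined functions that agree with them near `K`. -/
lemma exists_global_extension {K Ω : Set (EuclideanSpace ℝ (Fin n))} (hK : IsCompact K)
    (hΩ : IsOpen Ω) (hKΩ : K ⊆ Ω) {u v : EuclideanSpace ℝ (Fin n) → ℝ}
    (hu : ContDiffOn ℝ 2 u Ω) (hv : ContDiffOn ℝ 2 v Ω) (hupos : ∀ x ∈ Ω, 0 < u x)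
    (hvpos : ∀ x ∈ Ω, 0 < v x) : ∃ w φ : EuclideanSpace ℝ (Fin n) → ℝ,
      ContDiff ℝ 2 w ∧ (HasCompactSupport fun x => w x - 1) ∧ ContDiff ℝ 2 φ ∧
      HasCompactSupport φ ∧ (∀ t ∈ Set.Icc (0 : ℝ) 1, ∀ x, 0 < w x + t * φ x) ∧
      (∀ x ∈ K, w =ᶠ[𝓝 x] v) ∧ (∀ x ∈ K, φ =ᶠ[𝓝 x] fun y => u y - v y) ∧
      ∀ x, 0 < φ x → x ∈ Ω ∧ φ x ≤ u x - v x := by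
  obtain ⟨χ, hχ, hχc, hχΩ, hχ1, hχr⟩ := exists_cutoff hK hΩ hKΩ
  refine ⟨fun x => 1 + χ x * (v x - 1), fun x => χ x * (u x - v x),
    contDiff_const.add (contDiff_cutoff_mul hΩ hχ hχΩ (hv.sub contDiffOn_const)), ?_,
    contDiff_cutoff_mul hΩ hχ hχΩ (hu.sub hv), hχc.mul_right, fun t ht x => ?_,
    fun x hx => ?_, fun x hx => ?_, fun x hx => ?_⟩
  · simp only [add_sub_cancel_left]
    exact hχc.mul_right
  · beta_reduce
    by_cases hx : x ∈ tsupport χ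
    · have h1 := hupos x (hχΩ hx)
      have h2 := hvpos x (hχΩ hx)
      have h3 : 0 < (1 - t) * v x + t * u x := by
        rcases ht.1.eq_or_lt with h | h
        · rw [← h]; simpa using h2
        · have := mul_nonneg (sub_nonneg.2 ht.2) h2.le
          have := mul_pos h h1
          linarith
      have h4 : 1 + χ x * (v x - 1) + t * (χ x * (u x - v x)) =
          (1 - χ x) + χ x * ((1 - t) * v x + t * u x) := by ring
      rw [h4]
      rcases (hχr x).1.eq_or_lt with h | h
      · rw [← h]; simp
      · have := mul_pos h h3
        linarith [(hχr x).2]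
    · rw [image_eq_zero_of_notMem_tsupport hx]; simp
  · filter_upwards [hχ1 x hx] with y hy
    rw [hy]; ring
  · filter_upwards [hχ1 x hx] with y hy
    rw [hy, one_mul]
  · beta_reduce at hx ⊢
    have hpos : 0 < χ x := (hχr x).1.lt_of_ne fun h => by rw [← h, zero_mul] at hx; exact hx.false
    refine ⟨hχΩ (subset_tsupport _ hpos.ne'), ?_⟩
    have h1 : 0 < u x - v x := pos_of_mul_pos_right hx hpos.le
    exact mul_le_of_le_one_left h1.le (hχr x).2

/-- The jet of a function in `C²(closure Ω)` extends continuously to the closure. -/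
lemma IsC2OnClosure.exists_jet {Ω : Set (EuclideanSpace ℝ (Fin n))}
    {u : EuclideanSpace ℝ (Fin n) → ℝ} (hu : IsC2OnClosure Ω u) :
    ∃ Ju : EuclideanSpace ℝ (Fin n) → Jet n, ContinuousOn Ju (closure Ω) ∧
      (∀ x ∈ Ω, Ju x = jetOf u x) ∧ ∀ x, (Ju x).1 = u x := by
  obtain ⟨-, hc, ⟨D, hD, hDu⟩, ⟨H, hH, hHu⟩⟩ := hu
  refine ⟨fun x => (u x, fun i => D x (EuclideanSpace.single i 1),
    fun i j => H x (EuclideanSpace.single i 1) (EuclideanSpace.single j 1)), ?_, fun x hx => ?_,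
    fun x => rfl⟩
  · refine hc.prodMk (ContinuousOn.prodMk ?_ ?_)
    · exact continuousOn_pi.2 fun i => hD.clm_apply continuousOn_const
    · exact continuousOn_pi.2 fun i => continuousOn_pi.2 fun j =>
        (hH.clm_apply continuousOn_const).clm_apply continuousOn_const
  · simp only [hDu hx, hHu hx]; rfl

lemma continuousOn_zeroCoeff (k : ℕ) (a : ℝ) (b : ℕ → ℝ) :
    ContinuousOn (fun J : Jet n => zeroCoeff k a b J.1 J.2.1 (Matrix.of J.2.2)) {J | 0 < J.1} := by
  have hr := continuous_jet_dotProduct_self (n := n)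
  refine (continuousOn_jet_rpow _).mul (Continuous.continuousOn ?_)
  exact (continuous_finsetSum _ fun l _ => continuous_const.mul
    ((hr.pow _).mul (continuous_jet_sig _))).add (continuous_finsetSum _ fun l _ =>
    continuous_const.mul ((hr.pow _).mul (continuous_jet_sig _)))

/-- The integrand of the first variation is bounded above: the gradient term has a sign, the second
term is small, and the last one is controlled by the inequalities for the coefficients. -/
lemma variationIntegrand_le {k : ℕ} (hk : 1 ≤ k) (hkn : k ≤ n) (a : ℝ) (b : ℕ → ℝ)
    (hb : ∀ l ≤ k, 0 ≤ b l)
    (h2 : b k * (a + k * n + 2 * k * (a + n + k + 1)) - 1 / 2 * (a + n + k - 1) * n * b (k - 1)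
        - 4 * k * (a + n + k) * b k + b (k - 1) * (a + n + k) * (a + n + k - 1) ≤ 0)
    (h3 : ∀ l : ℕ, 1 ≤ l → l + 1 ≤ k →
      b l * (a + k - l + l * (n + l - k) + (a + n + l + 1) * (k + l))
        - 2 * (l + 1) * (k + l) * b (l + 1)
        - 1 / 2 * (a + n + l - 1) * (n + l - k) * b (l - 1) ≤ 0)
    (h4 : ∀ l : ℕ, l + 2 ≤ k →
      b l * (a + n + l + 1) * (a + n + l) - 4 * (l + 1) * (a + n + l + 1) * b (l + 1)
        + 4 * (l + 2) * (l + 1) * b (l + 2) ≤ 0)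
    {G Γ : ℝ → ℝ} {w φ : EuclideanSpace ℝ (Fin n) → ℝ} {x : EuclideanSpace ℝ (Fin n)}
    (hw : 0 < w x) (hA : jetA (w x) (grd w x) (hessian w x) ∈ matCone (Fin n) k) {δ C : ℝ}
    (hG' : 0 ≤ deriv G (φ x)) (hΓ : 0 ≤ Γ (φ x)) (hGΓ : |G (φ x) * φ x - Γ (φ x)| ≤ 2 * δ)
    (hC : |zeroCoeff k a b (w x) (grd w x) (hessian w x)| ≤ C) :
    variationIntegrand k a b G Γ w φ x ≤ 2 * δ * C + Γ (φ x) *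
      ((b 0 * (a + k + (a + n + 1) * k) - 2 * k * b 1) *
        ((w x) ^ (a - 1) * sig (jetA (w x) (grd w x) (hessian w x)) k)) := by
  have hcard : k ≤ Fintype.card (Fin n) := by simpa using hkn
  have e1 : 0 ≤ ∑ l ∈ Finset.range k, b l *
      ((tensorX a l (k - 1 - l) (w x) (grd w x) (hessian w x)).mulVec (grd φ x) ⬝ᵥ grd φ x) := by
    refine Finset.sum_nonneg fun l hl => ?_
    rw [Finset.mem_range] at hl
    have hr : 0 ≤ grd w x ⬝ᵥ grd w x := Finset.sum_nonneg fun i _ => mul_self_nonneg _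
    exact mul_nonneg (hb l hl.le) (dotProduct_mulVec_nonneg
      ((newtonT_posSemidef hcard (by omega) hA).smul (by positivity)) _)
  have e2 : (G (φ x) * φ x - Γ (φ x)) * zeroCoeff k a b (w x) (grd w x) (hessian w x) ≤
      2 * δ * C := by
    refine (le_abs_self _).trans ?_
    rw [abs_mul]
    exact mul_le_mul hGΓ hC (abs_nonneg _) ((abs_nonneg _).trans hGΓ)
  have e3 := adjointOne_le hk hcard a b (by simpa using h2) (by simpa using h3) (by simpa using h4)
    hw (grd w x) (hessian w x) hA
  rw [Fintype.card_fin] at e3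
  have e4 := mul_le_mul_of_nonneg_left e3 hΓ
  have e5 := mul_nonneg hG' e1
  rw [variationIntegrand]
  linarith

end Bounds

end

end SigmaYamabe

/-! ### The comparison principle -/

theorem theorem3p3 (n k : ℕ) (hk : 1 ≤ k) (hkn : k ≤ n) (α : ℝ)
    (b : ℕ → ℝ) (hb0 : b 0 = k) (hb : ∀ l : ℕ, 1 ≤ l → l ≤ k → 0 ≤ b l)
    (h1 : b 0 * (α + k + (α + n + 1) * k) - 2 * k * b 1 < 0)
    (h2 : b k * (α + k * n + 2 * k * (α + n + k + 1))
        - 1 / 2 * (α + n + k - 1) * n * b (k - 1)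
        - 4 * k * (α + n + k) * b k
        + b (k - 1) * (α + n + k) * (α + n + k - 1) ≤ 0)
    (h3 : ∀ l : ℕ, 1 ≤ l → l + 1 ≤ k →
      b l * (α + k - l + l * (n + l - k) + (α + n + l + 1) * (k + l))
        - 2 * (l + 1) * (k + l) * b (l + 1)
        - 1 / 2 * (α + n + l - 1) * (n + l - k) * b (l - 1) ≤ 0)
    (h4 : ∀ l : ℕ, l + 2 ≤ k →
      b l * (α + n + l + 1) * (α + n + l)
        - 4 * (l + 1) * (α + n + l + 1) * b (l + 1)
        + 4 * (l + 2) * (l + 1) * b (l + 2) ≤ 0)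
    (Ω : Set (EuclideanSpace ℝ (Fin n))) (hΩ : IsOpen Ω) (hΩb : Bornology.IsBounded Ω)
    (u v : EuclideanSpace ℝ (Fin n) → ℝ)
    (hu : SigmaYamabe.IsC2OnClosure Ω u) (huΦ : u ∈ SigmaYamabe.Phi k Ω)
    (hv : SigmaYamabe.IsC2OnClosure Ω v) (hvΦ : v ∈ SigmaYamabe.Phi k Ω)
    (hvpos : ∀ x ∈ frontier Ω, 0 < v x)
    (hψ : ∀ x ∈ Ω, SigmaYamabe.psi k α b v x ≤ SigmaYamabe.psi k α b u x)
    (hbdry : ∀ x ∈ frontier Ω, u x ≤ v x) :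
    ∀ x ∈ Ω, u x ≤ v x := by
  open SigmaYamabe in
  by_contra! hcon
  obtain ⟨x₁, hx₁, hlt₁⟩ := hcon
  have hcard : k ≤ Fintype.card (Fin n) := by simpa using hkn
  have hupos := huΦ.2.1
  have hvpos' : ∀ x ∈ closure Ω, 0 < v x := fun x hx => by
    by_cases hxΩ : x ∈ Ω
    · exact hvΦ.2.1 x hxΩ
    · exact hvpos x (by rw [hΩ.frontier_eq]; exact ⟨hx, hxΩ⟩)
  have huA := fun x hx => jetA_mem_matCone_of_mem_Phi hkn hΩ hu.1 huΦ (x := x) hx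
  have hvA := fun x hx => jetA_mem_matCone_of_mem_Phi hkn hΩ hv.1 hvΦ (x := x) hx
  obtain ⟨x₀, hx₀, hlt, hσ⟩ := exists_sig_pos hkn hΩ hΩb hu.1 hu.2.1 hupos hv.1 hv.2.1 hvpos' huA
    hbdry hx₁ hlt₁
  have hbn : ∀ l ≤ k, 0 ≤ b l := fun l hl => by
    rcases Nat.eq_zero_or_pos l with rfl | h
    · rw [hb0]; exact Nat.cast_nonneg k
    · exact hb l h hl
  have hcomp : IsCompact (closure Ω) := hΩb.isCompact_closure
  -- the jets of `v + t (u - v)`, extended continuously to the closure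
  obtain ⟨Ju, hJu, hJuΩ, hJu1⟩ := hu.exists_jet
  obtain ⟨Jv, hJv, hJvΩ, hJv1⟩ := hv.exists_jet
  set L : ℝ × EuclideanSpace ℝ (Fin n) → Jet n :=
    fun q => Jv q.2 + q.1 • (Ju q.2 - Jv q.2) with hL
  have hLc : ContinuousOn L (Set.univ ×ˢ closure Ω) := by
    have c1 : ContinuousOn (fun q : ℝ × EuclideanSpace ℝ (Fin n) => Ju q.2)
        (Set.univ ×ˢ closure Ω) := hJu.comp continuousOn_snd fun q hq => hq.2
    have c2 : ContinuousOn (fun q : ℝ × EuclideanSpace ℝ (Fin n) => Jv q.2)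
        (Set.univ ×ˢ closure Ω) := hJv.comp continuousOn_snd fun q hq => hq.2
    exact c2.add (continuousOn_fst.smul (c1.sub c2))
  have hL1 : ∀ t x, (L (t, x)).1 = v x + t * (u x - v x) := fun t x => by
    simp [hL, hJu1, hJv1]
  have hLA : ∀ t ∈ Set.Icc (0 : ℝ) 1, ∀ x ∈ Ω,
      jetA (L (t, x)).1 (L (t, x)).2.1 (Matrix.of (L (t, x)).2.2) ∈ matCone (Fin n) k := by
    intro t ht x hx
    have h := jetA_combination_mem_matCone hcard (hvΦ.2.1 x hx) (hupos x hx)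
      (sub_nonneg.2 ht.2) ht.1 (hvA x hx) (huA x hx)
    convert h using 2
    · rw [hL1]; ring
    · funext i
      simp only [hL, hJuΩ x hx, hJvΩ x hx, jetOf, Prod.snd_add, Prod.smul_snd, Prod.snd_sub,
        Prod.fst_add, Prod.smul_fst, Prod.fst_sub, Pi.add_apply, Pi.smul_apply, Pi.sub_apply,
        smul_eq_mul]
      ring
    · ext i j
      simp only [hL, hJuΩ x hx, hJvΩ x hx, jetOf, Prod.snd_add, Prod.smul_snd, Prod.snd_sub,
        Matrix.of_apply, Matrix.add_apply, Matrix.smul_apply,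
        Pi.add_apply, Pi.smul_apply, Pi.sub_apply, smul_eq_mul]
      ring
  -- a bound for the zeroth order coefficient where `v ≤ u`
  obtain ⟨C, hC⟩ : ∃ C, ∀ t ∈ Set.Icc (0 : ℝ) 1, ∀ x ∈ closure Ω, v x ≤ u x →
      |zeroCoeff k α b (L (t, x)).1 (L (t, x)).2.1 (Matrix.of (L (t, x)).2.2)| ≤ C := by
    have hD : IsCompact {x ∈ closure Ω | v x ≤ u x} := by
      refine hcomp.of_isClosed_subset ?_ fun x hx => hx.1
      exact (isClosed_closure.isClosed_le hv.2.1 hu.2.1)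
    have hLD : ContinuousOn L (Set.Icc (0 : ℝ) 1 ×ˢ {x ∈ closure Ω | v x ≤ u x}) :=
      hLc.mono fun q hq => ⟨trivial, hq.2.1⟩
    have hcont := (continuousOn_zeroCoeff (n := n) k α b).comp hLD fun q hq => by
      have e1 := hvpos' q.2 hq.2.1
      have e2 := mul_nonneg hq.1.1 (sub_nonneg.2 hq.2.2)
      change 0 < (L (q.1, q.2)).1
      rw [hL1]; linarith
    obtain ⟨C, hC⟩ := ((isCompact_Icc.prod hD).image_of_continuousOn hcont.norm).bddAbove
    exact ⟨C, fun t ht x hx hvu => hC ⟨(t, x), ⟨ht, hx, hvu⟩, rfl⟩⟩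
  have hC0 : 0 ≤ C := (abs_nonneg _).trans
    (hC 0 ⟨le_rfl, zero_le_one⟩ x₀ (subset_closure hx₀) hlt.le)
  -- near `(0, x₀)` the derivative of the integral has a strictly negative contribution
  set S : Jet n → ℝ := fun J => J.1 ^ (α - 1) * sig (jetA J.1 J.2.1 (Matrix.of J.2.2)) k with hS
  have hS0 : ∀ t ∈ Set.Icc (0 : ℝ) 1, ∀ x ∈ Ω, v x ≤ u x → 0 ≤ S (L (t, x)) := by
    intro t ht x hx hvu
    refine mul_nonneg (Real.rpow_nonneg ?_ _) ((hLA t ht x hx).2 k le_rfl)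
    rw [hL1]
    exact add_nonneg (hvΦ.2.1 x hx).le (mul_nonneg ht.1 (sub_nonneg.2 hvu))
  have hL0 : L (0, x₀) = jetOf v x₀ := by simp [hL, hJvΩ x₀ hx₀]
  set P := S (L (0, x₀)) with hP
  have hPpos : 0 < P := by
    rw [hP, hL0]
    exact mul_pos (Real.rpow_pos_of_pos (hvΦ.2.1 x₀ hx₀) _) hσ
  set φ₀ := u x₀ - v x₀ with hφ₀
  have hφ₀pos : 0 < φ₀ := sub_pos.2 hlt
  obtain ⟨r, hr, hnear⟩ : ∃ r > 0, ∀ q : ℝ × EuclideanSpace ℝ (Fin n), dist q (0, x₀) < r →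
      q.2 ∈ Ω ∧ P / 2 < S (L q) ∧ φ₀ / 2 < u q.2 - v q.2 := by
    refine Metric.eventually_nhds_iff.1 ?_
    have hcl : closure Ω ∈ 𝓝 x₀ := mem_of_superset (hΩ.mem_nhds hx₀) subset_closure
    have hsnd : Tendsto (fun q : ℝ × EuclideanSpace ℝ (Fin n) => q.2) (𝓝 (0, x₀)) (𝓝 x₀) :=
      continuous_snd.tendsto' _ _ rfl
    have hLat : ContinuousAt L (0, x₀) := hLc.continuousAt (prod_mem_nhds univ_mem hcl)
    have hSat : ContinuousAt S (L (0, x₀)) := by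
      refine ((continuousOn_jet_rpow _).mul (continuous_jet_sig k).continuousOn).continuousAt
        (isOpen_jet_pos.mem_nhds ?_)
      show 0 < (L (0, x₀)).1
      rw [hL0]; exact hvΦ.2.1 x₀ hx₀
    have hSL : ContinuousAt (fun q => S (L q)) (0, x₀) := hSat.comp hLat
    have hd : ContinuousAt (fun x => u x - v x) x₀ :=
      (hu.2.1.continuousAt hcl).sub (hv.2.1.continuousAt hcl)
    filter_upwards [hsnd.eventually (hΩ.mem_nhds hx₀),
      hSL.eventually (lt_mem_nhds (half_lt_self hPpos)),
      (hd.tendsto.comp hsnd).eventually (lt_mem_nhds (half_lt_self hφ₀pos))] with q e1 e2 e3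
    exact ⟨e1, e2, e3⟩
  set B := Metric.ball x₀ r with hB
  set τ := min (r / 2) 1 with hτ
  have hτ0 : 0 < τ := lt_min (by linarith) one_pos
  have hτ1 : τ ≤ 1 := min_le_right _ _
  have hnear' : ∀ t ∈ Set.Icc (0 : ℝ) τ, ∀ x ∈ B,
      x ∈ Ω ∧ P / 2 < S (L (t, x)) ∧ φ₀ / 2 < u x - v x := fun t ht x hx => by
    refine hnear (t, x) ?_
    rw [Prod.dist_eq, max_lt_iff]
    refine ⟨?_, hx⟩
    rw [Real.dist_eq, sub_zero, abs_of_nonneg ht.1]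
    linarith [ht.2.trans (min_le_left (r / 2) 1)]
  have hBΩ : B ⊆ Ω := fun x hx => (hnear' 0 ⟨le_rfl, hτ0.le⟩ x hx).1
  set κ₀ := b 0 * (α + k + (α + n + 1) * k) - 2 * k * b 1 with hκ₀
  set κ := -κ₀ * (φ₀ / 4) * (P / 2) with hκ
  have hκpos : 0 < κ := mul_pos (mul_pos (neg_pos.2 h1) (by linarith)) (by linarith)
  have hΩfin : volume Ω ≠ ⊤ := hΩb.measure_lt_top.ne
  have hBfin : volume B ≠ ⊤ := Metric.isBounded_ball.measure_lt_top.ne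
  have hBpos : 0 < volume.real B :=
    ENNReal.toReal_pos (Metric.measure_ball_pos volume x₀ hr).ne' hBfin
  -- the truncation level
  set E := κ * volume.real B * τ with hE
  have hEpos : 0 < E := mul_pos (mul_pos hκpos hBpos) hτ0
  set V := C * volume.real Ω with hV
  have hV0 : 0 ≤ V := mul_nonneg hC0 measureReal_nonneg
  set δ := min (φ₀ / 8) (E / (4 * (V + 1))) with hδ
  have hδ0 : 0 < δ := lt_min (by linarith) (by positivity)
  have hδφ : δ ≤ φ₀ / 8 := min_le_left _ _
  have hδE : 2 * δ * V < E := by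
    have : δ * (4 * (V + 1)) ≤ E := (le_div_iff₀ (by positivity)).1 (min_le_right _ _)
    nlinarith
  obtain ⟨G, Γ, hG, hΓ, hGn, hG', hGδ, hΓn⟩ := exists_truncation hδ0
  set K := {x ∈ closure Ω | δ ≤ u x - v x} with hK
  have hKc : IsCompact K := by
    refine hcomp.of_isClosed_subset ?_ fun x hx => hx.1
    exact (isClosed_closure.isClosed_le continuousOn_const (hu.2.1.sub hv.2.1))
  have hKΩ : K ⊆ Ω := fun x hx => by
    by_contra hxΩ
    have := hbdry x (by rw [hΩ.frontier_eq]; exact ⟨hx.1, hxΩ⟩)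
    linarith [hx.2]
  obtain ⟨w, φ, hw, hw1, hφ, hφc, hwφ, hwK, hφK, hφle⟩ :=
    exists_global_extension hKc hΩ hKΩ hu.1 hv.1 hupos hvΦ.2.1
  have hφmem : ∀ x, δ < φ x → x ∈ K := fun x hx => by
    obtain ⟨m1, m2⟩ := hφle x (hδ0.trans hx)
    exact ⟨subset_closure m1, hx.le.trans m2⟩
  have hjw : ∀ x ∈ K, jetOf w x = Jv x := fun x hx => by
    rw [jetOf_congr (hwK x hx), hJvΩ x (hKΩ hx)]
  have hjφ : ∀ x ∈ K, jetOf φ x = Ju x - Jv x := fun x hx => by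
    have hxn := hΩ.mem_nhds (hKΩ hx)
    have h := jetOf_linear (hu.1.contDiffAt hxn) (hv.1.contDiffAt hxn) 1 (-1)
    rw [jetOf_congr (hφK x hx), hJuΩ x (hKΩ hx), hJvΩ x (hKΩ hx)]
    simpa [← sub_eq_add_neg] using h
  obtain ⟨hint, hcont, hder⟩ := hasDerivAt_integral_psiJet k α b hG hΓ (hGδ 0 hδ0.le).1
    (hGδ 0 hδ0.le).2.2 hw hw1 hφ hφc hwφ
  -- pointwise bounds for the integrand of the first variation
  have hlow : ∀ t x, φ x ≤ δ → variationIntegrand k α b G Γ (fun x => w x + t * φ x) φ x = 0 := by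
    intro t x hx
    obtain ⟨m1, m2, m3⟩ := hGδ _ hx
    simp [variationIntegrand, m1, m2, m3]
  have hhigh : ∀ t ∈ Set.Icc (0 : ℝ) 1, ∀ x, δ < φ x →
      variationIntegrand k α b G Γ (fun x => w x + t * φ x) φ x ≤
        2 * δ * C + Γ (φ x) * (κ₀ * S (L (t, x))) := by
    intro t ht x hx
    have hxK := hφmem x hx
    have hj : jetOf (fun x => w x + t * φ x) x = L (t, x) := by
      have := jetOf_linear (x := x) hw.contDiffAt hφ.contDiffAt 1 t
      rw [hjw x hxK, hjφ x hxK] at this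
      simpa using this
    have hA := hLA t ht x (hKΩ hxK)
    have hz := hC t ht x hxK.1 (by linarith [hxK.2])
    rw [← hj] at hA hz ⊢
    obtain ⟨m1, -, m3⟩ := hΓn (φ x) (hδ0.trans hx).le
    exact variationIntegrand_le hk hkn α b hbn h2 h3 h4 (hwφ t ht x) hA (hG' _) m1 m3 hz
  have hbound : ∀ t ∈ Set.Icc (0 : ℝ) 1, ∀ x,
      variationIntegrand k α b G Γ (fun x => w x + t * φ x) φ x ≤
        Ω.indicator (fun _ => 2 * δ * C) x := by
    intro t ht x
    rcases le_or_gt (φ x) δ with hx | hx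
    · rw [hlow t x hx]
      exact Set.indicator_nonneg (fun _ _ => by positivity) x
    · have hxK := hφmem x hx
      rw [Set.indicator_of_mem (hKΩ hxK)]
      refine (hhigh t ht x hx).trans (add_le_of_nonpos_right ?_)
      exact mul_nonpos_of_nonneg_of_nonpos (hΓn (φ x) (hδ0.trans hx).le).1
        (mul_nonpos_of_nonpos_of_nonneg h1.le (hS0 t ht x (hKΩ hxK) (by linarith [hxK.2])))
  have hboundB : ∀ t ∈ Set.Icc (0 : ℝ) τ, ∀ x,
      variationIntegrand k α b G Γ (fun x => w x + t * φ x) φ x ≤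
        Ω.indicator (fun _ => 2 * δ * C) x - B.indicator (fun _ => κ) x := by
    intro t ht x
    have ht1 : t ∈ Set.Icc (0 : ℝ) 1 := ⟨ht.1, ht.2.trans hτ1⟩
    by_cases hxB : x ∈ B
    · obtain ⟨m1, m2, m3⟩ := hnear' t ht x hxB
      have hxK : x ∈ K := ⟨subset_closure m1, by linarith⟩
      have hφx : φ x = u x - v x := (hφK x hxK).self_of_nhds
      have hδx : δ < φ x := by rw [hφx]; linarith
      rw [Set.indicator_of_mem m1, Set.indicator_of_mem hxB]
      refine (hhigh t ht1 x hδx).trans ?_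
      have hΓx : φ₀ / 4 ≤ Γ (φ x) := by
        refine le_trans ?_ (hΓn (φ x) (hδ0.trans hδx).le).2.1
        rw [hφx]; linarith
      have := mul_le_mul hΓx m2.le (by linarith) (by linarith)
      have := mul_le_mul_of_nonpos_left this h1.le
      rw [hκ]
      linarith
    · rw [Set.indicator_of_notMem hxB, sub_zero]
      exact hbound t ht1 x
  have iΩ : Integrable (Ω.indicator fun _ => 2 * δ * C) :=
    (integrable_indicator_iff hΩ.measurableSet).2 (integrableOn_const hΩfin)
  have iB : Integrable (B.indicator fun _ => κ) :=
    (integrable_indicator_iff measurableSet_ball).2 (integrableOn_const hBfin)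
  have eΩ : ∫ x, Ω.indicator (fun _ => 2 * δ * C) x = 2 * δ * V := by
    rw [integral_indicator_const _ hΩ.measurableSet, smul_eq_mul, hV]; ring
  have eB : ∫ x, B.indicator (fun _ => κ) x = κ * volume.real B := by
    rw [integral_indicator_const _ measurableSet_ball, smul_eq_mul]; ring
  set I : ℝ → ℝ := fun t => ∫ x, G (φ x) * psiJet k α b (jetOf w x + t • jetOf φ x) with hI
  have d1 : I τ - I 0 ≤ (2 * δ * V - κ * volume.real B) * (τ - 0) := by
    refine (convex_Icc 0 τ).image_sub_le_mul_sub_of_deriv_le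
      (hcont.mono (Set.Icc_subset_Icc_right hτ1)) ?_ ?_ 0 ⟨le_rfl, hτ0.le⟩ τ ⟨hτ0.le, le_rfl⟩ hτ0.le
    · rw [interior_Icc]
      intro t ht
      exact (hder t ⟨ht.1, ht.2.trans_le hτ1⟩).2.differentiableAt.differentiableWithinAt
    · rw [interior_Icc]
      intro t ht
      obtain ⟨hi, hd⟩ := hder t ⟨ht.1, ht.2.trans_le hτ1⟩
      rw [hd.deriv, ← eΩ, ← eB, ← integral_sub iΩ iB]
      exact integral_mono hi (iΩ.sub iB) (hboundB t ⟨ht.1.le, ht.2.le⟩)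
  have d2 : I 1 - I τ ≤ 2 * δ * V * (1 - τ) := by
    refine (convex_Icc τ 1).image_sub_le_mul_sub_of_deriv_le
      (hcont.mono (Set.Icc_subset_Icc_left hτ0.le)) ?_ ?_ τ ⟨le_rfl, hτ1⟩ 1 ⟨hτ1, le_rfl⟩ hτ1
    · rw [interior_Icc]
      intro t ht
      exact (hder t ⟨hτ0.trans ht.1, ht.2⟩).2.differentiableAt.differentiableWithinAt
    · rw [interior_Icc]
      intro t ht
      obtain ⟨hi, hd⟩ := hder t ⟨hτ0.trans ht.1, ht.2⟩
      rw [hd.deriv, ← eΩ]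
      exact integral_mono hi iΩ (hbound t ⟨(hτ0.trans ht.1).le, ht.2.le⟩)
  have d3 : I 0 ≤ I 1 := by
    refine integral_mono (hint 0 ⟨le_rfl, zero_le_one⟩) (hint 1 ⟨zero_le_one, le_rfl⟩) fun x => ?_
    rcases le_or_gt (φ x) δ with hx | hx
    · simp [(hGδ _ hx).1]
    · have hxK := hφmem x hx
      have hxΩ := hKΩ hxK
      have hxn := hΩ.mem_nhds hxΩ
      refine mul_le_mul_of_nonneg_left ?_ (hGn _)
      rw [hjw x hxK, hjφ x hxK, zero_smul, add_zero, one_smul, add_sub_cancel, hJuΩ x hxΩ,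
        hJvΩ x hxΩ]
      have := hψ x hxΩ
      rwa [psi_eq_psiJ k α b (hu.1.contDiffAt hxn), psi_eq_psiJ k α b (hv.1.contDiffAt hxn)] at this
  linarith
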